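/- Let $n\ge 4$, let $(M,c)$ be a smooth $n$-manifold with a flat conformal structure (that is, $c$ is a conformal class of smooth Riemannian metrics, and around every point of $M$ there is a smooth chart in which the metrics of $c$ are positive multiples of the Euclidean metric), and let $(B,c')$ be a smooth $(n-1)$-manifold with a conformal structure. Let $\sigma:M\to B$ be a smooth submersion; its one-dimensional fibres are the lines of a flow. A tangent vector of $M$ is called vertical if it lies in $\ker d\sigma$ and horizontal if it is orthogonal to $\ker d\sigma$ (a notion that depends only on $c$). Suppose that the flow is conformally rigid, i.e. that $\sigma$ is a conformal submersion: for $g\in c$, $h\in c'$ and every $p\in M$ there is $r(p)>0$ with $h(d\sigma\,x,d\sigma\,y)=r(p)\,g(x,y)$ for all horizontal $x,y\in T_pM$. For $g\in c$ the rotation of the flow is the skew form $M(X,Y)=\tfrac12\, g(u,[X,Y])$ on horizontal vectors, where $u$ is a $g$-unit vertical vector and $X,Y$ are extended to smooth horizontal vector fields. Let $p\in M$ be a point at which the rotation is nonzero for some representative metric $g\in c$. Then the flow is conformally isometric near $p$: there are an open neighbourhood $U$ of $p$ and a smooth, nowhere vanishing vertical vector field $V$ on $U$ that is a conformal Killing field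 of $c$, i.e. for every $g\in c$ there is a function $\varphi$ with $\mathcal L_V g=2\varphi g$ on $U$. In particular, if the rotation vanishes nowhere, then the flow is locally, around every point of $M$, generated by a conformal Killing field. -/

import Mathlib

open scoped Manifold ContDiff

noncomputable section

namespace FlatConformalFlow

/-- A smooth Riemannian metric on the `n`-manifold `M`; `g.inner p` is the inner product on the
tangent space at `p`. -/
abbrev Metric (n : ℕ) (M : Type*) [TopologicalSpace M]
    [ChartedSpace (EuclideanSpace ℝ (Fin n)) M] [IsManifold (𝓡 n) ∞ M] :=
  Bundle.ContMDiffRiemannianMetric (𝓡 n) ∞ (EuclideanSpace ℝ (Fin n))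
    (fun p : M => TangentSpace (𝓡 n) p)

section Conformal

variable (n : ℕ) (M : Type*) [TopologicalSpace M]
  [ChartedSpace (EuclideanSpace ℝ (Fin n)) M] [IsManifold (𝓡 n) ∞ M]

/-- Two metrics are conformally equivalent if they differ by a positive smooth factor. -/
instance conformalSetoid : Setoid (Metric n M) where
  r g g' := ∃ Λ : M → ℝ, ContMDiff (𝓡 n) 𝓘(ℝ, ℝ) ∞ Λ ∧ (∀ p, 0 < Λ p) ∧
    ∀ (p : M) (v w : TangentSpace (𝓡 n) p), g'.inner p v w = Λ p * g.inner p v w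
  iseqv :=
    { refl := fun g => ⟨fun _ => 1, contMDiff_const, fun _ => one_pos, fun p v w => by simp⟩
      symm := by
        rintro g g' ⟨Λ, hΛ, hpos, h⟩
        refine ⟨fun p => (Λ p)⁻¹, hΛ.inv₀ fun p => (hpos p).ne', fun p => inv_pos.2 (hpos p), ?_⟩
        intro p v w
        rw [h p v w, inv_mul_cancel_left₀ (hpos p).ne']
      trans := by
        rintro g₁ g₂ g₃ ⟨Λ, hΛ, hpos, h⟩ ⟨Λ', hΛ', hpos', h'⟩
        refine ⟨fun p => Λ' p * Λ p, hΛ'.mul hΛ, fun p => mul_pos (hpos' p) (hpos p), ?_⟩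
        intro p v w
        rw [h' p v w, h p v w, mul_assoc] }

/-- A conformal structure on `M`: a conformal class of smooth Riemannian metrics. -/
def ConformalStructure : Type _ := Quotient (conformalSetoid n M)

variable {n M}

/-- `g` is a representative of the conformal structure `c`. -/
def Represents (g : Metric n M) (c : ConformalStructure n M) : Prop :=
  Quotient.mk (conformalSetoid n M) g = c

/-- The conformal structure `c` is flat: around every point there is a smooth chart in which the
representatives of `c` are positive multiples of the Euclidean metric. -/
def ConformalStructure.IsFlat (c : ConformalStructure n M) : Prop :=
  ∀ g : Metric n M, Represents g c → ∀ p : M,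
    ∃ e ∈ IsManifold.maximalAtlas (𝓡 n) ∞ M, p ∈ e.source ∧
      ∀ q ∈ e.source, ∃ r : ℝ, 0 < r ∧ ∀ v w : TangentSpace (𝓡 n) q,
        g.inner q v w = r * inner (E := EuclideanSpace ℝ (Fin n)) ℝ
          (mfderiv (𝓡 n) (𝓡 n) e q v) (mfderiv (𝓡 n) (𝓡 n) e q w)

/-- The vector field `X` is smooth on the set `U`. -/
def SmoothFieldOn (X : (p : M) → TangentSpace (𝓡 n) p) (U : Set M) : Prop :=
  ContMDiffOn (𝓡 n) (𝓡 n).tangent ∞ (fun p => (⟨p, X p⟩ : TangentBundle (𝓡 n) M)) U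

/-- The derivative of the function `f` at `p` in the direction `v`. -/
def dirDeriv (f : M → ℝ) (p : M) (v : TangentSpace (𝓡 n) p) : ℝ :=
  mfderiv (𝓡 n) 𝓘(ℝ, ℝ) f p v

/-- `(ℒ_V g)(X, Y) = V(g(X, Y)) - g([V, X], Y) - g(X, [V, Y])` at the point `p`. -/
def lieDerivMetric (g : Metric n M) (V X Y : (p : M) → TangentSpace (𝓡 n) p) (p : M) : ℝ :=
  dirDeriv (fun q => g.inner q (X q) (Y q)) p (V p)
    - g.inner p (VectorField.mlieBracket (𝓡 n) V X p) (Y p)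
    - g.inner p (X p) (VectorField.mlieBracket (𝓡 n) V Y p)

/-- `V` is a conformal Killing field of the conformal structure `c` on the open set `U`: it is
smooth on `U`, and for every representative `g` one has `ℒ_V g = 2 φ g` on `U` for some
function `φ`. -/
def IsConformalKillingOn (c : ConformalStructure n M) (V : (p : M) → TangentSpace (𝓡 n) p)
    (U : Set M) : Prop :=
  SmoothFieldOn V U ∧ ∀ g : Metric n M, Represents g c → ∃ φ : M → ℝ,
    ∀ X Y : (p : M) → TangentSpace (𝓡 n) p, SmoothFieldOn X U → SmoothFieldOn Y U →
      ∀ p ∈ U, lieDerivMetric g V X Y p = 2 * φ p * g.inner p (X p) (Y p)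

end Conformal

section Flow

variable {m : ℕ} {M : Type*} [TopologicalSpace M]
  [ChartedSpace (EuclideanSpace ℝ (Fin (m + 1))) M] [IsManifold (𝓡 (m + 1)) ∞ M]
  {B : Type*} [TopologicalSpace B]
  [ChartedSpace (EuclideanSpace ℝ (Fin m)) B] [IsManifold (𝓡 m) ∞ B]

/-- A flow: a smooth submersion with one-dimensional fibres. The flow lines are
the fibres. -/
def IsFlow (σ : M → B) : Prop :=
  ContMDiff (𝓡 (m + 1)) (𝓡 m) ∞ σ ∧
    ∀ p, Function.Surjective (mfderiv (𝓡 (m + 1)) (𝓡 m) σ p)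

/-- `v ∈ T_p M` is vertical, that is, tangent to the fibre of `σ` through `p`. -/
def IsVertical (σ : M → B) (p : M) (v : TangentSpace (𝓡 (m + 1)) p) : Prop :=
  mfderiv (𝓡 (m + 1)) (𝓡 m) σ p v = 0

/-- `x ∈ T_p M` is horizontal, that is, `g`-orthogonal to the fibre of `σ` through `p`. -/
def IsHorizontal (g : Metric (m + 1) M) (σ : M → B) (p : M)
    (x : TangentSpace (𝓡 (m + 1)) p) : Prop :=
  ∀ v : TangentSpace (𝓡 (m + 1)) p, IsVertical σ p v → g.inner p x v = 0

/-- The flow `σ` is conformally rigid: it is a conformal submersion from `(M, c)` to `(B, c')`,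
that is, its differential preserves the inner product of horizontal vectors up to a positive
factor depending only on the point of `M`. -/
def IsConformallyRigid (c : ConformalStructure (m + 1) M) (c' : ConformalStructure m B)
    (σ : M → B) : Prop :=
  ∀ (g : Metric (m + 1) M) (h : Metric m B), Represents g c → Represents h c' →
    ∀ p : M, ∃ r : ℝ, 0 < r ∧ ∀ x y : TangentSpace (𝓡 (m + 1)) p,
      IsHorizontal g σ p x → IsHorizontal g σ p y →
        h.inner (σ p) (mfderiv (𝓡 (m + 1)) (𝓡 m) σ p x)
          (mfderiv (𝓡 (m + 1)) (𝓡 m) σ p y) = r * g.inner p x y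

/-- The rotation `M(X, Y) = ½ g(u, [X, Y])` of the flow at `p`, for horizontal fields `X`, `Y`
and a unit vertical vector `u` at `p`. -/
def rotation (g : Metric (m + 1) M) (p : M) (u : TangentSpace (𝓡 (m + 1)) p)
    (X Y : (q : M) → TangentSpace (𝓡 (m + 1)) q) : ℝ :=
  1 / 2 * g.inner p u (VectorField.mlieBracket (𝓡 (m + 1)) X Y p)

/-- The rotation of the flow `σ` with respect to the metric `g` is nonzero at `p`. -/
def RotationNeZeroAt (g : Metric (m + 1) M) (σ : M → B) (p : M) : Prop :=
  ∃ u : TangentSpace (𝓡 (m + 1)) p, IsVertical σ p u ∧ g.inner p u u = 1 ∧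
    ∃ U : Set M, IsOpen U ∧ p ∈ U ∧ ∃ X Y : (q : M) → TangentSpace (𝓡 (m + 1)) q,
      SmoothFieldOn X U ∧ SmoothFieldOn Y U ∧
      (∀ q ∈ U, IsHorizontal g σ q (X q) ∧ IsHorizontal g σ q (Y q)) ∧
      rotation g p u X Y ≠ 0

/-- The flow `σ` is conformally isometric near `p`: on a neighbourhood of `p` the flow lines are
the integral curves of a nowhere vanishing conformal Killing field. -/
def IsConformallyIsometricAt (c : ConformalStructure (m + 1) M) (σ : M → B) (p : M) : Prop :=
  ∃ U : Set M, IsOpen U ∧ p ∈ U ∧ ∃ V : (q : M) → TangentSpace (𝓡 (m + 1)) q,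
    (∀ q ∈ U, V q ≠ 0 ∧ IsVertical σ q (V q)) ∧ IsConformalKillingOn c V U

end Flow

end FlatConformalFlow

end

set_option linter.unusedSimpArgs false
set_option linter.unusedSectionVars false

/-! In a flat chart the problem is Euclidean. Let `u` be a nowhere zero vertical field. The pulled
back metric of `B` is invariant under the flow of `u`, so conformality of the submersion says that
the Lie derivative along `u` of the Euclidean metric is a multiple of that metric on the orthogonal
complement of `u`: the field is shear-free (`exists_shear_factor`). Equivalently there is a one-form
`w`, the coupling form, such that twice the symmetric part of `Du`, plus `w ⊗ u + u ⊗ w`, is `2φ`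
times the inner product (`symm_form_eq`). Replacing `u` by `e^F u` replaces `w` by `w - dF`, and `w
= 0` is the conformal Killing equation. Everything therefore reduces to `dw = 0`: then `w = dF` on a
ball and `e^F u` is the required field (`exists_conformalKilling_scale`).

The equation persists if only directions in a four-dimensional subspace are used and `u` is replaced
by its projection to that subspace. Subspaces containing `u x₀`, two horizontal vectors with nonzero
rotation and one further vector detect all of `dw` (`fderiv_symm_of_rotation`), so dimension four
suffices. There the projected field may be normalised, which changes `w` by an exact form.

In dimension four the frame `u, iu, ju, ku` arises from `u` by constant linear maps, so its
structure functions are just the entries of `Du`: the dilation `a = w(u)`, the rotation vector `m`,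
and the acceleration `k`, with `w = -k` on horizontal vectors. Flatness is the commutation of the
partial derivatives. The components of `dw` are `F` (mixed) and `2e` (horizontal). Commutators
applied to `u`, then to `m` and `k`, then to `e` and `F`, leave after elimination of the highest
derivatives an algebraic identity: `m ⊙ N` and `λ ⊙ e` have equal trace-free parts
(`cotton_offDiag`, `cotton_diag`), where `λ` is the horizontal gradient of `a` plus `k × m` and `N`
is its derivative along `u`.

Since `m` vanishes nowhere, this forces `dw = 0`. Where `m × e ≠ 0`, the identity makes `λ` parallel
to `m`, its `u`-derivative then gives `λ = 0`, and the derivative of `λ = 0` gives `e = 0`, a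
contradiction. Hence `m × e = 0` everywhere; its divergence yields `(m·λ) e = 0`, and
differentiating `m·λ` along `m` where `e ≠ 0` gives `e = 0`. Finally the derivative of `e = 0` gives
`F = 0`. -/

namespace FlatConformalFlow

/-! ### Structure equations of a shear-free field in dimension four -/

/-- The differential-algebraic data of a shear-free unit field `u` on an open subset of the
quaternions: derivations along the frame `u, i u, j u, k u`, the components of `u`, and the
components of its derivative. -/
structure ShearFreeFrame (R : Type*) [CommRing R] [Algebra ℝ R] where
  (d0 d1 d2 d3 : Derivation ℝ R R)
  (u0 u1 u2 u3 a m1 m2 m3 k1 k2 k3 : R)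
  unit : u0 * u0 + u1 * u1 + u2 * u2 + u3 * u3 = 1
  d0u0 : d0 u0 = -k1 * u1 - k2 * u2 - k3 * u3
  d0u1 : d0 u1 = k1 * u0 + k2 * u3 - k3 * u2
  d0u2 : d0 u2 = -k1 * u3 + k2 * u0 + k3 * u1
  d0u3 : d0 u3 = k1 * u2 - k2 * u1 + k3 * u0
  d1u0 : d1 u0 = -a * u1 - m3 * u2 + m2 * u3
  d1u1 : d1 u1 = a * u0 + m3 * u3 + m2 * u2
  d1u2 : d1 u2 = -a * u3 + m3 * u0 - m2 * u1
  d1u3 : d1 u3 = a * u2 - m3 * u1 - m2 * u0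
  d2u0 : d2 u0 = m3 * u1 - a * u2 - m1 * u3
  d2u1 : d2 u1 = -m3 * u0 + a * u3 - m1 * u2
  d2u2 : d2 u2 = m3 * u3 + a * u0 + m1 * u1
  d2u3 : d2 u3 = -m3 * u2 - a * u1 + m1 * u0
  d3u0 : d3 u0 = -m2 * u1 + m1 * u2 - a * u3
  d3u1 : d3 u1 = m2 * u0 - m1 * u3 - a * u2
  d3u2 : d3 u2 = -m2 * u3 - m1 * u0 + a * u1
  d3u3 : d3 u3 = m2 * u2 + m1 * u1 + a * u0
  c01 : ∀ f, d0 (d1 f) - d1 (d0 f) =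
    -k1 * d0 f - a * d1 f + (k2 + m2) * d3 f - (k3 + m3) * d2 f
  c02 : ∀ f, d0 (d2 f) - d2 (d0 f) =
    -k2 * d0 f - a * d2 f + (k3 + m3) * d1 f - (k1 + m1) * d3 f
  c03 : ∀ f, d0 (d3 f) - d3 (d0 f) =
    -k3 * d0 f - a * d3 f + (k1 + m1) * d2 f - (k2 + m2) * d1 f
  c12 : ∀ f, d1 (d2 f) - d2 (d1 f) = -2 * m3 * d0 f - 2 * a * d3 f + m1 * d2 f - m2 * d1 f
  c23 : ∀ f, d2 (d3 f) - d3 (d2 f) = -2 * m1 * d0 f - 2 * a * d1 f + m2 * d3 f - m3 * d2 f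
  c31 : ∀ f, d3 (d1 f) - d1 (d3 f) = -2 * m2 * d0 f - 2 * a * d2 f + m3 * d1 f - m1 * d3 f

namespace ShearFreeFrame

variable {R : Type*} [CommRing R] [Algebra ℝ R] (S : ShearFreeFrame R)

/-- The frame obtained by permuting the imaginary units cyclically. -/
def rot : ShearFreeFrame R where
  d0 := S.d0
  d1 := S.d2
  d2 := S.d3
  d3 := S.d1
  u0 := S.u0
  u1 := S.u2
  u2 := S.u3
  u3 := S.u1
  a := S.a
  m1 := S.m2
  m2 := S.m3
  m3 := S.m1
  k1 := S.k2
  k2 := S.k3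
  k3 := S.k1
  unit := by linear_combination S.unit
  d0u0 := by rw [S.d0u0]; ring
  d0u1 := by rw [S.d0u2]; ring
  d0u2 := by rw [S.d0u3]; ring
  d0u3 := by rw [S.d0u1]; ring
  d1u0 := by rw [S.d2u0]; ring
  d1u1 := by rw [S.d2u2]; ring
  d1u2 := by rw [S.d2u3]; ring
  d1u3 := by rw [S.d2u1]; ring
  d2u0 := by rw [S.d3u0]; ring
  d2u1 := by rw [S.d3u2]; ring
  d2u2 := by rw [S.d3u3]; ring
  d2u3 := by rw [S.d3u1]; ring
  d3u0 := by rw [S.d1u0]; ring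
  d3u1 := by rw [S.d1u2]; ring
  d3u2 := by rw [S.d1u3]; ring
  d3u3 := by rw [S.d1u1]; ring
  c01 := S.c02
  c02 := S.c03
  c03 := S.c01
  c12 := S.c23
  c23 := S.c31
  c31 := S.c12

/-- The gradient-like horizontal vector `λ`, first component. -/
def L1 : R := S.d1 S.a + S.k2 * S.m3 - S.k3 * S.m2
def L2 : R := S.rot.L1
def L3 : R := S.rot.rot.L1
/-- Half of the horizontal curvature of the coupling form, first component. -/
def e1 : R := -S.d0 S.m1 - S.a * S.m1 + S.k2 * S.m3 - S.k3 * S.m2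
def e2 : R := S.rot.e1
def e3 : R := S.rot.rot.e1
/-- The mixed curvature of the coupling form, first component. -/
def F1 : R := -S.d0 S.k1 - S.L1
def F2 : R := S.rot.F1
def F3 : R := S.rot.rot.F1
-- The unknown shared by the three diagonal derivatives `d1 k1`, `d2 k2`, `d3 k3`. It is invariant
-- under the cyclic rotation, so one name serves for all three.
def c : R := S.d0 S.a + S.a * S.a - (S.m1 * S.m1 + S.m2 * S.m2 + S.m3 * S.m3)

lemma rot_c : S.rot.c = S.c := by simp only [c, rot]; ring

lemma d1a : S.d1 S.a = S.L1 - S.k2 * S.m3 + S.k3 * S.m2 := by simp only [L1]; ring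
lemma d2a : S.d2 S.a = S.L2 - S.k3 * S.m1 + S.k1 * S.m3 := S.rot.d1a
lemma d3a : S.d3 S.a = S.L3 - S.k1 * S.m2 + S.k2 * S.m1 := S.rot.rot.d1a
lemma d0a : S.d0 S.a = S.c - S.a * S.a + S.m1 * S.m1 + S.m2 * S.m2 + S.m3 * S.m3 := by
  simp only [c]; ring
lemma d0m1 : S.d0 S.m1 = -S.e1 - S.a * S.m1 + S.k2 * S.m3 - S.k3 * S.m2 := by
  simp only [e1]; ring
lemma d0m2 : S.d0 S.m2 = -S.e2 - S.a * S.m2 + S.k3 * S.m1 - S.k1 * S.m3 := S.rot.d0m1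
lemma d0m3 : S.d0 S.m3 = -S.e3 - S.a * S.m3 + S.k1 * S.m2 - S.k2 * S.m1 := S.rot.rot.d0m1
lemma d0k1 : S.d0 S.k1 = -S.F1 - S.L1 := by simp only [F1]; ring
lemma d0k2 : S.d0 S.k2 = -S.F2 - S.L2 := S.rot.d0k1
lemma d0k3 : S.d0 S.k3 = -S.F3 - S.L3 := S.rot.rot.d0k1

/-- Nonzero integers are units in an algebra over the reals. -/
lemma cancel {R : Type*} [CommRing R] [Algebra ℝ R] {x y : R} (n : ℕ) (hn : n ≠ 0) (h : (n : R) * x = n * y) : x = y := by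
  have hu : IsUnit (n : R) := by
    have := (IsUnit.mk0 (n : ℝ) (Nat.cast_ne_zero.2 hn)).map (algebraMap ℝ R)
    simpa using this
  exact hu.mul_left_cancel h

/-! ### First derivatives of rotation and acceleration, from commutators on `u` -/

section FirstOrder

/-- Flatness enters here: the commutator of `d1` and `d2` on the four components of `u` is a vector
equation, whose components along `iu`, `ju`, `ku` give this lemma and the next two. The commutator
of `d0` and `d1` gives the derivatives of `k` likewise, and cyclic rotation supplies the other
directions. -/
lemma d1m3 : S.d1 S.m3 = -S.L2 + S.a * S.m2 + S.k3 * S.m1 + S.k1 * S.m3 - S.m3 * S.m1 := by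
  have h0 := S.c12 S.u0
  have h1 := S.c12 S.u1
  have h2 := S.c12 S.u2
  have h3 := S.c12 S.u3
  simp only [S.d0u0, S.d0u1, S.d0u2, S.d0u3, S.d1u0, S.d1u1, S.d1u2, S.d1u3, S.d2u0, S.d2u1,
    S.d2u2, S.d2u3, S.d3u0, S.d3u1, S.d3u2, S.d3u3, map_add, map_sub, map_neg,
    Derivation.leibniz, smul_eq_mul, neg_mul, S.d2a] at h0 h1 h2 h3
  -- The coefficients are the components of `-iu`; the multiple of `S.unit` accounts for `|u|² = 1`.
  linear_combination S.u1 * h0 - S.u0 * h1 + S.u3 * h2 - S.u2 * h3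
    - (S.d1 S.m3 - (-S.L2 + S.a * S.m2 + S.k3 * S.m1 + S.k1 * S.m3 - S.m3 * S.m1)) * S.unit

lemma d2m3 : S.d2 S.m3 = S.L1 - S.a * S.m1 + S.k2 * S.m3 + S.k3 * S.m2 - S.m2 * S.m3 := by
  have h0 := S.c12 S.u0
  have h1 := S.c12 S.u1
  have h2 := S.c12 S.u2
  have h3 := S.c12 S.u3
  simp only [S.d0u0, S.d0u1, S.d0u2, S.d0u3, S.d1u0, S.d1u1, S.d1u2, S.d1u3, S.d2u0, S.d2u1,
    S.d2u2, S.d2u3, S.d3u0, S.d3u1, S.d3u2, S.d3u3, map_add, map_sub, map_neg,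
    Derivation.leibniz, smul_eq_mul, neg_mul, S.d1a] at h0 h1 h2 h3
  linear_combination S.u2 * h0 - S.u3 * h1 - S.u0 * h2 + S.u1 * h3
    - (S.d2 S.m3 - (S.L1 - S.a * S.m1 + S.k2 * S.m3 + S.k3 * S.m2 - S.m2 * S.m3)) * S.unit

lemma d1m1_add_d2m2 : S.d1 S.m1 + S.d2 S.m2 =
    -2 * S.k3 * S.m3 + S.m1 * S.m1 + S.m2 * S.m2 + 2 * S.m3 * S.m3 := by
  have h0 := S.c12 S.u0
  have h1 := S.c12 S.u1
  have h2 := S.c12 S.u2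
  have h3 := S.c12 S.u3
  simp only [S.d0u0, S.d0u1, S.d0u2, S.d0u3, S.d1u0, S.d1u1, S.d1u2, S.d1u3, S.d2u0, S.d2u1,
    S.d2u2, S.d2u3, S.d3u0, S.d3u1, S.d3u2, S.d3u3, map_add, map_sub, map_neg,
    Derivation.leibniz, smul_eq_mul, neg_mul] at h0 h1 h2 h3
  linear_combination -S.u3 * h0 - S.u2 * h1 + S.u1 * h2 + S.u0 * h3
    - (S.d1 S.m1 + S.d2 S.m2 -
      (-2 * S.k3 * S.m3 + S.m1 * S.m1 + S.m2 * S.m2 + 2 * S.m3 * S.m3)) * S.unit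

lemma d1k1 : S.d1 S.k1 = S.c + S.k1 * S.k1 + S.k2 * S.m2 + S.k3 * S.m3 + S.m1 * S.m1 := by
  have h0 := S.c01 S.u0
  have h1 := S.c01 S.u1
  have h2 := S.c01 S.u2
  have h3 := S.c01 S.u3
  simp only [S.d0u0, S.d0u1, S.d0u2, S.d0u3, S.d1u0, S.d1u1, S.d1u2, S.d1u3, S.d2u0, S.d2u1,
    S.d2u2, S.d2u3, S.d3u0, S.d3u1, S.d3u2, S.d3u3, map_add, map_sub, map_neg,
    Derivation.leibniz, smul_eq_mul, neg_mul, S.d0a] at h0 h1 h2 h3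
  linear_combination S.u1 * h0 - S.u0 * h1 + S.u3 * h2 - S.u2 * h3
    - (S.d1 S.k1 - (S.c + S.k1 * S.k1 + S.k2 * S.m2 + S.k3 * S.m3 + S.m1 * S.m1)) * S.unit

lemma d1k2 : S.d1 S.k2 =
    -S.e3 - S.a * S.k3 + S.a * S.m3 + S.k1 * S.k2 - S.k1 * S.m2 + S.m1 * S.m2 := by
  have h0 := S.c01 S.u0
  have h1 := S.c01 S.u1
  have h2 := S.c01 S.u2
  have h3 := S.c01 S.u3
  simp only [S.d0u0, S.d0u1, S.d0u2, S.d0u3, S.d1u0, S.d1u1, S.d1u2, S.d1u3, S.d2u0, S.d2u1,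
    S.d2u2, S.d2u3, S.d3u0, S.d3u1, S.d3u2, S.d3u3, map_add, map_sub, map_neg,
    Derivation.leibniz, smul_eq_mul, neg_mul, S.d0m3] at h0 h1 h2 h3
  linear_combination S.u2 * h0 - S.u3 * h1 - S.u0 * h2 + S.u1 * h3
    - (S.d1 S.k2 - (-S.e3 - S.a * S.k3 + S.a * S.m3 + S.k1 * S.k2 - S.k1 * S.m2
      + S.m1 * S.m2)) * S.unit

lemma d1k3 : S.d1 S.k3 =
    S.e2 + S.a * S.k2 - S.a * S.m2 + S.k1 * S.k3 - S.k1 * S.m3 + S.m1 * S.m3 := by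
  have h0 := S.c01 S.u0
  have h1 := S.c01 S.u1
  have h2 := S.c01 S.u2
  have h3 := S.c01 S.u3
  simp only [S.d0u0, S.d0u1, S.d0u2, S.d0u3, S.d1u0, S.d1u1, S.d1u2, S.d1u3, S.d2u0, S.d2u1,
    S.d2u2, S.d2u3, S.d3u0, S.d3u1, S.d3u2, S.d3u3, map_add, map_sub, map_neg,
    Derivation.leibniz, smul_eq_mul, neg_mul, S.d0m2] at h0 h1 h2 h3
  linear_combination S.u3 * h0 + S.u2 * h1 - S.u1 * h2 - S.u0 * h3
    - (S.d1 S.k3 - (S.e2 + S.a * S.k2 - S.a * S.m2 + S.k1 * S.k3 - S.k1 * S.m3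
      + S.m1 * S.m3)) * S.unit

lemma d1m1 : S.d1 S.m1 =
    S.k1 * S.m1 - S.k2 * S.m2 - S.k3 * S.m3 + S.m2 * S.m2 + S.m3 * S.m3 := by
  have h1 : S.d1 S.m1 + S.d2 S.m2 = _ := S.d1m1_add_d2m2
  have h2 : S.d2 S.m2 + S.d3 S.m3 =
    -2 * S.k1 * S.m1 + S.m2 * S.m2 + S.m3 * S.m3 + 2 * S.m1 * S.m1 := S.rot.d1m1_add_d2m2
  have h3 : S.d3 S.m3 + S.d1 S.m1 =
    -2 * S.k2 * S.m2 + S.m3 * S.m3 + S.m1 * S.m1 + 2 * S.m2 * S.m2 := S.rot.rot.d1m1_add_d2m2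
  -- The three cyclic pairwise sums determine each summand.
  refine cancel 2 two_ne_zero ?_
  push_cast
  linear_combination h1 - h2 + h3

lemma d2m2 : S.d2 S.m2 =
    S.k2 * S.m2 - S.k3 * S.m3 - S.k1 * S.m1 + S.m3 * S.m3 + S.m1 * S.m1 := S.rot.d1m1
lemma d3m3 : S.d3 S.m3 =
    S.k3 * S.m3 - S.k1 * S.m1 - S.k2 * S.m2 + S.m1 * S.m1 + S.m2 * S.m2 := S.rot.rot.d1m1
lemma d2m1 : S.d2 S.m1 = -S.L3 + S.a * S.m3 + S.k1 * S.m2 + S.k2 * S.m1 - S.m1 * S.m2 :=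
  S.rot.d1m3
lemma d3m2 : S.d3 S.m2 = -S.L1 + S.a * S.m1 + S.k2 * S.m3 + S.k3 * S.m2 - S.m2 * S.m3 :=
  S.rot.rot.d1m3
lemma d3m1 : S.d3 S.m1 = S.L2 - S.a * S.m2 + S.k3 * S.m1 + S.k1 * S.m3 - S.m3 * S.m1 :=
  S.rot.d2m3
lemma d1m2 : S.d1 S.m2 = S.L3 - S.a * S.m3 + S.k1 * S.m2 + S.k2 * S.m1 - S.m1 * S.m2 :=
  S.rot.rot.d2m3
lemma d2k2 : S.d2 S.k2 = S.c + S.k2 * S.k2 + S.k3 * S.m3 + S.k1 * S.m1 + S.m2 * S.m2 := by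
  rw [← S.rot_c]; exact S.rot.d1k1
lemma d3k3 : S.d3 S.k3 = S.c + S.k3 * S.k3 + S.k1 * S.m1 + S.k2 * S.m2 + S.m3 * S.m3 := by
  rw [← S.rot_c]; exact S.rot.d2k2
lemma d2k3 : S.d2 S.k3 =
    -S.e1 - S.a * S.k1 + S.a * S.m1 + S.k2 * S.k3 - S.k2 * S.m3 + S.m2 * S.m3 := S.rot.d1k2
lemma d3k1 : S.d3 S.k1 =
    -S.e2 - S.a * S.k2 + S.a * S.m2 + S.k3 * S.k1 - S.k3 * S.m1 + S.m3 * S.m1 := S.rot.rot.d1k2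
lemma d2k1 : S.d2 S.k1 =
    S.e3 + S.a * S.k3 - S.a * S.m3 + S.k2 * S.k1 - S.k2 * S.m1 + S.m2 * S.m1 := S.rot.d1k3
lemma d3k2 : S.d3 S.k2 =
    S.e1 + S.a * S.k1 - S.a * S.m1 + S.k3 * S.k2 - S.k3 * S.m2 + S.m3 * S.m2 := S.rot.rot.d1k3

end FirstOrder
end ShearFreeFrame
namespace ShearFreeFrame

variable {R : Type*} [CommRing R] [Algebra ℝ R] (S : ShearFreeFrame R)

/-! ### Derivatives of `λ`, `e` and `F`, from commutators on `m` and `k` -/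

section SecondOrder

/-- The horizontal derivatives of `m` are already known and contain `λ` linearly, in antisymmetric
position. Hence a horizontal commutator on a component of `m` becomes an equation for derivatives of
`λ`: here `d3 m2` contains `-L1` while `d2 m2` is free of `λ`. -/
lemma d2L1 : S.d2 S.L1 = 2 * S.L1 * S.k2 + S.L2 * S.k1 - S.L2 * S.m1 + S.L3 * S.a
    + 2 * S.c * S.m3 - 2 * S.e1 * S.m2 - 3 * S.e2 * S.m1 - S.a * S.a * S.m3
    + (S.k1 * S.k1 + S.k2 * S.k2 + S.k3 * S.k3) * S.m3
    + (S.m1 * S.m1 + S.m2 * S.m2 + S.m3 * S.m3) * S.m3 := by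
  have h := S.c23 S.m2
  simp only [S.d0m2, S.d1m2, S.d2m2, S.d3m2, S.d2m3, S.d3m3, S.d2m1, S.d3m1, S.d2k1, S.d2k2,
    S.d2k3, S.d3k1, S.d3k2, S.d3k3, S.d2a, S.d3a, map_add, map_sub, map_neg, Derivation.leibniz,
    smul_eq_mul, neg_mul] at h
  linear_combination -h

lemma d3L1 : S.d3 S.L1 = 2 * S.L1 * S.k3 - S.L2 * S.a + S.L3 * S.k1 - S.L3 * S.m1
    - 2 * S.c * S.m2 - 2 * S.e1 * S.m3 - 3 * S.e3 * S.m1 + S.a * S.a * S.m2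
    - (S.k1 * S.k1 + S.k2 * S.k2 + S.k3 * S.k3) * S.m2
    - (S.m1 * S.m1 + S.m2 * S.m2 + S.m3 * S.m3) * S.m2 := by
  have h := S.c23 S.m3
  simp only [S.d0m3, S.d1m3, S.d2m2, S.d3m2, S.d2m3, S.d3m3, S.d2m1, S.d3m1, S.d2k1, S.d2k2,
    S.d2k3, S.d3k1, S.d3k2, S.d3k3, S.d2a, S.d3a, map_add, map_sub, map_neg, Derivation.leibniz,
    smul_eq_mul, neg_mul] at h
  linear_combination -h

/-- The remaining component of the commutator sees only a sum of two diagonal derivatives; the three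
cyclic sums are separated in `d1L1`. -/
lemma d3L3_sub : S.d3 S.L3 + S.d2 S.L2 = -2 * S.L1 * S.k1 + 2 * S.L1 * S.m1 + S.L2 * S.k2
    + S.L2 * S.m2 + S.L3 * S.k3 + S.L3 * S.m3 + 4 * S.e1 * S.m1 - S.e2 * S.m2
    - S.e3 * S.m3 := by
  have h := S.c23 S.m1
  simp only [S.d0m1, S.d1m1, S.d2m2, S.d3m2, S.d2m3, S.d3m3, S.d2m1, S.d3m1, S.d2k1, S.d2k2,
    S.d2k3, S.d3k1, S.d3k2, S.d3k3, S.d2a, S.d3a, map_add, map_sub, map_neg, Derivation.leibniz,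
    smul_eq_mul, neg_mul] at h
  linear_combination h

lemma d1L1 : S.d1 S.L1 = 2 * S.L1 * S.k1 - S.L2 * S.k2 + S.L2 * S.m2 - S.L3 * S.k3
    + S.L3 * S.m3 - 3 * S.e1 * S.m1 + 2 * S.e2 * S.m2 + 2 * S.e3 * S.m3 := by
  have h1 := S.d3L3_sub
  have h2 : S.d1 S.L1 + S.d3 S.L3 = -2 * S.L2 * S.k2 + 2 * S.L2 * S.m2 + S.L3 * S.k3
    + S.L3 * S.m3 + S.L1 * S.k1 + S.L1 * S.m1 + 4 * S.e2 * S.m2 - S.e3 * S.m3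
    - S.e1 * S.m1 := S.rot.d3L3_sub
  have h3 : S.d2 S.L2 + S.d1 S.L1 = -2 * S.L3 * S.k3 + 2 * S.L3 * S.m3 + S.L1 * S.k1
    + S.L1 * S.m1 + S.L2 * S.k2 + S.L2 * S.m2 + 4 * S.e3 * S.m3 - S.e1 * S.m1
    - S.e2 * S.m2 := S.rot.rot.d3L3_sub
  refine cancel 2 two_ne_zero ?_
  push_cast
  linear_combination h2 + h3 - h1

lemma d2L2 : S.d2 S.L2 = 2 * S.L2 * S.k2 - S.L3 * S.k3 + S.L3 * S.m3 - S.L1 * S.k1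
    + S.L1 * S.m1 - 3 * S.e2 * S.m2 + 2 * S.e3 * S.m3 + 2 * S.e1 * S.m1 := S.rot.d1L1

lemma d3L3 : S.d3 S.L3 = 2 * S.L3 * S.k3 - S.L1 * S.k1 + S.L1 * S.m1 - S.L2 * S.k2
    + S.L2 * S.m2 - 3 * S.e3 * S.m3 + 2 * S.e1 * S.m1 + 2 * S.e2 * S.m2 := S.rot.rot.d1L1

lemma d3L2 : S.d3 S.L2 = 2 * S.L2 * S.k3 + S.L3 * S.k2 - S.L3 * S.m2 + S.L1 * S.a
    + 2 * S.c * S.m1 - 2 * S.e2 * S.m3 - 3 * S.e3 * S.m2 - S.a * S.a * S.m1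
    + (S.k2 * S.k2 + S.k3 * S.k3 + S.k1 * S.k1) * S.m1
    + (S.m2 * S.m2 + S.m3 * S.m3 + S.m1 * S.m1) * S.m1 := by
  rw [← S.rot_c]; exact S.rot.d2L1
lemma d1L3 : S.d1 S.L3 = 2 * S.L3 * S.k1 + S.L1 * S.k3 - S.L1 * S.m3 + S.L2 * S.a
    + 2 * S.c * S.m2 - 2 * S.e3 * S.m1 - 3 * S.e1 * S.m3 - S.a * S.a * S.m2
    + (S.k3 * S.k3 + S.k1 * S.k1 + S.k2 * S.k2) * S.m2
    + (S.m3 * S.m3 + S.m1 * S.m1 + S.m2 * S.m2) * S.m2 := by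
  rw [← S.rot_c]; exact S.rot.d3L2
lemma d1L2 : S.d1 S.L2 = 2 * S.L2 * S.k1 - S.L3 * S.a + S.L1 * S.k2 - S.L1 * S.m2
    - 2 * S.c * S.m3 - 2 * S.e2 * S.m1 - 3 * S.e1 * S.m2 + S.a * S.a * S.m3
    - (S.k2 * S.k2 + S.k3 * S.k3 + S.k1 * S.k1) * S.m3
    - (S.m2 * S.m2 + S.m3 * S.m3 + S.m1 * S.m1) * S.m3 := by
  rw [← S.rot_c]; exact S.rot.d3L1
lemma d2L3 : S.d2 S.L3 = 2 * S.L3 * S.k2 - S.L1 * S.a + S.L2 * S.k3 - S.L2 * S.m3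
    - 2 * S.c * S.m1 - 2 * S.e3 * S.m2 - 3 * S.e2 * S.m3 + S.a * S.a * S.m1
    - (S.k3 * S.k3 + S.k1 * S.k1 + S.k2 * S.k2) * S.m1
    - (S.m3 * S.m3 + S.m1 * S.m1 + S.m2 * S.m2) * S.m1 := by
  rw [← S.rot_c]; exact S.rot.d1L2

/-- The covariant derivative of `λ` along `u`, first component. -/
def N1 : R := S.d0 S.L1 + 2 * S.a * S.L1 + (S.L2 * S.k3 - S.L3 * S.k2)
  + (S.L2 * S.m3 - S.L3 * S.m2)
def N2 : R := S.rot.N1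
def N3 : R := S.rot.rot.N1

lemma d0L1 : S.d0 S.L1 = S.N1 - 2 * S.a * S.L1 - (S.L2 * S.k3 - S.L3 * S.k2)
    - (S.L2 * S.m3 - S.L3 * S.m2) := by simp only [N1]; ring
lemma d0L2 : S.d0 S.L2 = S.N2 - 2 * S.a * S.L2 - (S.L3 * S.k1 - S.L1 * S.k3)
    - (S.L3 * S.m1 - S.L1 * S.m3) := S.rot.d0L1
lemma d0L3 : S.d0 S.L3 = S.N3 - 2 * S.a * S.L3 - (S.L1 * S.k2 - S.L2 * S.k1)
    - (S.L1 * S.m2 - S.L2 * S.m1) := S.rot.rot.d0L1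

/-- The mixed commutator on `m` brings in `e` through `d0 m` and the `u`-derivative `N` of `λ`
through the horizontal derivatives of `m`. As `N` enters only antisymmetrically, it drops out of the
symmetric part of the derivative of `e`. -/
lemma d1e1 : S.d1 S.e1 = S.F1 * S.m1 - S.F2 * S.m2 - S.F3 * S.m3 + 2 * S.e1 * S.k1
    - S.e2 * S.k2 + S.e2 * S.m2 - S.e3 * S.k3 + S.e3 * S.m3 := by
  have h := S.c01 S.m1
  simp only [S.d0m1, S.d1m1, S.d2m1, S.d3m1, S.d1m2, S.d1m3, S.d0m2, S.d0m3, S.d0k1, S.d0k2,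
    S.d0k3, S.d1k1, S.d1k2, S.d1k3, S.d1a, S.d0a, map_add, map_sub, map_neg, Derivation.leibniz,
    smul_eq_mul, neg_mul] at h
  linear_combination h

lemma d1e2 : S.d1 S.e2 = -S.N3 + S.F1 * S.m2 + S.F2 * S.m1 - S.a * S.e3 + S.e1 * S.k2
    - S.e1 * S.m2 + 2 * S.e2 * S.k1 := by
  have h := S.c01 S.m2
  simp only [S.d0m1, S.d1m1, S.d2m2, S.d3m2, S.d1m2, S.d1m3, S.d0m2, S.d0m3, S.d0k1, S.d0k2,
    S.d0k3, S.d1k1, S.d1k2, S.d1k3, S.d1a, S.d0a, S.d0L3, map_add, map_sub, map_neg,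
    Derivation.leibniz, smul_eq_mul, neg_mul] at h
  linear_combination h

lemma d1e3 : S.d1 S.e3 = S.N2 + S.F1 * S.m3 + S.F3 * S.m1 + S.a * S.e2 + S.e1 * S.k3
    - S.e1 * S.m3 + 2 * S.e3 * S.k1 := by
  have h := S.c01 S.m3
  simp only [S.d0m1, S.d1m1, S.d2m3, S.d3m3, S.d1m2, S.d1m3, S.d0m2, S.d0m3, S.d0k1, S.d0k2,
    S.d0k3, S.d1k1, S.d1k2, S.d1k3, S.d1a, S.d0a, S.d0L2, map_add, map_sub, map_neg,
    Derivation.leibniz, smul_eq_mul, neg_mul] at h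
  linear_combination h

lemma d2e2 : S.d2 S.e2 = S.F2 * S.m2 - S.F3 * S.m3 - S.F1 * S.m1 + 2 * S.e2 * S.k2
    - S.e3 * S.k3 + S.e3 * S.m3 - S.e1 * S.k1 + S.e1 * S.m1 := S.rot.d1e1
lemma d3e3 : S.d3 S.e3 = S.F3 * S.m3 - S.F1 * S.m1 - S.F2 * S.m2 + 2 * S.e3 * S.k3
    - S.e1 * S.k1 + S.e1 * S.m1 - S.e2 * S.k2 + S.e2 * S.m2 := S.rot.rot.d1e1
lemma d2e3 : S.d2 S.e3 = -S.N1 + S.F2 * S.m3 + S.F3 * S.m2 - S.a * S.e1 + S.e2 * S.k3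
    - S.e2 * S.m3 + 2 * S.e3 * S.k2 := S.rot.d1e2
lemma d3e1 : S.d3 S.e1 = -S.N2 + S.F3 * S.m1 + S.F1 * S.m3 - S.a * S.e2 + S.e3 * S.k1
    - S.e3 * S.m1 + 2 * S.e1 * S.k3 := S.rot.rot.d1e2
lemma d2e1 : S.d2 S.e1 = S.N3 + S.F2 * S.m1 + S.F1 * S.m2 + S.a * S.e3 + S.e2 * S.k1
    - S.e2 * S.m1 + 2 * S.e1 * S.k2 := S.rot.d1e3
lemma d3e2 : S.d3 S.e2 = S.N1 + S.F3 * S.m2 + S.F2 * S.m3 + S.a * S.e1 + S.e3 * S.k2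
    - S.e3 * S.m2 + 2 * S.e2 * S.k3 := S.rot.rot.d1e3

/-- The trace part of the horizontal derivative of `F`. -/
def s : R := S.d1 S.F1 - (3 * S.F1 * S.k1 - S.F1 * S.m1 + 8 * S.e1 * S.m1)

lemma d1F1 : S.d1 S.F1 = S.s + 3 * S.F1 * S.k1 - S.F1 * S.m1 + 8 * S.e1 * S.m1 := by
  simp only [s]; ring

/-- Both `d1 F1` and `d2 F2` involve the unknown `d0 c`, through the mixed commutators on `k1` and
`k2`; it cancels in their difference. The commutators on `m1` and `m2` remove the derivatives of `λ`
that are left. Thus a single scalar `s` serves the three diagonal entries. -/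
lemma rot_s : S.rot.s = S.s := by
  have h1 := S.c01 S.k1
  have h2 := S.c23 S.m1
  have h3 := S.c02 S.k2
  have h4 := S.c31 S.m2
  have hF2 : S.rot.F1 = S.F2 := rfl
  have he2 : S.rot.e1 = S.e2 := rfl
  simp only [s, hF2, he2]
  simp only [rot]
  simp only [S.d0m1, S.d0m2, S.d0m3, S.d1m1, S.d1m2, S.d1m3, S.d2m1, S.d2m2, S.d2m3, S.d3m1,
    S.d3m2, S.d3m3, S.d0k1, S.d0k2, S.d0k3, S.d1k1, S.d1k2, S.d1k3, S.d2k1, S.d2k2, S.d2k3,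
    S.d3k1, S.d3k2, S.d3k3, S.d0a, S.d1a, S.d2a, S.d3a, map_add, map_sub, map_neg,
    Derivation.leibniz, smul_eq_mul, neg_mul] at h1 h2 h3 h4
  linear_combination h3 + h4 - h1 - h2

lemma d2F2 : S.d2 S.F2 = S.s + 3 * S.F2 * S.k2 - S.F2 * S.m2 + 8 * S.e2 * S.m2 := by
  rw [← S.rot_s]; exact S.rot.d1F1
lemma d3F3 : S.d3 S.F3 = S.s + 3 * S.F3 * S.k3 - S.F3 * S.m3 + 8 * S.e3 * S.m3 := by
  rw [← S.rot_s]; exact S.rot.d2F2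

lemma d1F2 : S.d1 S.F2 = S.d0 S.e3 + S.F1 * S.k2 - S.F1 * S.m2 + 2 * S.F2 * S.k1
    - S.F3 * S.a + 2 * S.a * S.e3 + S.e1 * S.k2 + 5 * S.e1 * S.m2 - S.e2 * S.k1
    + 3 * S.e2 * S.m1 := by
  have h1 := S.c01 S.k2
  have h2 := S.c31 S.m1
  simp only [S.d0m1, S.d0m2, S.d0m3, S.d1m1, S.d1m2, S.d1m3, S.d2m1, S.d2m2, S.d2m3, S.d3m1,
    S.d3m2, S.d3m3, S.d0k1, S.d0k2, S.d0k3, S.d1k1, S.d1k2, S.d1k3, S.d2k1, S.d2k2, S.d2k3,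
    S.d3k1, S.d3k2, S.d3k3, S.d0a, S.d1a, S.d2a, S.d3a, map_add, map_sub, map_neg,
    Derivation.leibniz, smul_eq_mul, neg_mul] at h1 h2
  linear_combination h1 + h2

lemma d1F3 : S.d1 S.F3 = -S.d0 S.e2 + S.F1 * S.k3 - S.F1 * S.m3 + S.F2 * S.a
    + 2 * S.F3 * S.k1 - 2 * S.a * S.e2 + S.e1 * S.k3 + 5 * S.e1 * S.m3 - S.e3 * S.k1
    + 3 * S.e3 * S.m1 := by
  have h1 := S.c01 S.k3
  have h2 := S.c12 S.m1
  simp only [S.d0m1, S.d0m2, S.d0m3, S.d1m1, S.d1m2, S.d1m3, S.d2m1, S.d2m2, S.d2m3, S.d3m1,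
    S.d3m2, S.d3m3, S.d0k1, S.d0k2, S.d0k3, S.d1k1, S.d1k2, S.d1k3, S.d2k1, S.d2k2, S.d2k3,
    S.d3k1, S.d3k2, S.d3k3, S.d0a, S.d1a, S.d2a, S.d3a, map_add, map_sub, map_neg,
    Derivation.leibniz, smul_eq_mul, neg_mul] at h1 h2
  linear_combination h1 + h2

lemma d2F3 : S.d2 S.F3 = S.d0 S.e1 + S.F2 * S.k3 - S.F2 * S.m3 + 2 * S.F3 * S.k2
    - S.F1 * S.a + 2 * S.a * S.e1 + S.e2 * S.k3 + 5 * S.e2 * S.m3 - S.e3 * S.k2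
    + 3 * S.e3 * S.m2 := S.rot.d1F2
lemma d3F1 : S.d3 S.F1 = S.d0 S.e2 + S.F3 * S.k1 - S.F3 * S.m1 + 2 * S.F1 * S.k3
    - S.F2 * S.a + 2 * S.a * S.e2 + S.e3 * S.k1 + 5 * S.e3 * S.m1 - S.e1 * S.k3
    + 3 * S.e1 * S.m3 := S.rot.rot.d1F2
lemma d2F1 : S.d2 S.F1 = -S.d0 S.e3 + S.F2 * S.k1 - S.F2 * S.m1 + S.F3 * S.a
    + 2 * S.F1 * S.k2 - 2 * S.a * S.e3 + S.e2 * S.k1 + 5 * S.e2 * S.m1 - S.e1 * S.k2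
    + 3 * S.e1 * S.m2 := S.rot.d1F3
lemma d3F2 : S.d3 S.F2 = -S.d0 S.e1 + S.F3 * S.k2 - S.F3 * S.m2 + S.F1 * S.a
    + 2 * S.F2 * S.k3 - 2 * S.a * S.e1 + S.e3 * S.k2 + 5 * S.e3 * S.m2 - S.e2 * S.k3
    + 3 * S.e2 * S.m3 := S.rot.rot.d1F3

end SecondOrder

/-! ### The algebraic integrability condition -/

section ThirdOrder

lemma map_two_mul (d : Derivation ℝ R R) (x : R) : d (2 * x) = 2 * d x := by
  rw [two_mul, map_add, two_mul]
lemma map_three_mul (d : Derivation ℝ R R) (x : R) : d (3 * x) = 3 * d x := by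
  have : (3 : R) * x = x + x + x := by ring
  rw [this, map_add, map_add]; ring
lemma map_five_mul (d : Derivation ℝ R R) (x : R) : d (5 * x) = 5 * d x := by
  have : (5 : R) * x = x + x + x + x + x := by ring
  rw [this]; simp only [map_add]; ring
lemma map_eight_mul (d : Derivation ℝ R R) (x : R) : d (8 * x) = 8 * d x := by
  have : (8 : R) * x = 2 * (2 * (2 * x)) := by ring
  rw [this]; simp only [map_two_mul]; ring

/-- An elimination: in the sum of the two commutators on `e` the derivatives of `N3` cancel, leaving
`d2 (d0 e1)` and `d1 (d0 e2)`. The commutators on `F` contain the same two terms, since the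
antisymmetric part of the derivative of `F` is `d0 e` up to lower order, and in their sum the
derivatives of `s` cancel. -/
lemma cotton_offDiag : S.m1 * S.N2 + S.m2 * S.N1 = S.L1 * S.e2 + S.L2 * S.e1 := by
  have h1 := S.c02 S.e1
  have h2 := S.c01 S.e2
  have h3 := S.c23 S.F2
  have h4 := S.c31 S.F1
  simp only [S.d1e1, S.d1e2, S.d2e1, S.d2e2, S.d3e1, S.d3e2, S.d1F1, S.d2F1, S.d3F1, S.d1F2,
    S.d2F2, S.d3F2, mul_assoc, map_two_mul, map_three_mul, map_five_mul, map_eight_mul,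
    map_add, map_sub, map_neg] at h1 h2 h3 h4
  simp only [S.d0m1, S.d0m2, S.d0m3, S.d1m1, S.d1m2, S.d1m3, S.d2m1, S.d2m2, S.d2m3, S.d3m1,
    S.d3m2, S.d3m3, S.d0k1, S.d0k2, S.d0k3, S.d1k1, S.d1k2, S.d1k3, S.d2k1, S.d2k2, S.d2k3,
    S.d3k1, S.d3k2, S.d3k3, S.d0a, S.d1a, S.d2a, S.d3a,
    S.d1e1, S.d1e2, S.d1e3, S.d2e1, S.d2e2, S.d2e3, S.d3e1, S.d3e2, S.d3e3,
    S.d1F1, S.d1F2, S.d1F3, S.d2F1, S.d2F2, S.d2F3, S.d3F1, S.d3F2, S.d3F3,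
    Derivation.leibniz, smul_eq_mul, neg_mul] at h1 h2 h3 h4
  refine cancel 12 (by norm_num) ?_
  push_cast
  -- All derivatives of `d0 e`, `N` and `s` cancel; what remains is twelve times the claim.
  linear_combination h1 + h2 - h3 - h4

lemma cotton_diag : S.m1 * S.N1 - S.m2 * S.N2 = S.L1 * S.e1 - S.L2 * S.e2 := by
  have h1 := S.c01 S.e1
  have h2 := S.c02 S.e2
  have h3 := S.c23 S.F1
  have h4 := S.c31 S.F2
  simp only [S.d1e1, S.d1e2, S.d2e1, S.d2e2, S.d3e1, S.d3e2, S.d1F1, S.d2F1, S.d3F1, S.d1F2,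
    S.d2F2, S.d3F2, mul_assoc, map_two_mul, map_three_mul, map_five_mul, map_eight_mul,
    map_add, map_sub, map_neg] at h1 h2 h3 h4
  simp only [S.d0m1, S.d0m2, S.d0m3, S.d1m1, S.d1m2, S.d1m3, S.d2m1, S.d2m2, S.d2m3, S.d3m1,
    S.d3m2, S.d3m3, S.d0k1, S.d0k2, S.d0k3, S.d1k1, S.d1k2, S.d1k3, S.d2k1, S.d2k2, S.d2k3,
    S.d3k1, S.d3k2, S.d3k3, S.d0a, S.d1a, S.d2a, S.d3a,
    S.d1e1, S.d1e2, S.d1e3, S.d2e1, S.d2e2, S.d2e3, S.d3e1, S.d3e2, S.d3e3,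
    S.d1F1, S.d1F2, S.d1F3, S.d2F1, S.d2F2, S.d2F3, S.d3F1, S.d3F2, S.d3F3,
    Derivation.leibniz, smul_eq_mul, neg_mul] at h1 h2 h3 h4
  refine cancel 12 (by norm_num) ?_
  push_cast
  linear_combination h1 - h2 - h3 + h4

end ThirdOrder
end ShearFreeFrame

/-! ### Symmetric trace-free products in three dimensions -/

section VectorAlgebra

variable {m1 m2 m3 : ℝ}

/-- A vector whose trace-free symmetric product with a nonzero vector vanishes is zero. -/
lemma eq_zero_of_symm_traceFree (hm : m1 * m1 + m2 * m2 + m3 * m3 ≠ 0) {x1 x2 x3 : ℝ}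
    (h12 : m1 * x2 + m2 * x1 = 0) (h23 : m2 * x3 + m3 * x2 = 0) (h31 : m3 * x1 + m1 * x3 = 0)
    (d12 : m1 * x1 = m2 * x2) (d23 : m2 * x2 = m3 * x3) : x1 = 0 ∧ x2 = 0 ∧ x3 = 0 := by
  have t : m1 * x1 = 0 := by
    have : (m1 * m1 + m2 * m2 + m3 * m3) * (2 * (m1 * x1)) = 0 := by
      linear_combination m1 * m2 * h12 + m2 * m3 * h23 + m3 * m1 * h31 - m2 * m2 * d12
        - m3 * m3 * (d12 + d23) + (m1 * m1 + m2 * m2 + m3 * m3) * (2 * d12 + d23)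
    have := (mul_eq_zero.1 this).resolve_left hm
    linarith
  refine ⟨mul_left_cancel₀ hm ?_, mul_left_cancel₀ hm ?_, mul_left_cancel₀ hm ?_⟩
  · linear_combination m2 * h12 + m3 * h31 + m1 * t + m1 * (d12 - t) + m1 * (d23 + d12 - t)
  · linear_combination m1 * h12 + m3 * h23 - m2 * t - m2 * (d12 - t) + m2 * (d23 + d12 - t)
  · linear_combination m1 * h31 + m2 * h23 - m3 * t + m3 * (d12 - t) - m3 * (d23 + d12 - t)

variable {e1 e2 e3 l1 l2 l3 n1 n2 n3 : ℝ}

/-- The hypotheses say that `m ⊙ n - l ⊙ e` is a multiple of the identity. Evaluated on `x = m × e`,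
which is orthogonal to `m` and `e`, it shows that the multiple is zero. Contraction with `x` then
gives `m (n·x) = e (l·x)`, and as `m` and `e` are independent, `l·x = 0`. Evaluation on `x × m`,
orthogonal to `m` but not to `e`, shows that `l` is orthogonal to that vector too. Hence `l` is
parallel to `m`. -/
lemma cross_eq_zero_of_symm_traceFree (hm : m1 * m1 + m2 * m2 + m3 * m3 ≠ 0)
    (h12 : m1 * n2 + m2 * n1 = l1 * e2 + l2 * e1) (h23 : m2 * n3 + m3 * n2 = l2 * e3 + l3 * e2)
    (h31 : m3 * n1 + m1 * n3 = l3 * e1 + l1 * e3)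
    (d12 : m1 * n1 - m2 * n2 = l1 * e1 - l2 * e2) (d23 : m2 * n2 - m3 * n3 = l2 * e2 - l3 * e3)
    (hx : ¬(m2 * e3 - m3 * e2 = 0 ∧ m3 * e1 - m1 * e3 = 0 ∧ m1 * e2 - m2 * e1 = 0)) :
    l2 * m3 - l3 * m2 = 0 ∧ l3 * m1 - l1 * m3 = 0 ∧ l1 * m2 - l2 * m1 = 0 := by
  obtain ⟨x1, hx1⟩ : ∃ x, x = m2 * e3 - m3 * e2 := ⟨_, rfl⟩
  obtain ⟨x2, hx2⟩ : ∃ x, x = m3 * e1 - m1 * e3 := ⟨_, rfl⟩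
  obtain ⟨x3, hx3⟩ : ∃ x, x = m1 * e2 - m2 * e1 := ⟨_, rfl⟩
  rw [← hx1, ← hx2, ← hx3] at hx
  have hxx : x1 * x1 + x2 * x2 + x3 * x3 ≠ 0 := by
    intro h
    refine hx ⟨?_, ?_, ?_⟩ <;> nlinarith [sq_nonneg x1, sq_nonneg x2, sq_nonneg x3]
  have hmx : m1 * x1 + m2 * x2 + m3 * x3 = 0 := by rw [hx1, hx2, hx3]; ring
  have hex : e1 * x1 + e2 * x2 + e3 * x3 = 0 := by rw [hx1, hx2, hx3]; ring
  have ht : m1 * n1 - l1 * e1 = 0 := by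
    refine mul_left_cancel₀ hxx ?_
    linear_combination (n1 * x1 + n2 * x2 + n3 * x3) * hmx - (l1 * x1 + l2 * x2 + l3 * x3) * hex
      - x1 * x2 * h12 - x2 * x3 * h23 - x3 * x1 * h31 + x2 * x2 * d12 + x3 * x3 * (d12 + d23)
  have hlx : l1 * x1 + l2 * x2 + l3 * x3 = 0 := by
    obtain ⟨p, hp⟩ : ∃ p, p = n1 * x1 + n2 * x2 + n3 * x3 := ⟨_, rfl⟩
    obtain ⟨q, hq⟩ : ∃ q, q = l1 * x1 + l2 * x2 + l3 * x3 := ⟨_, rfl⟩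
    have a1 : m1 * p = e1 * q := by
      rw [hp, hq]
      linear_combination -n1 * hmx + l1 * hex + x2 * h12 + x3 * h31 + 2 * x1 * ht
    have a2 : m2 * p = e2 * q := by
      rw [hp, hq]
      linear_combination -n2 * hmx + l2 * hex + x1 * h12 + x3 * h23 + 2 * x2 * (ht - d12)
    have a3 : m3 * p = e3 * q := by
      rw [hp, hq]
      linear_combination -n3 * hmx + l3 * hex + x1 * h31 + x2 * h23 + 2 * x3 * (ht - d12 - d23)
    rw [← hq]
    refine mul_left_cancel₀ hxx ?_
    have b1 : x1 * q = 0 := by rw [hx1]; linear_combination m3 * a2 - m2 * a3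
    have b2 : x2 * q = 0 := by rw [hx2]; linear_combination m1 * a3 - m3 * a1
    have b3 : x3 * q = 0 := by rw [hx3]; linear_combination m2 * a1 - m1 * a2
    linear_combination x1 * b1 + x2 * b2 + x3 * b3
  -- the component of `l` along `x × m`
  have hly : l1 * (x2 * m3 - x3 * m2) + l2 * (x3 * m1 - x1 * m3) + l3 * (x1 * m2 - x2 * m1) = 0 := by
    refine mul_left_cancel₀ hxx ?_
    obtain ⟨y1, hy1⟩ : ∃ y, y = x2 * m3 - x3 * m2 := ⟨_, rfl⟩
    obtain ⟨y2, hy2⟩ : ∃ y, y = x3 * m1 - x1 * m3 := ⟨_, rfl⟩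
    obtain ⟨y3, hy3⟩ : ∃ y, y = x1 * m2 - x2 * m1 := ⟨_, rfl⟩
    have hmy : m1 * y1 + m2 * y2 + m3 * y3 = 0 := by rw [hy1, hy2, hy3]; ring
    have hey : e1 * y1 + e2 * y2 + e3 * y3 = x1 * x1 + x2 * x2 + x3 * x3 := by
      rw [hy1, hy2, hy3]
      linear_combination -x1 * hx1 - x2 * hx2 - x3 * hx3
    rw [← hy1, ← hy2, ← hy3, ← hey]
    linear_combination (n1 * y1 + n2 * y2 + n3 * y3) * hmy
      - y1 * y2 * h12 - y2 * y3 * h23 - y3 * y1 * h31 - y1 * y1 * ht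
      - y2 * y2 * (ht - d12) - y3 * y3 * (ht - d12 - d23)
  have key : (m1 * m1 + m2 * m2 + m3 * m3) * (x1 * x1 + x2 * x2 + x3 * x3) ≠ 0 := mul_ne_zero hm hxx
  refine ⟨mul_left_cancel₀ key ?_, mul_left_cancel₀ key ?_, mul_left_cancel₀ key ?_⟩
  · linear_combination (m1 * m1 + m2 * m2 + m3 * m3) * (x2 * m3 - x3 * m2) * hlx
      - (l1 * m1 + l2 * m2 + l3 * m3) * (x2 * m3 - x3 * m2) * hmx
      - ((l2 * m3 - l3 * m2) * x1 + (l3 * m1 - l1 * m3) * x2 + (l1 * m2 - l2 * m1) * x3) * m1 * hmx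
      - (m1 * m1 + m2 * m2 + m3 * m3) * x1 * hly + (m1 * x1 + m2 * x2 + m3 * x3) * (l2 * m3 - l3 * m2) * hmx
  · linear_combination (m1 * m1 + m2 * m2 + m3 * m3) * (x3 * m1 - x1 * m3) * hlx
      - (l1 * m1 + l2 * m2 + l3 * m3) * (x3 * m1 - x1 * m3) * hmx
      - ((l2 * m3 - l3 * m2) * x1 + (l3 * m1 - l1 * m3) * x2 + (l1 * m2 - l2 * m1) * x3) * m2 * hmx
      - (m1 * m1 + m2 * m2 + m3 * m3) * x2 * hly + (m1 * x1 + m2 * x2 + m3 * x3) * (l3 * m1 - l1 * m3) * hmx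
  · linear_combination (m1 * m1 + m2 * m2 + m3 * m3) * (x1 * m2 - x2 * m1) * hlx
      - (l1 * m1 + l2 * m2 + l3 * m3) * (x1 * m2 - x2 * m1) * hmx
      - ((l2 * m3 - l3 * m2) * x1 + (l3 * m1 - l1 * m3) * x2 + (l1 * m2 - l2 * m1) * x3) * m3 * hmx
      - (m1 * m1 + m2 * m2 + m3 * m3) * x3 * hly + (m1 * x1 + m2 * x2 + m3 * x3) * (l1 * m2 - l2 * m1) * hmx

end VectorAlgebra

/-! ### Vanishing of the curvature of the coupling form where the rotation is nonzero -/

namespace ShearFreeFrame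

variable {R : Type*} [CommRing R] [Algebra ℝ R] (S : ShearFreeFrame R)
  {ι : Type*} (ev : ι → R →+* ℝ)

/-- The square of the rotation vector vanishes at no point. -/
def RotationNeZero : Prop := ∀ i, ev i S.m1 * ev i S.m1 + ev i S.m2 * ev i S.m2 +
  ev i S.m3 * ev i S.m3 ≠ 0

/-- The cross product `m × e`, first component. -/
def n1 : R := S.m2 * S.e3 - S.m3 * S.e2
def n2 : R := S.rot.n1
def n3 : R := S.rot.rot.n1
/-- The cross product `λ × m`, first component. -/
def w1 : R := S.L2 * S.m3 - S.L3 * S.m2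
def w2 : R := S.rot.w1
def w3 : R := S.rot.rot.w1

lemma n1_eq : S.n1 = S.m2 * S.e3 - S.m3 * S.e2 := rfl
lemma n2_eq : S.n2 = S.m3 * S.e1 - S.m1 * S.e3 := rfl
lemma n3_eq : S.n3 = S.m1 * S.e2 - S.m2 * S.e1 := rfl
lemma w1_eq : S.w1 = S.L2 * S.m3 - S.L3 * S.m2 := rfl
lemma w2_eq : S.w2 = S.L3 * S.m1 - S.L1 * S.m3 := rfl
lemma w3_eq : S.w3 = S.L1 * S.m2 - S.L2 * S.m1 := rfl

variable {S ev}

/-- The trace-free symmetric identity `m ⊙ N = λ ⊙ e`, evaluated at a point. -/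
lemma cotton_eval (f : R →+* ℝ) :
    (f S.m1 * f S.N2 + f S.m2 * f S.N1 = f S.L1 * f S.e2 + f S.L2 * f S.e1) ∧
    (f S.m2 * f S.N3 + f S.m3 * f S.N2 = f S.L2 * f S.e3 + f S.L3 * f S.e2) ∧
    (f S.m3 * f S.N1 + f S.m1 * f S.N3 = f S.L3 * f S.e1 + f S.L1 * f S.e3) ∧
    (f S.m1 * f S.N1 - f S.m2 * f S.N2 = f S.L1 * f S.e1 - f S.L2 * f S.e2) ∧
    (f S.m2 * f S.N2 - f S.m3 * f S.N3 = f S.L2 * f S.e2 - f S.L3 * f S.e3) := by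
  have h1 := congrArg f S.cotton_offDiag
  have h2 : f (S.m2 * S.N3 + S.m3 * S.N2) = f (S.L2 * S.e3 + S.L3 * S.e2) :=
    congrArg f S.rot.cotton_offDiag
  have h3 : f (S.m3 * S.N1 + S.m1 * S.N3) = f (S.L3 * S.e1 + S.L1 * S.e3) :=
    congrArg f S.rot.rot.cotton_offDiag
  have h4 := congrArg f S.cotton_diag
  have h5 : f (S.m2 * S.N2 - S.m3 * S.N3) = f (S.L2 * S.e2 - S.L3 * S.e3) :=
    congrArg f S.rot.cotton_diag
  simp only [map_add, map_sub, map_mul] at h1 h2 h3 h4 h5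
  exact ⟨h1, h2, h3, h4, h5⟩

/-- Evaluation of a derivative of a vanishing product at a zero of the first factor. -/
lemma eval_deriv_mul_eq_zero (f : R →+* ℝ) (d : Derivation ℝ R R) {x y : R} (h : x * y = 0)
    (hx : f x = 0) : f (d x) * f y = 0 := by
  have := congrArg f (congrArg d h)
  simpa [Derivation.leibniz, hx, mul_comm] using this

/-- Statements of the form "`w = 0` where `n ≠ 0`" are recorded as vanishing products. By the
Leibniz rule, `w` and all its derivatives then vanish at every point where `n` does not, without
mention of open sets. -/
lemma w_mul_n (hev : ∀ r : R, (∀ i, ev i r = 0) → r = 0) (hm : S.RotationNeZero ev) :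
    (∀ w ∈ ({S.w1, S.w2, S.w3} : Set R), ∀ n ∈ ({S.n1, S.n2, S.n3} : Set R), w * n = 0) := by
  intro w hw n hn
  refine hev _ fun i => ?_
  obtain ⟨h1, h2, h3, h4, h5⟩ := cotton_eval (S := S) (ev i)
  by_cases hx : ev i S.n1 = 0 ∧ ev i S.n2 = 0 ∧ ev i S.n3 = 0
  · obtain ⟨a1, a2, a3⟩ := hx
    rcases hn with rfl | rfl | rfl <;> simp [*]
  · have hx' := hx
    simp only [n1_eq, n2_eq, n3_eq, map_sub, map_mul] at hx'
    obtain ⟨b1, b2, b3⟩ := cross_eq_zero_of_symm_traceFree (hm i) h1 h2 h3 h4 h5 hx'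
    rcases hw with rfl | rfl | rfl <;> simp [w1_eq, w2_eq, w3_eq, *]

/-- Where `m × e ≠ 0`, both `λ × m` and its `u`-derivative vanish. So `λ = x m`, and the trace-free
identity becomes `m ⊙ (N - x e) = 0`, that is `N = x e`. The `u`-derivative of `λ × m` is then `-2 x
(m × e)`, which forces `x = 0`. -/
lemma L_mul_n (hev : ∀ r : R, (∀ i, ev i r = 0) → r = 0) (hm : S.RotationNeZero ev) :
    (∀ l ∈ ({S.L1, S.L2, S.L3} : Set R), ∀ n ∈ ({S.n1, S.n2, S.n3} : Set R), l * n = 0) := by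
  intro l hl n hn
  refine hev _ fun i => ?_
  obtain ⟨h1, h2, h3, h4, h5⟩ := cotton_eval (S := S) (ev i)
  by_cases hnz : ev i n = 0
  · simp [hnz]
  have hwn := w_mul_n hev hm
  have hw : ∀ w ∈ ({S.w1, S.w2, S.w3} : Set R), ev i w = 0 ∧ ev i (S.d0 w) = 0 := by
    intro w hw
    have a : ev i w = 0 := by
      have := congrArg (ev i) (hwn w hw n hn)
      simpa [hnz] using this
    exact ⟨a, (mul_eq_zero.1 (eval_deriv_mul_eq_zero (ev i) S.d0 (hwn w hw n hn) a)).resolve_right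
      hnz⟩
  obtain ⟨w1, v1⟩ := hw S.w1 (by simp)
  obtain ⟨w2, v2⟩ := hw S.w2 (by simp)
  obtain ⟨w3, v3⟩ := hw S.w3 (by simp)
  simp only [w1_eq, w2_eq, w3_eq, map_sub, map_mul, map_add, Derivation.leibniz, smul_eq_mul,
    S.d0L1, S.d0L2, S.d0L3, S.d0m1, S.d0m2, S.d0m3, map_neg, map_ofNat] at w1 w2 w3 v1 v2 v3
  -- The only possible factor in `λ = x m`, obtained by pairing with `m`.
  obtain ⟨x, hx⟩ : ∃ x, x = (ev i S.L1 * ev i S.m1 + ev i S.L2 * ev i S.m2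
    + ev i S.L3 * ev i S.m3) / (ev i S.m1 * ev i S.m1 + ev i S.m2 * ev i S.m2
    + ev i S.m3 * ev i S.m3) := ⟨_, rfl⟩
  rw [eq_div_iff (hm i)] at hx
  have l1 : ev i S.L1 = x * ev i S.m1 := by
    refine mul_left_cancel₀ (hm i) ?_
    linear_combination ev i S.m3 * (-w2) + ev i S.m2 * w3 - ev i S.m1 * hx
  have l2 : ev i S.L2 = x * ev i S.m2 := by
    refine mul_left_cancel₀ (hm i) ?_
    linear_combination ev i S.m3 * w1 - ev i S.m1 * w3 - ev i S.m2 * hx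
  have l3 : ev i S.L3 = x * ev i S.m3 := by
    refine mul_left_cancel₀ (hm i) ?_
    linear_combination ev i S.m1 * w2 - ev i S.m2 * w1 - ev i S.m3 * hx
  rw [l1, l2, l3] at v1 v2 v3
  rw [l1, l2] at h1 h4
  rw [l2, l3] at h2 h5
  rw [l3, l1] at h3
  obtain ⟨p1, p2, p3⟩ := eq_zero_of_symm_traceFree (hm i)
    (x1 := ev i S.N1 - x * ev i S.e1) (x2 := ev i S.N2 - x * ev i S.e2)
    (x3 := ev i S.N3 - x * ev i S.e3) (by linear_combination h1) (by linear_combination h2)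
    (by linear_combination h3) (by linear_combination h4) (by linear_combination h5)
  rw [sub_eq_zero] at p1 p2 p3
  have hxn : x * ev i n = 0 := by
    rcases hn with rfl | rfl | rfl
    · rw [n1_eq, map_sub, map_mul, map_mul]
      refine mul_left_cancel₀ (two_ne_zero (α := ℝ)) ?_
      linear_combination -v1 + ev i S.m3 * p2 - ev i S.m2 * p3
    · rw [n2_eq, map_sub, map_mul, map_mul]
      refine mul_left_cancel₀ (two_ne_zero (α := ℝ)) ?_
      linear_combination -v2 + ev i S.m1 * p3 - ev i S.m3 * p1
    · rw [n3_eq, map_sub, map_mul, map_mul]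
      refine mul_left_cancel₀ (two_ne_zero (α := ℝ)) ?_
      linear_combination -v3 + ev i S.m2 * p1 - ev i S.m1 * p2
  have hx0 := (mul_eq_zero.1 hxn).resolve_right hnz
  rcases hl with rfl | rfl | rfl <;> simp [*]

/-- Where `m × e ≠ 0`, `λ` vanishes with its derivatives. At such a point the trace-free symmetric
part of the derivative of `λ` reduces to `-5 m ⊙ e`, so `e = 0`, contradicting `m × e ≠ 0`. -/
lemma n_eq_zero (hev : ∀ r : R, (∀ i, ev i r = 0) → r = 0) (hm : S.RotationNeZero ev) :
    ∀ n ∈ ({S.n1, S.n2, S.n3} : Set R), n = 0 := by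
  intro n hn
  refine hev _ fun i => ?_
  by_contra hnz
  have hLn := L_mul_n hev hm
  have hL : ∀ l ∈ ({S.L1, S.L2, S.L3} : Set R), ev i l = 0 ∧
      ∀ d : Derivation ℝ R R, ev i (d l) = 0 := by
    intro l hl
    have a : ev i l = 0 := by
      have := congrArg (ev i) (hLn l hl n hn)
      simpa [hnz] using this
    exact ⟨a, fun d => (mul_eq_zero.1 (eval_deriv_mul_eq_zero (ev i) d (hLn l hl n hn) a)).resolve_right
      hnz⟩
  obtain ⟨l1, a1⟩ := hL S.L1 (by simp)
  obtain ⟨l2, a2⟩ := hL S.L2 (by simp)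
  obtain ⟨l3, a3⟩ := hL S.L3 (by simp)
  have b11 := a1 S.d1
  have b22 := a2 S.d2
  have b33 := a3 S.d3
  have b12 : ev i (S.d1 S.L2 + S.d2 S.L1) = 0 := by rw [map_add, a2, a1, add_zero]
  have b23 : ev i (S.d2 S.L3 + S.d3 S.L2) = 0 := by rw [map_add, a3, a2, add_zero]
  have b31 : ev i (S.d3 S.L1 + S.d1 S.L3) = 0 := by rw [map_add, a1, a3, add_zero]
  simp only [d1L1, d2L2, d3L3, d1L2, d2L1, d2L3, d3L2, d3L1, d1L3, map_add, map_sub, map_mul,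
    map_ofNat, l1, l2, l3] at b11 b22 b33 b12 b23 b31
  obtain ⟨p1, p2, p3⟩ := eq_zero_of_symm_traceFree (hm i)
    (x1 := ev i S.e1) (x2 := ev i S.e2) (x3 := ev i S.e3)
    (by linear_combination (-1 / 5) * b12) (by linear_combination (-1 / 5) * b23)
    (by linear_combination (-1 / 5) * b31) (by linear_combination (-1 / 5) * (b11 - b22))
    (by linear_combination (-1 / 5) * (b22 - b33))
  refine hnz ?_
  rcases hn with rfl | rfl | rfl <;> simp [n1_eq, n2_eq, n3_eq, *]

/-- The divergence of `m × e = 0`: up to lower-order terms the curl of `m` is `2λ` and that of `e`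
is `-2N`. The lower-order terms reduce to multiples of `m × e`. -/
lemma e_dot_L_add_m_dot_N (hn : ∀ n ∈ ({S.n1, S.n2, S.n3} : Set R), n = 0) :
    S.e1 * S.L1 + S.e2 * S.L2 + S.e3 * S.L3 + S.m1 * S.N1 + S.m2 * S.N2 + S.m3 * S.N3 = 0 := by
  have n1 := hn S.n1 (by simp)
  have n2 := hn S.n2 (by simp)
  have n3 := hn S.n3 (by simp)
  have h1 := congrArg S.d1 n1
  have h2 := congrArg S.d2 n2
  have h3 := congrArg S.d3 n3
  rw [n1_eq] at n1 h1
  rw [n2_eq] at n2 h2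
  rw [n3_eq] at n3 h3
  simp only [d1e1, d1e2, d1e3, d2e1, d2e2, d2e3, d3e1, d3e2, d3e3, d1m1, d1m2, d1m3, d2m1, d2m2,
    d2m3, d3m1, d3m2, d3m3, map_sub, Derivation.leibniz, smul_eq_mul, map_zero] at h1 h2 h3
  refine cancel 2 two_ne_zero ?_
  push_cast
  linear_combination h1 + h2 + h3 - S.k1 * n1 - S.k2 * n2 - S.k3 * n3

/-- The derivative of `m·λ` in the direction `m`. Where `m·λ` vanishes to first order it forces `m·e
= 0`. -/
lemma sum_m_mul_d_m_dot_L :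
    S.m1 * S.d1 (S.m1 * S.L1 + S.m2 * S.L2 + S.m3 * S.L3)
      + S.m2 * S.d2 (S.m1 * S.L1 + S.m2 * S.L2 + S.m3 * S.L3)
      + S.m3 * S.d3 (S.m1 * S.L1 + S.m2 * S.L2 + S.m3 * S.L3) =
    3 * (S.m1 * S.L1 + S.m2 * S.L2 + S.m3 * S.L3) * (S.m1 * S.k1 + S.m2 * S.k2 + S.m3 * S.k3)
      - 3 * (S.m1 * S.e1 + S.m2 * S.e2 + S.m3 * S.e3)
        * (S.m1 * S.m1 + S.m2 * S.m2 + S.m3 * S.m3) := by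
  simp only [d1L1, d2L2, d3L3, d1L2, d2L1, d2L3, d3L2, d3L1, d1L3, d1m1, d1m2, d1m3, d2m1, d2m2,
    d2m3, d3m1, d3m2, d3m3, map_add, Derivation.leibniz, smul_eq_mul]
  ring

/-- Since `m × e = 0`, one has `e = x m`, and the trace-free identity gives `N = x λ`. The
divergence relation becomes `2 x (m·λ) = 0`, so `(m·λ) e = 0`. Where `e ≠ 0`, `m·λ` and its
derivatives vanish, hence `m·e = 0`; together with `m × e = 0` this gives `e = 0`. -/
lemma e_eq_zero (hev : ∀ r : R, (∀ i, ev i r = 0) → r = 0) (hm : S.RotationNeZero ev) :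
    ∀ e ∈ ({S.e1, S.e2, S.e3} : Set R), e = 0 := by
  have hn := n_eq_zero hev hm
  have hd := e_dot_L_add_m_dot_N hn
  have key : ∀ e ∈ ({S.e1, S.e2, S.e3} : Set R),
      (S.m1 * S.L1 + S.m2 * S.L2 + S.m3 * S.L3) * e = 0 := by
    intro e he
    refine hev _ fun i => ?_
    obtain ⟨h1, h2, h3, h4, h5⟩ := cotton_eval (S := S) (ev i)
    have w1 := congrArg (ev i) (hn S.n1 (by simp))
    have w2 := congrArg (ev i) (hn S.n2 (by simp))
    have w3 := congrArg (ev i) (hn S.n3 (by simp))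
    have hd' := congrArg (ev i) hd
    simp only [n1_eq, n2_eq, n3_eq, map_sub, map_mul, map_add, map_zero] at w1 w2 w3 hd'
    obtain ⟨x, hx⟩ : ∃ x, x = (ev i S.e1 * ev i S.m1 + ev i S.e2 * ev i S.m2
      + ev i S.e3 * ev i S.m3) / (ev i S.m1 * ev i S.m1 + ev i S.m2 * ev i S.m2
      + ev i S.m3 * ev i S.m3) := ⟨_, rfl⟩
    rw [eq_div_iff (hm i)] at hx
    have l1 : ev i S.e1 = x * ev i S.m1 := by
      refine mul_left_cancel₀ (hm i) ?_
      linear_combination ev i S.m3 * w2 - ev i S.m2 * w3 - ev i S.m1 * hx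
    have l2 : ev i S.e2 = x * ev i S.m2 := by
      refine mul_left_cancel₀ (hm i) ?_
      linear_combination -ev i S.m3 * w1 + ev i S.m1 * w3 - ev i S.m2 * hx
    have l3 : ev i S.e3 = x * ev i S.m3 := by
      refine mul_left_cancel₀ (hm i) ?_
      linear_combination -ev i S.m1 * w2 + ev i S.m2 * w1 - ev i S.m3 * hx
    rw [l1, l2] at h1 h4
    rw [l2, l3] at h2 h5
    rw [l3, l1] at h3
    obtain ⟨p1, p2, p3⟩ := eq_zero_of_symm_traceFree (hm i)
      (x1 := ev i S.N1 - x * ev i S.L1) (x2 := ev i S.N2 - x * ev i S.L2)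
      (x3 := ev i S.N3 - x * ev i S.L3) (by linear_combination h1) (by linear_combination h2)
      (by linear_combination h3) (by linear_combination h4) (by linear_combination h5)
    have hxL : x * ev i (S.m1 * S.L1 + S.m2 * S.L2 + S.m3 * S.L3) = 0 := by
      simp only [map_add, map_mul]
      refine mul_left_cancel₀ (two_ne_zero (α := ℝ)) ?_
      linear_combination hd' - ev i S.L1 * l1 - ev i S.L2 * l2 - ev i S.L3 * l3
        - ev i S.m1 * p1 - ev i S.m2 * p2 - ev i S.m3 * p3
    rw [map_mul]
    rcases he with rfl | rfl | rfl
    · rw [l1]; linear_combination ev i S.m1 * hxL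
    · rw [l2]; linear_combination ev i S.m2 * hxL
    · rw [l3]; linear_combination ev i S.m3 * hxL
  intro e he
  refine hev _ fun i => ?_
  by_contra hez
  have hY : ev i (S.m1 * S.L1 + S.m2 * S.L2 + S.m3 * S.L3) = 0 := by
    have := congrArg (ev i) (key e he)
    rw [map_mul, map_zero] at this
    exact (mul_eq_zero.1 this).resolve_right hez
  have hdY : ∀ d : Derivation ℝ R R, ev i (d (S.m1 * S.L1 + S.m2 * S.L2 + S.m3 * S.L3)) = 0 :=
    fun d => (mul_eq_zero.1 (eval_deriv_mul_eq_zero (ev i) d (key e he) hY)).resolve_right hez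
  have hs := congrArg (ev i) (sum_m_mul_d_m_dot_L (S := S))
  rw [map_add, map_add, map_mul, map_mul, map_mul, hdY, hdY, hdY, map_sub, map_mul, map_mul, hY]
    at hs
  simp only [map_mul, map_add, map_ofNat] at hs
  have hem : ev i S.m1 * ev i S.e1 + ev i S.m2 * ev i S.e2 + ev i S.m3 * ev i S.e3 = 0 := by
    refine mul_left_cancel₀ (hm i) ?_
    linear_combination (1 / 3) * hs
  have w1 := congrArg (ev i) (hn S.n1 (by simp))
  have w2 := congrArg (ev i) (hn S.n2 (by simp))
  have w3 := congrArg (ev i) (hn S.n3 (by simp))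
  simp only [n1_eq, n2_eq, n3_eq, map_sub, map_mul, map_zero] at w1 w2 w3
  refine hez ?_
  refine mul_left_cancel₀ (hm i) ?_
  rcases he with rfl | rfl | rfl
  · linear_combination ev i S.m1 * hem + ev i S.m3 * w2 - ev i S.m2 * w3
  · linear_combination ev i S.m2 * hem - ev i S.m3 * w1 + ev i S.m1 * w3
  · linear_combination ev i S.m3 * hem - ev i S.m1 * w2 + ev i S.m2 * w1

/-- When `e = 0`, the trace-free symmetric part of the derivative of `e` is `2 m ⊙ F`. -/
lemma F_eq_zero (hev : ∀ r : R, (∀ i, ev i r = 0) → r = 0) (hm : S.RotationNeZero ev) :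
    ∀ f ∈ ({S.F1, S.F2, S.F3} : Set R), f = 0 := by
  have he := e_eq_zero hev hm
  have e1 := he S.e1 (by simp)
  have e2 := he S.e2 (by simp)
  have e3 := he S.e3 (by simp)
  intro f hf
  refine hev _ fun i => ?_
  have b11 := congrArg (ev i) S.d1e1
  have b22 := congrArg (ev i) S.d2e2
  have b33 := congrArg (ev i) S.d3e3
  have b12 := congrArg (ev i) (congrArg₂ (· + ·) S.d1e2 S.d2e1)
  have b23 := congrArg (ev i) (congrArg₂ (· + ·) S.d2e3 S.d3e2)
  have b31 := congrArg (ev i) (congrArg₂ (· + ·) S.d3e1 S.d1e3)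
  simp only [e1, e2, e3, map_zero, map_add, map_sub, map_mul, map_neg, map_ofNat] at b11 b22 b33 b12 b23 b31
  obtain ⟨p1, p2, p3⟩ := eq_zero_of_symm_traceFree (hm i)
    (x1 := ev i S.F1) (x2 := ev i S.F2) (x3 := ev i S.F3)
    (by linear_combination (-1 / 2) * b12) (by linear_combination (-1 / 2) * b23)
    (by linear_combination (-1 / 2) * b31) (by linear_combination (-1 / 2) * (b11 - b22))
    (by linear_combination (-1 / 2) * (b22 - b33))
  rcases hf with rfl | rfl | rfl
  exacts [p1, p2, p3]

end ShearFreeFrame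

/-! ### The quaternionic frame of a shear-free unit field -/

section CommutingDerivations

variable {R : Type*} [CommRing R] [Algebra ℝ R]

/-- The derivation with coefficients `A` in a family `p` of derivations. -/
def combDeriv (p : Fin 4 → Derivation ℝ R R) (A : Fin 4 → R) : Derivation ℝ R R := ∑ j, A j • p j

lemma combDeriv_apply (p : Fin 4 → Derivation ℝ R R) (A : Fin 4 → R) (f : R) :
    combDeriv p A f = ∑ j, A j * p j f := by
  have h : ∀ s : Finset (Fin 4), (∑ j ∈ s, A j • p j : Derivation ℝ R R) f
      = ∑ j ∈ s, A j * p j f := by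
    intro s
    induction s using Finset.cons_induction with
    | empty => simp
    | cons a s ha ih => rw [Finset.sum_cons, Finset.sum_cons, Derivation.add_apply, ih]; rfl
  exact h _

/-- The second-order terms cancel because the `p i` commute; only the bracket of the coefficient
fields remains. -/
lemma combDeriv_commutator {p : Fin 4 → Derivation ℝ R R}
    (hp : ∀ i j f, p i (p j f) = p j (p i f)) (A B : Fin 4 → R) (f : R) :
    combDeriv p A (combDeriv p B f) - combDeriv p B (combDeriv p A f) =
      ∑ l, (combDeriv p A (B l) - combDeriv p B (A l)) * p l f := by
  have h : ∀ A B : Fin 4 → R, combDeriv p A (combDeriv p B f) =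
      ∑ l, combDeriv p A (B l) * p l f + ∑ j, ∑ l, A j * B l * p j (p l f) := by
    intro A B
    rw [combDeriv_apply p B, map_sum, Finset.sum_comm, ← Finset.sum_add_distrib]
    refine Finset.sum_congr rfl fun l _ => ?_
    rw [Derivation.leibniz, smul_eq_mul, smul_eq_mul, combDeriv_apply p A (p l f), Finset.mul_sum,
      mul_comm, add_comm]
    congr 1
    exact Finset.sum_congr rfl fun j _ => by ring
  rw [h A B, h B A, add_sub_add_comm, ← Finset.sum_sub_distrib]
  have : ∑ j, ∑ l, A j * B l * p j (p l f) = ∑ j, ∑ l, B j * A l * p j (p l f) := by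
    rw [Finset.sum_comm]
    refine Finset.sum_congr rfl fun l _ => Finset.sum_congr rfl fun j _ => ?_
    rw [hp j l]; ring
  rw [this, sub_self, add_zero]
  exact Finset.sum_congr rfl fun l _ => by ring

/-- Left multiplication by the quaternion units `1, i, j, k`, in coordinates. -/
def quatFrame (u : Fin 4 → R) : Fin 4 → Fin 4 → R :=
  ![u, ![-u 1, u 0, -u 3, u 2], ![-u 2, u 3, u 0, -u 1], ![-u 3, -u 2, u 1, u 0]]

lemma quatFrame_apply (u : Fin 4 → R) (a b : Fin 4) : quatFrame u a b =
    (![u, ![-u 1, u 0, -u 3, u 2], ![-u 2, u 3, u 0, -u 1], ![-u 3, -u 2, u 1, u 0]] :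
      Fin 4 → Fin 4 → R) a b := rfl

variable (p : Fin 4 → Derivation ℝ R R) (u w : Fin 4 → R)

/-- The components of the derivative of `u` in the quaternionic frame. -/
def frameDeriv (a b : Fin 4) : R :=
  ∑ j, combDeriv p (quatFrame u a) (u j) * quatFrame u b j

/-- The components of the form `w` in the quaternionic frame. -/
def frameForm (a : Fin 4) : R := ∑ j, w j * quatFrame u a j

variable {p u w} {φ : R} (hp : ∀ i j f, p i (p j f) = p j (p i f))
  (hu : ∑ j, u j * u j = 1)
  (hK : ∀ i j, p i (u j) + p j (u i) + w i * u j + w j * u i = if i = j then 2 * φ else 0)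

include hu in
lemma frameDeriv_zero (a : Fin 4) : frameDeriv p u a 0 = 0 := by
  have h := congrArg (combDeriv p (quatFrame u a)) hu
  simp only [map_sum, Derivation.leibniz, smul_eq_mul, Derivation.map_one_eq_zero] at h
  refine ShearFreeFrame.cancel 2 two_ne_zero ?_
  rw [mul_zero, ← h, frameDeriv, Finset.mul_sum]
  refine Finset.sum_congr rfl fun j _ => ?_
  simp only [quatFrame, Matrix.cons_val_zero]
  push_cast; ring

include hu in
lemma combDeriv_quatFrame_apply (a j : Fin 4) : combDeriv p (quatFrame u a) (u j) =
    ∑ b, frameDeriv p u a b * quatFrame u b j := by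
  obtain ⟨v, hv⟩ : ∃ v : Fin 4 → R, ∀ j, v j = combDeriv p (quatFrame u a) (u j) :=
    ⟨_, fun j => rfl⟩
  simp only [frameDeriv, ← hv]
  simp only [Fin.sum_univ_four] at hu ⊢
  fin_cases j <;> simp [quatFrame] <;> linear_combination -(v _) * hu

include hK in
-- The component equations contracted with two arbitrary vectors, so that they can be read in any
-- frame.
lemma combDeriv_symm (X Y : Fin 4 → R) :
    ∑ j, combDeriv p X (u j) * Y j + ∑ j, combDeriv p Y (u j) * X j
      + (∑ j, w j * X j) * (∑ j, u j * Y j) + (∑ j, w j * Y j) * (∑ j, u j * X j)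
    = 2 * φ * ∑ j, X j * Y j := by
  have h : ∑ i, ∑ j, X i * Y j * (p i (u j) + p j (u i) + w i * u j + w j * u i) =
      ∑ i, ∑ j, X i * Y j * (if i = j then 2 * φ else 0) :=
    Finset.sum_congr rfl fun i _ => Finset.sum_congr rfl fun j _ => by rw [hK]
  simp only [combDeriv_apply]
  simp only [mul_ite, mul_zero, Finset.sum_ite_eq, Finset.mem_univ, if_true] at h
  simp only [Fin.sum_univ_four] at h ⊢
  linear_combination h

include hu in
lemma quatFrame_orthonormal (a b : Fin 4) :
    ∑ j, quatFrame u a j * quatFrame u b j = if a = b then 1 else 0 := by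
  simp only [Fin.sum_univ_four] at hu ⊢
  fin_cases a <;> fin_cases b <;> simp [quatFrame] <;> first | linear_combination hu | ring

include hu hK in
lemma frameDeriv_symm (a b : Fin 4) : frameDeriv p u a b + frameDeriv p u b a
    + frameForm u w a * (if 0 = b then 1 else 0) + frameForm u w b * (if 0 = a then 1 else 0)
    = if a = b then 2 * φ else 0 := by
  have h := combDeriv_symm hK (quatFrame u a) (quatFrame u b)
  have h0 : ∀ c, ∑ j, u j * quatFrame u c j = if 0 = c then 1 else 0 :=
    fun c => quatFrame_orthonormal hu 0 c
  rw [quatFrame_orthonormal hu, h0, h0] at h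
  rw [frameDeriv, frameDeriv, frameForm, frameForm, h]
  split_ifs <;> ring

/-- The frame of a shear-free unit field given by commuting derivations. -/
def ShearFreeFrame.ofCommuting (p : Fin 4 → Derivation ℝ R R) (u w : Fin 4 → R) (φ : R)
    (hp : ∀ i j f, p i (p j f) = p j (p i f)) (hu : ∑ j, u j * u j = 1)
    (hK : ∀ i j, p i (u j) + p j (u i) + w i * u j + w j * u i = if i = j then 2 * φ else 0) :
    ShearFreeFrame R :=
  have h0 := frameDeriv_zero (p := p) hu
  have hs := frameDeriv_symm hu hK
  have hc := combDeriv_quatFrame_apply (p := p) hu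
  -- The equation paired twice with `u`, where the derivative of `u` drops out because `u` is a unit
  -- field. The diagonal, mixed and horizontal off-diagonal pairs give `hd`, `hk` and `ha`: the
  -- horizontal part of `Du` is `φ` times the identity plus a skew map.
  have hφ : frameForm u w 0 = φ :=
    ShearFreeFrame.cancel 2 two_ne_zero (by
      have := hs 0 0; simp [h0] at this; push_cast; linear_combination this)
  have hd : ∀ i, i ≠ 0 → frameDeriv p u i i = frameForm u w 0 := fun i hi =>
    ShearFreeFrame.cancel 2 two_ne_zero (by
      have := hs i i; simp [hi.symm] at this; rw [hφ]; push_cast; linear_combination this)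
  have hk : ∀ i, i ≠ 0 → frameDeriv p u 0 i = -frameForm u w i := fun i hi => by
    have := hs 0 i; simp [hi.symm, h0] at this; linear_combination this
  have ha : ∀ i j, i ≠ 0 → j ≠ 0 → i ≠ j → frameDeriv p u i j = -frameDeriv p u j i :=
    fun i j hi hj hij => by
      have := hs i j; simp [hi.symm, hj.symm, hij] at this; linear_combination this
  have hcc := combDeriv_commutator hp
  have r : ∀ a j, combDeriv p (quatFrame u a) (u j) = frameDeriv p u a 0 * quatFrame u 0 j
      + frameDeriv p u a 1 * quatFrame u 1 j + frameDeriv p u a 2 * quatFrame u 2 j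
      + frameDeriv p u a 3 * quatFrame u 3 j := fun a j => by rw [hc, Fin.sum_univ_four]
  have r0 : ∀ j, combDeriv p (quatFrame u 0) (u j) = -frameForm u w 1 * quatFrame u 1 j
      - frameForm u w 2 * quatFrame u 2 j - frameForm u w 3 * quatFrame u 3 j := fun j => by
    rw [r, h0, hk 1 (by decide), hk 2 (by decide), hk 3 (by decide)]; ring
  have r1 : ∀ j, combDeriv p (quatFrame u 1) (u j) = frameForm u w 0 * quatFrame u 1 j
      + frameDeriv p u 1 2 * quatFrame u 2 j - frameDeriv p u 3 1 * quatFrame u 3 j := fun j => by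
    rw [r, h0, hd 1 (by decide), ha 1 3 (by decide) (by decide) (by decide)]; ring
  have r2 : ∀ j, combDeriv p (quatFrame u 2) (u j) = -frameDeriv p u 1 2 * quatFrame u 1 j
      + frameForm u w 0 * quatFrame u 2 j + frameDeriv p u 2 3 * quatFrame u 3 j := fun j => by
    rw [r, h0, hd 2 (by decide), ha 2 1 (by decide) (by decide) (by decide)]; ring
  have r3 : ∀ j, combDeriv p (quatFrame u 3) (u j) = frameDeriv p u 3 1 * quatFrame u 1 j
      - frameDeriv p u 2 3 * quatFrame u 2 j + frameForm u w 0 * quatFrame u 3 j := fun j => by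
    rw [r, h0, hd 3 (by decide), ha 3 2 (by decide) (by decide) (by decide)]; ring
  { d0 := combDeriv p (quatFrame u 0)
    d1 := combDeriv p (quatFrame u 1)
    d2 := combDeriv p (quatFrame u 2)
    d3 := combDeriv p (quatFrame u 3)
    u0 := u 0
    u1 := u 1
    u2 := u 2
    u3 := u 3
    a := frameForm u w 0
    m1 := frameDeriv p u 2 3
    m2 := frameDeriv p u 3 1
    m3 := frameDeriv p u 1 2
    k1 := -frameForm u w 1
    k2 := -frameForm u w 2
    k3 := -frameForm u w 3
    unit := by rw [← hu, Fin.sum_univ_four]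
    d0u0 := by rw [r0]; simp [quatFrame]
    d0u1 := by rw [r0]; simp [quatFrame]; ring
    d0u2 := by rw [r0]; simp [quatFrame]; ring
    d0u3 := by rw [r0]; simp [quatFrame]; ring
    d1u0 := by rw [r1]; simp [quatFrame]; ring
    d1u1 := by rw [r1]; simp [quatFrame]
    d1u2 := by rw [r1]; simp [quatFrame]
    d1u3 := by rw [r1]; simp [quatFrame]; ring
    d2u0 := by rw [r2]; simp [quatFrame]; ring
    d2u1 := by rw [r2]; simp [quatFrame]; ring
    d2u2 := by rw [r2]; simp [quatFrame]
    d2u3 := by rw [r2]; simp [quatFrame]; ring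
    d3u0 := by rw [r3]; simp [quatFrame]; ring
    d3u1 := by rw [r3]; simp [quatFrame]; ring
    d3u2 := by rw [r3]; simp [quatFrame]
    d3u3 := by rw [r3]; simp [quatFrame]
    -- Each frame vector has components `± u j`, so its derivatives are again given by `r0`, `r1`,
    -- `r2`, `r3`.
    c01 := fun f => by
      rw [hcc]
      simp only [combDeriv_apply p _ f, Fin.sum_univ_four, quatFrame_apply, Matrix.cons_val, map_neg, r0, r1, r2, r3]
      ring
    c02 := fun f => by
      rw [hcc]
      simp only [combDeriv_apply p _ f, Fin.sum_univ_four, quatFrame_apply, Matrix.cons_val, map_neg, r0, r1, r2, r3]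
      ring
    c03 := fun f => by
      rw [hcc]
      simp only [combDeriv_apply p _ f, Fin.sum_univ_four, quatFrame_apply, Matrix.cons_val, map_neg, r0, r1, r2, r3]
      ring
    c12 := fun f => by
      rw [hcc]
      simp only [combDeriv_apply p _ f, Fin.sum_univ_four, quatFrame_apply, Matrix.cons_val, map_neg, r0, r1, r2, r3]
      ring
    c23 := fun f => by
      rw [hcc]
      simp only [combDeriv_apply p _ f, Fin.sum_univ_four, quatFrame_apply, Matrix.cons_val, map_neg, r0, r1, r2, r3]
      ring
    c31 := fun f => by
      rw [hcc]
      simp only [combDeriv_apply p _ f, Fin.sum_univ_four, quatFrame_apply, Matrix.cons_val, map_neg, r0, r1, r2, r3]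
      ring }

end CommutingDerivations

/-! ### Closedness of the coupling form in four commuting directions -/

section Curl

variable {R : Type*} [CommRing R] [Algebra ℝ R]

/-- An antisymmetric array is determined by its components in an orthonormal frame. -/
lemma eq_zero_of_frame_eq_zero {A : Type*} [CommRing A] {Q : Matrix (Fin 4) (Fin 4) A}
    (hQ : Q * Q.transpose = 1) {T : Matrix (Fin 4) (Fin 4) A}
    (h : ∀ a b, a < b → ∑ i, ∑ j, Q a i * Q b j * T i j = 0) (hT : ∀ i j, T i j = -T j i)
    (hd : ∀ i, T i i = 0) : T = 0 := by
  have hQ' : Q.transpose * Q = 1 := mul_eq_one_comm.1 hQ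
  have e : ∀ a b, (Q * T * Q.transpose) a b = ∑ i, ∑ j, Q a i * Q b j * T i j := fun a b => by
    simp only [Matrix.mul_apply, Matrix.transpose_apply, Finset.sum_mul]
    rw [Finset.sum_comm]
    exact Finset.sum_congr rfl fun _ _ => Finset.sum_congr rfl fun _ _ => by ring
  have h0 : Q * T * Q.transpose = 0 := by
    ext a b
    rw [e, Matrix.zero_apply]
    rcases lt_trichotomy a b with hab | rfl | hab
    · exact h a b hab
    · simp only [Fin.sum_univ_four, hd, hT 1 0, hT 2 0, hT 3 0, hT 2 1, hT 3 1, hT 3 2]; ring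
    · rw [← neg_eq_zero, ← h b a hab]
      simp only [Fin.sum_univ_four, hd, hT 1 0, hT 2 0, hT 3 0, hT 2 1, hT 3 1, hT 3 2]; ring
  calc T = (Q.transpose * Q) * T * (Q.transpose * Q) := by rw [hQ']; simp
    _ = Q.transpose * (Q * T * Q.transpose) * Q := by simp only [Matrix.mul_assoc]
    _ = 0 := by rw [h0]; simp

lemma sum_frame_eq {A : Type*} [CommRing A] {Q : Matrix (Fin 4) (Fin 4) A}
    (hQ : Q * Q.transpose = 1) (T : Matrix (Fin 4) (Fin 4) A) (x y : Fin 4 → A) :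
    ∑ i, ∑ j, x i * y j * T i j = ∑ a, ∑ b, (∑ i, Q a i * x i) * (∑ j, Q b j * y j) *
      ∑ i, ∑ j, Q a i * Q b j * T i j := by
  have hQ' : Q.transpose * Q = 1 := mul_eq_one_comm.1 hQ
  have e : ∀ x y : Fin 4 → A, ∑ i, ∑ j, x i * y j * T i j = x ⬝ᵥ T.mulVec y := fun x y => by
    simp only [dotProduct, Matrix.mulVec, Finset.mul_sum]
    exact Finset.sum_congr rfl fun _ _ => Finset.sum_congr rfl fun _ _ => by ring
  have e' : ∀ a b, ∑ i, ∑ j, Q a i * Q b j * T i j = (Q * T * Q.transpose) a b := fun a b => by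
    simp only [Matrix.mul_apply, Matrix.transpose_apply, Finset.sum_mul]
    rw [Finset.sum_comm]
    exact Finset.sum_congr rfl fun _ _ => Finset.sum_congr rfl fun _ _ => by ring
  have e2 : ∀ x y : Fin 4 → A, ∑ i, ∑ j, x i * y j * (Q * T * Q.transpose) i j =
      x ⬝ᵥ (Q * T * Q.transpose).mulVec y := fun x y => by
    simp only [dotProduct, Matrix.mulVec, Finset.mul_sum]
    exact Finset.sum_congr rfl fun _ _ => Finset.sum_congr rfl fun _ _ => by ring
  simp only [e']
  rw [e, show ∑ a, ∑ b, (∑ i, Q a i * x i) * (∑ j, Q b j * y j) * (Q * T * Q.transpose) a b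
    = _ from e2 (Q.mulVec x) (Q.mulVec y)]
  rw [Matrix.mulVec_mulVec, Matrix.mul_assoc, hQ', Matrix.mul_one, ← Matrix.mulVec_mulVec,
    Matrix.dotProduct_mulVec (Q.mulVec x) Q, Matrix.vecMul_mulVec, hQ', Matrix.vecMul_one]

variable {p : Fin 4 → Derivation ℝ R R} {u w : Fin 4 → R} {φ : R}
  (hp : ∀ i j f, p i (p j f) = p j (p i f)) (hu : ∑ j, u j * u j = 1)
  (hK : ∀ i j, p i (u j) + p j (u i) + w i * u j + w j * u i = if i = j then 2 * φ else 0)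

include hu in
lemma quatFrame_mul_transpose :
    Matrix.of (quatFrame u) * (Matrix.of (quatFrame u)).transpose = 1 := by
  ext a b
  rw [Matrix.mul_apply, Matrix.one_apply, ← quatFrame_orthonormal hu]
  rfl

/-- The invariant formula `dw(X, Y) = X(w(Y)) - Y(w(X)) - w([X, Y])` for two vectors of the frame.
-/
lemma curl_frame (w : Fin 4 → R) (a b : Fin 4) :
    ∑ i, ∑ j, quatFrame u a i * quatFrame u b j * (p i (w j) - p j (w i)) =
      combDeriv p (quatFrame u a) (frameForm u w b) - combDeriv p (quatFrame u b) (frameForm u w a)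
      - ∑ j, w j * (combDeriv p (quatFrame u a) (quatFrame u b j)
        - combDeriv p (quatFrame u b) (quatFrame u a j)) := by
  simp only [frameForm, map_sum, Derivation.leibniz, smul_eq_mul, combDeriv_apply]
  generalize quatFrame u a = X
  generalize quatFrame u b = Y
  simp only [Fin.sum_univ_four]
  ring

include hp hu hK in
lemma curl_form_eq_zero
    (hF : ∀ f ∈ ({(ShearFreeFrame.ofCommuting p u w φ hp hu hK).F1,
      (ShearFreeFrame.ofCommuting p u w φ hp hu hK).F2,
      (ShearFreeFrame.ofCommuting p u w φ hp hu hK).F3} : Set R), f = 0)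
    (he : ∀ e ∈ ({(ShearFreeFrame.ofCommuting p u w φ hp hu hK).e1,
      (ShearFreeFrame.ofCommuting p u w φ hp hu hK).e2,
      (ShearFreeFrame.ofCommuting p u w φ hp hu hK).e3} : Set R), e = 0) (i j : Fin 4) :
    p i (w j) = p j (w i) := by
  obtain ⟨S, hS⟩ : ∃ S, S = ShearFreeFrame.ofCommuting p u w φ hp hu hK := ⟨_, rfl⟩
  have d0 : combDeriv p (quatFrame u 0) = S.d0 := by rw [hS]; rfl
  have d1 : combDeriv p (quatFrame u 1) = S.d1 := by rw [hS]; rfl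
  have d2 : combDeriv p (quatFrame u 2) = S.d2 := by rw [hS]; rfl
  have d3 : combDeriv p (quatFrame u 3) = S.d3 := by rw [hS]; rfl
  have u0 : u 0 = S.u0 := by rw [hS]; rfl
  have u1 : u 1 = S.u1 := by rw [hS]; rfl
  have u2 : u 2 = S.u2 := by rw [hS]; rfl
  have u3 : u 3 = S.u3 := by rw [hS]; rfl
  have w0 : frameForm u w 0 = S.a := by rw [hS]; rfl
  have w1 : frameForm u w 1 = -S.k1 := by rw [hS]; exact (neg_neg _).symm
  have w2 : frameForm u w 2 = -S.k2 := by rw [hS]; exact (neg_neg _).symm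
  have w3 : frameForm u w 3 = -S.k3 := by rw [hS]; exact (neg_neg _).symm
  have v0 := w0
  have v1 := w1
  have v2 := w2
  have v3 := w3
  rw [frameForm, Fin.sum_univ_four] at v0 v1 v2 v3
  simp only [quatFrame_apply, Matrix.cons_val, u0, u1, u2, u3] at v0 v1 v2 v3
  have hF1 := hF _ (Set.mem_insert _ _)
  have hF2 := hF _ (Set.mem_insert_of_mem _ (Set.mem_insert _ _))
  have hF3 := hF _ (Set.mem_insert_of_mem _ (Set.mem_insert_of_mem _ rfl))
  have he1 := he _ (Set.mem_insert _ _)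
  have he2 := he _ (Set.mem_insert_of_mem _ (Set.mem_insert _ _))
  have he3 := he _ (Set.mem_insert_of_mem _ (Set.mem_insert_of_mem _ rfl))
  rw [← hS] at hF1 hF2 hF3 he1 he2 he3
  have key : ∀ a b : Fin 4, a < b → combDeriv p (quatFrame u a) (frameForm u w b)
      - combDeriv p (quatFrame u b) (frameForm u w a)
      - ∑ j, w j * (combDeriv p (quatFrame u a) (quatFrame u b j)
        - combDeriv p (quatFrame u b) (quatFrame u a j)) = 0 := by
    intro a b hab
    simp only [Fin.sum_univ_four]
    fin_cases a <;> fin_cases b <;> first | exact absurd hab (by decide) | skip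
    all_goals
      simp only [Fin.zero_eta, Fin.mk_one, Fin.reduceFinMk, quatFrame_apply _ _ 0,
        quatFrame_apply _ _ 1, quatFrame_apply _ _ 2, quatFrame_apply _ _ 3, Matrix.cons_val,
        d0, d1, d2, d3, u0, u1, u2, u3, w0, w1, w2, w3, map_neg, S.d0u0, S.d0u1, S.d0u2, S.d0u3,
        S.d1u0, S.d1u1, S.d1u2, S.d1u3, S.d2u0, S.d2u1, S.d2u2, S.d2u3, S.d3u0, S.d3u1, S.d3u2,
        S.d3u3, S.d0k1, S.d0k2, S.d0k3, S.d1k2, S.d1k3, S.d2k1, S.d2k3, S.d3k1, S.d3k2, S.d1a,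
        S.d2a, S.d3a]
    -- For the pairs `01, 02, 03, 12, 13, 23` the components of `dw` are `F1, F2, F3, 2 e3, -2 e2, 2
    -- e1`; the terms in `v0`, …, `v3` evaluate `w` on the bracket.
    · linear_combination hF1 + S.k1 * v0 + S.a * v1 - (S.k2 + S.m2) * v3 + (S.k3 + S.m3) * v2
    · linear_combination hF2 + S.k2 * v0 + S.a * v2 - (S.k3 + S.m3) * v1 + (S.k1 + S.m1) * v3
    · linear_combination hF3 + S.k3 * v0 + S.a * v3 - (S.k1 + S.m1) * v2 + (S.k2 + S.m2) * v1
    · linear_combination 2 * he3 + 2 * S.m3 * v0 + 2 * S.a * v3 - S.m1 * v2 + S.m2 * v1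
    · linear_combination -2 * he2 - 2 * S.m2 * v0 - 2 * S.a * v2 + S.m3 * v1 - S.m1 * v3
    · linear_combination 2 * he1 + 2 * S.m1 * v0 + 2 * S.a * v1 - S.m2 * v3 + S.m3 * v2
  have hz := eq_zero_of_frame_eq_zero (quatFrame_mul_transpose hu)
    (T := Matrix.of fun i j => p i (w j) - p j (w i))
    (fun a b hab => (curl_frame w a b).trans (key a b hab)) (fun i j => by simp) (fun i => by simp)
  exact sub_eq_zero.1 (congrFun (congrFun hz i) j)

include hp hu hK in
/-- Over a ring of functions, the form of a shear-free unit field is closed if the rotation of the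
field vanishes nowhere. -/
theorem curl_form_eq_zero_of_rotation {ι : Type*} (ev : ι → R →+* ℝ)
    (hev : ∀ r : R, (∀ i, ev i r = 0) → r = 0)
    (hm : ∀ s, ∃ x y : Fin 4 → ℝ, ∑ i, ev s (u i) * x i = 0 ∧ ∑ i, ev s (u i) * y i = 0 ∧
      ∑ i, ∑ j, x i * y j * (ev s (p i (u j)) - ev s (p j (u i))) ≠ 0) (i j : Fin 4) :
    p i (w j) = p j (w i) := by
  have hrot : (ShearFreeFrame.ofCommuting p u w φ hp hu hK).RotationNeZero ev := by
    intro s h0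
    obtain ⟨x, y, hx, hy, hne⟩ := hm s
    replace h0 : ev s (frameDeriv p u 2 3) * ev s (frameDeriv p u 2 3)
        + ev s (frameDeriv p u 3 1) * ev s (frameDeriv p u 3 1)
        + ev s (frameDeriv p u 1 2) * ev s (frameDeriv p u 1 2) = 0 := h0
    have m1 : ev s (frameDeriv p u 2 3) = 0 := by
      nlinarith [mul_self_nonneg (ev s (frameDeriv p u 3 1)),
        mul_self_nonneg (ev s (frameDeriv p u 1 2)), mul_self_nonneg (ev s (frameDeriv p u 2 3))]
    have m2 : ev s (frameDeriv p u 3 1) = 0 := by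
      nlinarith [mul_self_nonneg (ev s (frameDeriv p u 3 1)),
        mul_self_nonneg (ev s (frameDeriv p u 1 2)), mul_self_nonneg (ev s (frameDeriv p u 2 3))]
    have m3 : ev s (frameDeriv p u 1 2) = 0 := by
      nlinarith [mul_self_nonneg (ev s (frameDeriv p u 3 1)),
        mul_self_nonneg (ev s (frameDeriv p u 1 2)), mul_self_nonneg (ev s (frameDeriv p u 2 3))]
    have hsymm := fun a b => congrArg (ev s) (frameDeriv_symm hu hK a b)
    have n1 := hsymm 2 3
    have n2 := hsymm 1 3
    have n3 := hsymm 1 2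
    simp [m1, m2, m3] at n1 n2 n3
    have hQ : (Matrix.of (quatFrame u)).map (ev s)
        * ((Matrix.of (quatFrame u)).map (ev s)).transpose = 1 := by
      rw [← Matrix.transpose_map, ← Matrix.map_mul, quatFrame_mul_transpose hu]
      simp
    have hcomp : ∀ a b, ∑ i, ∑ j, ev s (quatFrame u a i) * ev s (quatFrame u b j) *
        (ev s (p i (u j)) - ev s (p j (u i))) =
        ev s (frameDeriv p u a b) - ev s (frameDeriv p u b a) := by
      intro a b
      simp only [← map_mul, ← map_sub, ← map_sum, frameDeriv, combDeriv_apply]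
      congr 1
      simp only [Fin.sum_univ_four]
      ring
    refine hne ?_
    -- Expanded in the frame, only horizontal pairs survive, because `x` and `y` are orthogonal to
    -- `u`. On those pairs `du` is twice a component of `m`, up to sign, which is zero here.
    have := sum_frame_eq hQ (Matrix.of fun i j => ev s (p i (u j)) - ev s (p j (u i))) x y
    simp only [Matrix.of_apply, Matrix.map_apply, hcomp] at this
    rw [this]
    have x0 : ∑ i, ev s (quatFrame u 0 i) * x i = 0 := hx
    have y0 : ∑ i, ev s (quatFrame u 0 i) * y i = 0 := hy
    rw [Fin.sum_univ_four]
    simp only [Fin.sum_univ_four (fun b => _ * _ * _)]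
    rw [x0, y0]
    simp only [m1, m2, m3, n1, n2, n3, sub_self, mul_zero, zero_mul, add_zero]
  exact curl_form_eq_zero hp hu hK (ShearFreeFrame.F_eq_zero hev hrot)
    (ShearFreeFrame.e_eq_zero hev hrot) i j

end Curl

/-! ### The algebra of smooth functions on an open set and its partial derivatives -/

section SmoothRing

variable {E : Type*} [NormedAddCommGroup E] [NormedSpace ℝ E] {W : Set E}

open Classical in
/-- Extension by zero of a function on a subset. -/
noncomputable def extendZero (f : W → ℝ) (x : E) : ℝ := if h : x ∈ W then f ⟨x, h⟩ else 0

lemma extendZero_apply (f : W → ℝ) (x : W) : extendZero f x = f x := by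
  simp [extendZero]

lemma extendZero_eqOn {f : W → ℝ} {F : E → ℝ} (h : ∀ x : W, f x = F x) :
    Set.EqOn (extendZero f) F W := fun x hx => by
  rw [← h ⟨x, hx⟩]; exact extendZero_apply f ⟨x, hx⟩

lemma contDiffOn_extendZero {f : W → ℝ} {F : E → ℝ} (hF : ContDiffOn ℝ ∞ F W)
    (h : ∀ x : W, f x = F x) : ContDiffOn ℝ ∞ (extendZero f) W :=
  hF.congr (extendZero_eqOn h)

variable (W) in
/-- The algebra of smooth functions on a subset of a normed space. -/
noncomputable def smoothAlgebra : Subalgebra ℝ (W → ℝ) where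
  carrier := {f | ContDiffOn ℝ ∞ (extendZero f) W}
  mul_mem' := fun {f g} hf hg => contDiffOn_extendZero (ContDiffOn.mul hf hg) fun x => by
    simp [extendZero_apply]
  add_mem' := fun {f g} hf hg => contDiffOn_extendZero (ContDiffOn.add hf hg) fun x => by
    simp [extendZero_apply]
  algebraMap_mem' := fun r => contDiffOn_extendZero (F := fun _ => r) contDiffOn_const fun x => rfl

/-- The restriction of a smooth function, as an element of the algebra. -/
noncomputable def smoothAlgebra.restrict (F : E → ℝ) (hF : ContDiffOn ℝ ∞ F W) : smoothAlgebra W :=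
  ⟨fun x => F x, contDiffOn_extendZero hF fun _ => rfl⟩

/-- Evaluation at a point. -/
noncomputable def smoothAlgebra.eval (x : W) : smoothAlgebra W →+* ℝ :=
  (Pi.evalRingHom (fun _ : W => ℝ) x).comp (smoothAlgebra W).val.toRingHom

lemma smoothAlgebra.eval_ext {f g : smoothAlgebra W}
    (h : ∀ x, smoothAlgebra.eval x f = smoothAlgebra.eval x g) : f = g :=
  Subtype.ext (funext h)

lemma smoothAlgebra.contDiffOn_fderiv (hW : IsOpen W) (f : smoothAlgebra W) (v : E) :
    ContDiffOn ℝ ∞ (fun x => fderiv ℝ (extendZero f.1) x v) W :=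
  (ContDiffOn.fderiv_of_isOpen (n := ∞) (m := ∞) f.2 hW (by simp)).clm_apply contDiffOn_const

lemma smoothAlgebra.differentiableAt (hW : IsOpen W) (f : smoothAlgebra W) (x : W) :
    DifferentiableAt ℝ (extendZero f.1) x :=
  ((ContDiffOn.differentiableOn f.2 (by simp)) x x.2).differentiableAt (hW.mem_nhds x.2)

lemma fderiv_extendZero (hW : IsOpen W) {f : W → ℝ} {F : E → ℝ} (h : ∀ x : W, f x = F x) (x : W) :
    fderiv ℝ (extendZero f) x = fderiv ℝ F x :=
  Filter.EventuallyEq.fderiv_eq (Filter.eventuallyEq_of_mem (hW.mem_nhds x.2) (extendZero_eqOn h))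

/-- The directional derivative on smooth functions. -/
noncomputable def smoothAlgebra.partialDeriv (hW : IsOpen W) (v : E) :
    Derivation ℝ (smoothAlgebra W) (smoothAlgebra W) :=
  Derivation.mk'
    { toFun := fun f => smoothAlgebra.restrict (fun x => fderiv ℝ (extendZero f.1) x v)
        (smoothAlgebra.contDiffOn_fderiv hW f v)
      map_add' := fun f g => Subtype.ext (funext fun x => by
        change fderiv ℝ (extendZero (f.1 + g.1)) x v = fderiv ℝ (extendZero f.1) x v +
          fderiv ℝ (extendZero g.1) x v
        rw [fderiv_extendZero hW (F := extendZero f.1 + extendZero g.1)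
            (fun x => by simp [extendZero_apply]), fderiv_add (differentiableAt hW f x)
            (differentiableAt hW g x)]
        rfl)
      map_smul' := fun c f => Subtype.ext (funext fun x => by
        change fderiv ℝ (extendZero (c • f.1)) x v = c * fderiv ℝ (extendZero f.1) x v
        rw [fderiv_extendZero hW (F := c • extendZero f.1)
            (fun x => by simp [extendZero_apply]), fderiv_const_smul (differentiableAt hW f x)]
        rfl) }
    (fun f g => Subtype.ext (funext fun x => by
      change fderiv ℝ (extendZero (f.1 * g.1)) x v = f.1 x * fderiv ℝ (extendZero g.1) x v +
          g.1 x * fderiv ℝ (extendZero f.1) x v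
      rw [fderiv_extendZero hW (F := extendZero f.1 * extendZero g.1)
        (fun x => by simp [extendZero_apply]), fderiv_mul (differentiableAt hW f x)
        (differentiableAt hW g x)]
      simp [extendZero_apply]))

lemma smoothAlgebra.eval_partialDeriv (hW : IsOpen W) (v : E) (f : smoothAlgebra W) {F : E → ℝ}
    (h : ∀ x : W, f.1 x = F x) (x : W) :
    smoothAlgebra.eval x (smoothAlgebra.partialDeriv hW v f) = fderiv ℝ F x v := by
  rw [← fderiv_extendZero hW h]; rfl

lemma smoothAlgebra.partialDeriv_comm (hW : IsOpen W) (v w : E) (f : smoothAlgebra W) :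
    smoothAlgebra.partialDeriv hW v (smoothAlgebra.partialDeriv hW w f) =
      smoothAlgebra.partialDeriv hW w (smoothAlgebra.partialDeriv hW v f) := by
  have h : ∀ v w : E, ∀ x : W, smoothAlgebra.eval x
      (smoothAlgebra.partialDeriv hW v (smoothAlgebra.partialDeriv hW w f)) =
      fderiv ℝ (fderiv ℝ (extendZero f.1)) x v w := fun v w x => by
    rw [smoothAlgebra.eval_partialDeriv hW v _
      (F := fun y => fderiv ℝ (extendZero f.1) y w) (fun _ => rfl)]
    have hd : DifferentiableAt ℝ (fderiv ℝ (extendZero f.1)) x :=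
      (((ContDiffOn.fderiv_of_isOpen (n := ∞) (m := ∞) f.2 hW (by simp)).differentiableOn
        (by simp)) x x.2).differentiableAt (hW.mem_nhds x.2)
    rw [fderiv_clm_apply hd (differentiableAt_const w)]
    simp
  refine smoothAlgebra.eval_ext fun x => ?_
  rw [h, h]
  have hs : IsSymmSndFDerivAt ℝ (extendZero f.1) (x : E) :=
    ContDiffAt.isSymmSndFDerivAt (n := ∞)
      ((show ContDiffOn ℝ ∞ (extendZero f.1) W from f.2).contDiffAt (hW.mem_nhds x.2)) (by simp; exact WithTop.coe_le_coe.2 le_top)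
  exact hs v w

end SmoothRing

/-! ### Reduction to four directions -/

section Euclidean

variable {E : Type*} [NormedAddCommGroup E] [InnerProductSpace ℝ E] [FiniteDimensional ℝ E]

/-- Gram–Schmidt is triangular: each `s i` lies in the span of the vectors with index at most `i`.
This covers dependent families too, because the process is completed to an orthonormal basis. -/
lemma exists_orthonormal_expansion {k : ℕ} (hE : k ≤ Module.finrank ℝ E) (s : Fin k → E) :
    ∃ v : Fin k → E, Orthonormal ℝ v ∧ ∀ i, s i = ∑ j, inner ℝ (v j) (s i) • v j := by
  obtain ⟨b, hb⟩ : ∃ b : OrthonormalBasis (Fin (Module.finrank ℝ E)) ℝ E,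
      ∀ (i : Fin k) (j : Fin (Module.finrank ℝ E)), (i : ℕ) < j → inner ℝ (b j) (s i) = 0 := by
    refine ⟨InnerProductSpace.gramSchmidtOrthonormalBasis (by simp)
      -- The family is padded with zeros up to the dimension of the space.
      (fun i => if h : (i : ℕ) < k then s ⟨i, h⟩ else 0), fun i j hij => ?_⟩
    have := InnerProductSpace.gramSchmidtOrthonormalBasis_inv_triangular (𝕜 := ℝ) (E := E)
      (h := by simp) (fun i : Fin (Module.finrank ℝ E) => if h : (i : ℕ) < k then s ⟨i, h⟩ else 0)
      (i := Fin.castLE hE i) (j := j) hij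
    simpa using this
  refine ⟨fun i => b (Fin.castLE hE i), b.orthonormal.comp _ (Fin.castLE_injective hE), fun i => ?_⟩
  conv_lhs => rw [← b.sum_repr' (s i)]
  symm
  refine Finset.sum_of_injOn (Fin.castLE hE) ((Fin.castLE_injective hE).injOn) (by simp) ?_ (by simp)
  intro j _ hj
  rw [hb i j, zero_smul]
  by_contra hlt
  refine hj ⟨⟨j, by omega⟩, by simp, by ext; simp⟩

lemma inner_eq_sum_of_expansion {k : ℕ} {v : Fin k → E} {x y : E}
    (hx : x = ∑ j, inner ℝ (v j) x • v j) : inner ℝ x y = ∑ j, inner ℝ (v j) x * inner ℝ (v j) y := by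
  conv_lhs => rw [hx]
  simp only [sum_inner, real_inner_smul_left]

/-- The functions remain functions on an open set of `E`; only the derivatives are restricted, to
the four directions `v i`. The four-dimensional theorem is applied to the normalised projection of
`u`, on the open set where this projection and its rotation on the projected vectors do not vanish.
-/
lemma fderiv_symm_on_four {W : Set E} (hW : IsOpen W) {u : E → E} {w : E → E →L[ℝ] ℝ} {φ : E → ℝ}
    (hu : ContDiffOn ℝ ∞ u W) (hw : ContDiffOn ℝ ∞ w W)
    (hK : ∀ x ∈ W, ∀ X Y, inner ℝ (fderiv ℝ u x X) Y + inner ℝ (fderiv ℝ u x Y) X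
      + w x X * inner ℝ (u x) Y + w x Y * inner ℝ (u x) X = 2 * φ x * inner ℝ X Y)
    {v : Fin 4 → E} (hv : Orthonormal ℝ v) {x₀ : E} (hx₀ : x₀ ∈ W) (hne : u x₀ ≠ 0)
    (huv : u x₀ = ∑ j, inner ℝ (v j) (u x₀) • v j) {X Y : E}
    (hX : X = ∑ j, inner ℝ (v j) X • v j) (hY : Y = ∑ j, inner ℝ (v j) Y • v j)
    (huX : inner ℝ (u x₀) X = 0) (huY : inner ℝ (u x₀) Y = 0)
    (hXY : inner ℝ (fderiv ℝ u x₀ X) Y ≠ inner ℝ (fderiv ℝ u x₀ Y) X) (i j : Fin 4) :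
    fderiv ℝ w x₀ (v i) (v j) = fderiv ℝ w x₀ (v j) (v i) := by
  have hud : ∀ x ∈ W, DifferentiableAt ℝ u x := fun x hx =>
    ((hu.differentiableOn (by simp)) x hx).differentiableAt (hW.mem_nhds hx)
  have hwd : ∀ x ∈ W, DifferentiableAt ℝ w x := fun x hx =>
    ((hw.differentiableOn (by simp)) x hx).differentiableAt (hW.mem_nhds hx)
  let U : Fin 4 → E → ℝ := fun j x => inner ℝ (v j) (u x)
  have hU : ∀ j, ContDiffOn ℝ ∞ (U j) W := fun j => contDiffOn_const.inner ℝ hu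
  have hUd : ∀ j, ∀ x ∈ W, ∀ Z, fderiv ℝ (U j) x Z = inner ℝ (v j) (fderiv ℝ u x Z) := by
    intro j x hx Z
    have := ((innerSL ℝ (v j)).hasFDerivAt.comp x (hud x hx).hasFDerivAt).fderiv
    exact congrArg (fun L => L Z) this
  have hUd' : ∀ i j, ContDiffOn ℝ ∞ (fun x => fderiv ℝ (U j) x (v i)) W := fun i j =>
    (ContDiffOn.fderiv_of_isOpen (n := ∞) (m := ∞) (hU j) hW (by simp)).clm_apply contDiffOn_const
  let ρ : E → ℝ := fun x => ∑ j, U j x * U j x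
  have hρ : ContDiffOn ℝ ∞ ρ W := ContDiffOn.sum fun j _ => (hU j).mul (hU j)
  -- Projection orthogonal to `U`, multiplied by `ρ` so as to need no division. It makes `X'` and
  -- `Y'` horizontal at every point, and `f` is the rotation evaluated on them.
  let pr : E → (Fin 4 → ℝ) → Fin 4 → ℝ := fun x z i => ρ x * z i - (∑ k, U k x * z k) * U i x
  let X' : Fin 4 → ℝ := fun i => inner ℝ (v i) X
  let Y' : Fin 4 → ℝ := fun i => inner ℝ (v i) Y
  let f : E → ℝ := fun x => ∑ i, ∑ j, pr x X' i * pr x Y' j *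
    (fderiv ℝ (U j) x (v i) - fderiv ℝ (U i) x (v j))
  have hpr : ∀ z i, ContDiffOn ℝ ∞ (fun x => pr x z i) W := fun z i =>
    (hρ.mul contDiffOn_const).sub
      ((ContDiffOn.sum fun k _ => (hU k).mul contDiffOn_const).mul (hU i))
  have hf : ContDiffOn ℝ ∞ f W := ContDiffOn.sum fun i _ => ContDiffOn.sum fun j _ =>
    ((hpr _ _).mul (hpr _ _)).mul ((hUd' i j).sub (hUd' j i))
  let W' : Set E := W ∩ (fun x => ρ x * f x) ⁻¹' {0}ᶜ
  have hW' : IsOpen W' :=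
    (hρ.mul hf).continuousOn.isOpen_inter_preimage hW isOpen_compl_singleton
  have hsub : W' ⊆ W := Set.inter_subset_left
  have hρ0 : ρ x₀ ≠ 0 := by
    have : ρ x₀ = inner ℝ (u x₀) (u x₀) := (inner_eq_sum_of_expansion huv).symm
    rw [this]
    exact inner_self_ne_zero.2 hne
  have hx₀' : x₀ ∈ W' := by
    refine ⟨hx₀, mul_ne_zero hρ0 ?_⟩
    have h1 : ∀ z, inner ℝ (u x₀) z = 0 → pr x₀ (fun i => inner ℝ (v i) z)
        = fun i => ρ x₀ * inner ℝ (v i) z := fun z hz => by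
      funext i
      have : ∑ k, U k x₀ * inner ℝ (v k) z = 0 := by
        rw [← hz]; exact (inner_eq_sum_of_expansion huv).symm
      change ρ x₀ * inner ℝ (v i) z - (∑ k, U k x₀ * inner ℝ (v k) z) * U i x₀ = _
      rw [this]; ring
    have h2 : f x₀ = ρ x₀ * ρ x₀ *
        (inner ℝ (fderiv ℝ u x₀ X) Y - inner ℝ (fderiv ℝ u x₀ Y) X) := by
      have e1 : ∀ A B : E, A = ∑ j, inner ℝ (v j) A • v j → B = ∑ j, inner ℝ (v j) B • v j →
          inner ℝ (fderiv ℝ u x₀ A) B = ∑ i, ∑ j, inner ℝ (v i) A * inner ℝ (v j) B *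
            fderiv ℝ (U j) x₀ (v i) := by
        intro A B hA hB
        conv_lhs => rw [hA, hB]
        simp only [map_sum, map_smul, sum_inner, inner_sum, real_inner_smul_left,
          real_inner_smul_right, hUd _ x₀ hx₀]
        rw [Finset.sum_comm]
        refine Finset.sum_congr rfl fun i _ => Finset.sum_congr rfl fun j _ => ?_
        rw [real_inner_comm (fderiv ℝ u x₀ (v i)) (v j)]; ring
      rw [e1 X Y hX hY, e1 Y X hY hX]
      change ∑ i, ∑ j, pr x₀ (fun i => inner ℝ (v i) X) i * pr x₀ (fun i => inner ℝ (v i) Y) j *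
        (fderiv ℝ (U j) x₀ (v i) - fderiv ℝ (U i) x₀ (v j)) = _
      rw [h1 X huX, h1 Y huY, Finset.sum_comm (γ := Fin 4)
        (f := fun i j => inner ℝ (v i) Y * inner ℝ (v j) X * fderiv ℝ (U j) x₀ (v i)),
        ← Finset.sum_sub_distrib, Finset.mul_sum]
      refine Finset.sum_congr rfl fun i _ => ?_
      rw [← Finset.sum_sub_distrib, Finset.mul_sum]
      refine Finset.sum_congr rfl fun j _ => ?_
      ring
    rw [h2]
    exact mul_ne_zero (mul_ne_zero hρ0 hρ0) (sub_ne_zero.2 hXY)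
  have hρpos : ∀ x ∈ W', 0 < ρ x := fun x hx =>
    lt_of_le_of_ne (Finset.sum_nonneg fun j _ => mul_self_nonneg _)
      (Ne.symm (left_ne_zero_of_mul hx.2))
  have hq : ContDiffOn ℝ ∞ (fun x => √(ρ x)) W' :=
    (hρ.mono hsub).sqrt fun x hx => (hρpos x hx).ne'
  have hq0 : ∀ x ∈ W', √(ρ x) ≠ 0 := fun x hx => (Real.sqrt_pos.2 (hρpos x hx)).ne'
  let p : Fin 4 → Derivation ℝ (smoothAlgebra W') (smoothAlgebra W') :=
    fun i => smoothAlgebra.partialDeriv hW' (v i)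
  have hp : ∀ i j g, p i (p j g) = p j (p i g) := fun i j g =>
    smoothAlgebra.partialDeriv_comm hW' _ _ g
  let Ur : Fin 4 → smoothAlgebra W' := fun j => smoothAlgebra.restrict (U j) ((hU j).mono hsub)
  let q : smoothAlgebra W' := smoothAlgebra.restrict (fun x => √(ρ x)) hq
  let r : smoothAlgebra W' := smoothAlgebra.restrict (fun x => (√(ρ x))⁻¹) (hq.inv hq0)
  let wr : Fin 4 → smoothAlgebra W' := fun j => smoothAlgebra.restrict (fun x => w x (v j))
    ((hw.mono hsub).clm_apply contDiffOn_const)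
  -- No smoothness of `φ` is assumed; the `(0, 0)` component of `hK` expresses it through smooth
  -- functions.
  let φr : smoothAlgebra W' := smoothAlgebra.restrict
    (fun x => fderiv ℝ (U 0) x (v 0) + w x (v 0) * U 0 x)
    (((hUd' 0 0).mono hsub).add
      (((hw.mono hsub).clm_apply contDiffOn_const).mul ((hU 0).mono hsub)))
  have hqr : q * r = 1 := smoothAlgebra.eval_ext fun x => mul_inv_cancel₀ (hq0 x x.2)
  have hUU : ∑ j, Ur j * Ur j = q * q := smoothAlgebra.eval_ext fun x => by
    simp only [map_sum, map_mul]
    exact (Real.mul_self_sqrt (hρpos x x.2).le).symm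
  have hpU : ∀ i j x, smoothAlgebra.eval x (p i (Ur j)) = fderiv ℝ (U j) x (v i) := fun i j x =>
    smoothAlgebra.eval_partialDeriv hW' (v i) (Ur j) (F := U j) (fun _ => rfl) x
  have hKr : ∀ i j, p i (Ur j) + p j (Ur i) + wr i * Ur j + wr j * Ur i =
      if i = j then 2 * φr else 0 := by
    intro i j
    refine smoothAlgebra.eval_ext fun x => ?_
    have hφx : φ x = smoothAlgebra.eval x φr := by
      have h := hK x (hsub x.2) (v 0) (v 0)
      rw [real_inner_comm, ← hUd 0 x (hsub x.2), real_inner_comm, orthonormal_iff_ite.1 hv,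
        if_pos rfl] at h
      change φ x = fderiv ℝ (U 0) x (v 0) + w x (v 0) * inner ℝ (v 0) (u x)
      linarith
    have h := hK x (hsub x.2) (v i) (v j)
    rw [real_inner_comm (v j), real_inner_comm (v i), ← hUd j x (hsub x.2), ← hUd i x (hsub x.2),
      real_inner_comm (v j), real_inner_comm (v i), orthonormal_iff_ite.1 hv, hφx] at h
    simp only [map_add, map_mul, hpU, apply_ite (smoothAlgebra.eval x), map_zero, map_ofNat]
    refine Eq.trans h ?_
    split_ifs <;> simp
  have hpq : ∀ i, p i q = -(q * q * p i r) := by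
    intro i
    have h := congrArg (p i) hqr
    rw [Derivation.leibniz, Derivation.map_one_eq_zero, smul_eq_mul, smul_eq_mul] at h
    linear_combination q * h - p i q * hqr
  -- With `r = 1/√ρ`, the unit field `r U` satisfies the equation for the form `w - d log r`, since
  -- `q * p j r` is the logarithmic derivative of `r`. This correction is closed, so `w` has the
  -- same curl.
  have main := curl_form_eq_zero_of_rotation (p := p) (u := fun j => r * Ur j)
    (w := fun j => wr j - q * p j r) (φ := r * φr) hp
    (by
      simp only [Fin.sum_univ_four] at hUU ⊢
      linear_combination r * r * hUU + (q * r + 1) * hqr)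
    (fun i j => by
      have h := hKr i j
      simp only [Derivation.leibniz, smul_eq_mul]
      have e : (if i = j then 2 * (r * φr) else 0) = r * (if i = j then 2 * φr else 0) := by
        split_ifs <;> ring
      rw [e]
      linear_combination r * h - (p i r * Ur j + p j r * Ur i) * hqr)
    smoothAlgebra.eval (fun g hg => smoothAlgebra.eval_ext fun x => by rw [hg, map_zero])
    (fun s => by
      have hperp : ∀ z, ∑ i, U i s * pr s z i = 0 := fun z => by
        simp only [pr, ρ, Fin.sum_univ_four]; ring
      have hr0 : smoothAlgebra.eval s r ≠ 0 := inv_ne_zero (hq0 s s.2)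
      refine ⟨pr s X', pr s Y', ?_, ?_, ?_⟩
      · have := hperp X'
        simp only [map_mul]
        change ∑ i, _ * U i s * _ = 0
        simp only [mul_assoc, ← Finset.mul_sum]
        rw [this, mul_zero]
      · have := hperp Y'
        simp only [map_mul]
        change ∑ i, _ * U i s * _ = 0
        simp only [mul_assoc, ← Finset.mul_sum]
        rw [this, mul_zero]
      · have hfs : f s ≠ 0 := right_ne_zero_of_mul s.2.2
        have hx := hperp X'
        have hy := hperp Y'
        refine ne_of_eq_of_ne ?_ (mul_ne_zero hr0 hfs)
        have hUe : ∀ j, smoothAlgebra.eval s (Ur j) = U j s := fun j => rfl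
        simp only [Derivation.leibniz, smul_eq_mul, map_add, map_mul, hpU, f, hUe]
        generalize pr s X' = x at hx ⊢
        generalize pr s Y' = y at hy ⊢
        simp only [Fin.sum_univ_four] at hx hy ⊢
        -- Normalisation multiplies the rotation by `r`: the terms with derivatives of `r` contain
        -- the pairing of `U` with `x` or `y`, which is zero.
        linear_combination (x 0 * smoothAlgebra.eval s (p 0 r) + x 1 * smoothAlgebra.eval s (p 1 r)
          + x 2 * smoothAlgebra.eval s (p 2 r) + x 3 * smoothAlgebra.eval s (p 3 r)) * hy
          - (y 0 * smoothAlgebra.eval s (p 0 r) + y 1 * smoothAlgebra.eval s (p 1 r)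
          + y 2 * smoothAlgebra.eval s (p 2 r) + y 3 * smoothAlgebra.eval s (p 3 r)) * hx) i j
  have hwr : p i (wr j) = p j (wr i) := by
    simp only [map_sub, Derivation.leibniz, smul_eq_mul, hpq] at main
    rw [hp i j r] at main
    linear_combination main
  have hpw : ∀ i j, smoothAlgebra.eval ⟨x₀, hx₀'⟩ (p i (wr j)) = fderiv ℝ w x₀ (v i) (v j) := by
    intro i j
    refine (smoothAlgebra.eval_partialDeriv hW' (v i) (wr j) (F := fun x => w x (v j))
      (fun _ => rfl) ⟨x₀, hx₀'⟩).trans ?_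
    rw [fderiv_clm_apply (hwd x₀ hx₀) (differentiableAt_const _)]
    simp
  rw [← hpw, ← hpw, hwr]

end Euclidean

/-! ### Closedness in all directions and integration of the coupling form -/

section FlatKilling

variable {E : Type*} [NormedAddCommGroup E] [InnerProductSpace ℝ E] [FiniteDimensional ℝ E]
  {W : Set E} {u : E → E} {w : E → E →L[ℝ] ℝ} {φ : E → ℝ}

/-- The span of `u x₀, X, Y, b` lies in a four-dimensional space to which the preceding reduction
applies, so `dw` vanishes on `(u, b)` and `(X, b)`. A horizontal `Z` can replace `X` if its rotation
with `Y` is nonzero; otherwise `X + Z` can, and linearity gives `Z`. Vertical and horizontal vectors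
together span. -/
theorem fderiv_symm_of_rotation (hE : 4 ≤ Module.finrank ℝ E) (hW : IsOpen W)
    (hu : ContDiffOn ℝ ∞ u W) (hw : ContDiffOn ℝ ∞ w W)
    (hK : ∀ x ∈ W, ∀ X Y, inner ℝ (fderiv ℝ u x X) Y + inner ℝ (fderiv ℝ u x Y) X
      + w x X * inner ℝ (u x) Y + w x Y * inner ℝ (u x) X = 2 * φ x * inner ℝ X Y)
    {x₀ : E} (hx₀ : x₀ ∈ W) (hne : u x₀ ≠ 0) {X Y : E}
    (huX : inner ℝ (u x₀) X = 0) (huY : inner ℝ (u x₀) Y = 0)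
    (hXY : inner ℝ (fderiv ℝ u x₀ X) Y ≠ inner ℝ (fderiv ℝ u x₀ Y) X) (a b : E) :
    fderiv ℝ w x₀ a b = fderiv ℝ w x₀ b a := by
  have key : ∀ X b, inner ℝ (u x₀) X = 0 →
      inner ℝ (fderiv ℝ u x₀ X) Y ≠ inner ℝ (fderiv ℝ u x₀ Y) X →
      fderiv ℝ w x₀ (u x₀) b = fderiv ℝ w x₀ b (u x₀) ∧
        fderiv ℝ w x₀ X b = fderiv ℝ w x₀ b X := by
    intro X b huX hXY
    obtain ⟨v, hv, hs⟩ := exists_orthonormal_expansion hE ![u x₀, X, Y, b]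
    have h0 := hs 0
    have h1 := hs 1
    have h2 := hs 2
    have h3 := hs 3
    simp only [Matrix.cons_val] at h0 h1 h2 h3
    have h := fderiv_symm_on_four hW hu hw hK hv hx₀ hne h0 h1 h2 huX huY hXY
    have e : ∀ c d : E, c = ∑ j, inner ℝ (v j) c • v j → d = ∑ j, inner ℝ (v j) d • v j →
        fderiv ℝ w x₀ c d = fderiv ℝ w x₀ d c := by
      intro c d hc hd
      rw [hc, hd]
      simp only [map_sum, map_smul, sum_apply, smul_apply,
        Finset.smul_sum]
      rw [Finset.sum_comm]
      refine Finset.sum_congr rfl fun i _ => Finset.sum_congr rfl fun j _ => ?_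
      rw [h j i, smul_comm]
    exact ⟨e _ _ h0 h3, e _ _ h1 h3⟩
  have hperp : ∀ Z, inner ℝ (u x₀) Z = 0 → fderiv ℝ w x₀ Z b = fderiv ℝ w x₀ b Z := by
    intro Z hZ
    by_cases hZY : inner ℝ (fderiv ℝ u x₀ Z) Y = inner ℝ (fderiv ℝ u x₀ Y) Z
    · have h1 := (key X b huX hXY).2
      have h2 := (key (X + Z) b (by rw [inner_add_right, huX, hZ, add_zero]) (by
        rw [map_add, inner_add_left, inner_add_right, hZY]
        exact fun h => hXY (add_right_cancel h))).2
      rw [map_add, map_add, add_apply, h1] at h2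
      exact add_left_cancel h2
    · exact (key Z b hZ hZY).2
  obtain ⟨t, ht⟩ : ∃ t : ℝ, t = inner ℝ (u x₀) a / inner ℝ (u x₀) (u x₀) := ⟨_, rfl⟩
  have huu : inner ℝ (u x₀) (u x₀) ≠ 0 := inner_self_ne_zero.2 hne
  have h1 := hperp (a - t • u x₀) (by
    rw [inner_sub_right, real_inner_smul_right, ht, div_mul_cancel₀ _ huu, sub_self])
  have h2 := (key X b huX hXY).1
  simp only [map_sub, map_smul, sub_apply, smul_apply, h2]
    at h1
  exact sub_left_injective h1

/-- Nonzero rotation is an open condition, tested on the projections of the fixed vectors `X` and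
`Y` away from `u`. So `w` is closed on a ball and has a primitive `F` there, and the derivative of
`e^F u` is `e^F (Du + w ⊗ u)`. -/
theorem exists_conformalKilling_scale (hE : 4 ≤ Module.finrank ℝ E) (hW : IsOpen W)
    (hu : ContDiffOn ℝ ∞ u W) (hw : ContDiffOn ℝ ∞ w W)
    (hK : ∀ x ∈ W, ∀ X Y, inner ℝ (fderiv ℝ u x X) Y + inner ℝ (fderiv ℝ u x Y) X
      + w x X * inner ℝ (u x) Y + w x Y * inner ℝ (u x) X = 2 * φ x * inner ℝ X Y)
    {x₀ : E} (hx₀ : x₀ ∈ W) (hne : ∀ x ∈ W, u x ≠ 0) {X Y : E}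
    (huX : inner ℝ (u x₀) X = 0) (huY : inner ℝ (u x₀) Y = 0)
    (hXY : inner ℝ (fderiv ℝ u x₀ X) Y ≠ inner ℝ (fderiv ℝ u x₀ Y) X) :
    ∃ N : Set E, IsOpen N ∧ x₀ ∈ N ∧ N ⊆ W ∧ ∃ F : E → ℝ, ContDiffOn ℝ ∞ F N ∧
      ∀ x ∈ N, ∀ X Y, inner ℝ (fderiv ℝ (fun y => Real.exp (F y) • u y) x X) Y
        + inner ℝ (fderiv ℝ (fun y => Real.exp (F y) • u y) x Y) X
        = 2 * (Real.exp (F x) * φ x) * inner ℝ X Y := by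
  have hud : ∀ x ∈ W, DifferentiableAt ℝ u x := fun x hx =>
    ((hu.differentiableOn (by simp)) x hx).differentiableAt (hW.mem_nhds hx)
  let pr : E → E → E := fun Z x => (inner ℝ (u x) (u x) : ℝ) • Z - (inner ℝ (u x) Z : ℝ) • u x
  have hpr : ∀ Z, ContDiffOn ℝ ∞ (pr Z) W := fun Z =>
    ((hu.inner ℝ hu).smul contDiffOn_const).sub ((hu.inner ℝ contDiffOn_const).smul hu)
  have hperp : ∀ Z x, inner ℝ (u x) (pr Z x) = 0 := fun Z x => by
    simp only [pr, inner_sub_right, real_inner_smul_right]; ring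
  have hDu : ContDiffOn ℝ ∞ (fderiv ℝ u) W :=
    ContDiffOn.fderiv_of_isOpen (n := ∞) (m := ∞) hu hW (by simp)
  let f : E → ℝ := fun x => inner ℝ (fderiv ℝ u x (pr X x)) (pr Y x)
    - inner ℝ (fderiv ℝ u x (pr Y x)) (pr X x)
  have hf : ContDiffOn ℝ ∞ f W :=
    ((hDu.clm_apply (hpr X)).inner ℝ (hpr Y)).sub ((hDu.clm_apply (hpr Y)).inner ℝ (hpr X))
  have hopen : IsOpen (W ∩ f ⁻¹' {0}ᶜ) :=
    hf.continuousOn.isOpen_inter_preimage hW isOpen_compl_singleton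
  have hmem : x₀ ∈ W ∩ f ⁻¹' {0}ᶜ := by
    refine ⟨hx₀, ?_⟩
    have huu : (inner ℝ (u x₀) (u x₀) : ℝ) ≠ 0 := inner_self_ne_zero.2 (hne x₀ hx₀)
    have h : f x₀ = inner ℝ (u x₀) (u x₀) * inner ℝ (u x₀) (u x₀) *
        (inner ℝ (fderiv ℝ u x₀ X) Y - inner ℝ (fderiv ℝ u x₀ Y) X) := by
      simp only [f, pr, huX, huY, zero_smul, sub_zero, map_smul, real_inner_smul_left,
        real_inner_smul_right]
      ring
    rw [Set.mem_preimage, Set.mem_compl_singleton_iff, h]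
    exact mul_ne_zero (mul_ne_zero huu huu) (sub_ne_zero.2 hXY)
  obtain ⟨ε, hε, hball⟩ := Metric.isOpen_iff.1 hopen x₀ hmem
  have hsub : Metric.ball x₀ ε ⊆ W := fun x hx => (hball hx).1
  obtain ⟨F, hF⟩ := (convex_ball x₀ ε).exists_forall_hasFDerivAt_of_fderiv_symmetric
    Metric.isOpen_ball ((hw.differentiableOn (by simp)).mono hsub)
    (fun x hx a b => fderiv_symm_of_rotation hE hW hu hw hK (hsub hx) (hne x (hsub hx))
      (hperp X x) (hperp Y x) (sub_ne_zero.1 (hball hx).2) a b)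
  refine ⟨Metric.ball x₀ ε, Metric.isOpen_ball, Metric.mem_ball_self hε, hsub, F, ?_, ?_⟩
  · refine (contDiffOn_infty_iff_fderiv_of_isOpen Metric.isOpen_ball).2
      ⟨fun x hx => (hF x hx).differentiableAt.differentiableWithinAt,
        (hw.mono hsub).congr fun x hx => (hF x hx).fderiv⟩
  · intro x hx X Y
    have h := ((hF x hx).exp.smul (hud x (hsub hx)).hasFDerivAt).fderiv
    rw [show (fun y => Real.exp (F y) • u y) = (fun y => Real.exp (F y)) • u from rfl, h]
    simp only [add_apply, smul_apply,
      ContinuousLinearMap.smulRight_apply, inner_add_left, real_inner_smul_left, smul_eq_mul]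
    linear_combination Real.exp (F x) * hK x (hsub hx) X Y

end FlatKilling

lemma _root_.ContDiffOn.hasFDerivAt_of_isOpen {E F : Type*} [NormedAddCommGroup E]
    [NormedSpace ℝ E] [NormedAddCommGroup F] [NormedSpace ℝ F] {W : Set E} {f : E → F}
    (hf : ContDiffOn ℝ ∞ f W) (hW : IsOpen W) {x : E} (hx : x ∈ W) :
    HasFDerivAt f (fderiv ℝ f x) x :=
  (((hf.differentiableOn (by simp)) x hx).differentiableAt (hW.mem_nhds hx)).hasFDerivAt

/-! ### From conformal submersions to shear-free fields -/

section Submersion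

variable {E : Type*} [NormedAddCommGroup E] [InnerProductSpace ℝ E] [FiniteDimensional ℝ E]
  {F : Type*} [NormedAddCommGroup F] [NormedSpace ℝ F] [FiniteDimensional ℝ F]
  {W : Set E}

/-- With `v` spanning the kernel of `A x₀`, the map `(A x, ⟨v, ·⟩)` is invertible at `x₀`, hence
nearby, and its inverse depends smoothly on `x`. The preimage of `(0, 1)` lies in the kernel of `A
x` and is not zero. -/
lemma exists_kernel_field (hEF : Module.finrank ℝ E = Module.finrank ℝ F + 1) (hW : IsOpen W)
    {A : E → E →L[ℝ] F} (hA : ContDiffOn ℝ ∞ A W) {x₀ : E} (hx₀ : x₀ ∈ W)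
    (hs : Function.Surjective (A x₀)) :
    ∃ N : Set E, IsOpen N ∧ x₀ ∈ N ∧ N ⊆ W ∧ ∃ u : E → E, ContDiffOn ℝ ∞ u N ∧
      ∀ x ∈ N, u x ≠ 0 ∧ A x (u x) = 0 := by
  have hker : Module.finrank ℝ (LinearMap.ker (A x₀).toLinearMap) = 1 := by
    have h1 := LinearMap.finrank_range_add_finrank_ker (A x₀).toLinearMap
    have h2 : LinearMap.range (A x₀).toLinearMap = ⊤ := LinearMap.range_eq_top.2 hs
    rw [h2, finrank_top, hEF] at h1
    omega
  obtain ⟨v, hv, hspan⟩ := finrank_eq_one_iff'.1 hker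
  let T : E → E →L[ℝ] F × ℝ := fun x => (A x).prod (innerSL ℝ (v : E))
  have hT : ContDiffOn ℝ ∞ T W := by
    have : T = fun x => (ContinuousLinearMap.inl ℝ F ℝ).comp (A x)
        + (ContinuousLinearMap.inr ℝ F ℝ).comp (innerSL ℝ (v : E)) := by
      funext x; ext y <;> simp [T]
    rw [this]
    exact (contDiffOn_const.clm_comp hA).add contDiffOn_const
  have hinj : Function.Injective (T x₀).toLinearMap := by
    rw [← LinearMap.ker_eq_bot, LinearMap.ker_eq_bot']
    intro y hy
    have h1 : A x₀ y = 0 := congrArg Prod.fst hy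
    have h2 : inner ℝ (v : E) y = 0 := congrArg Prod.snd hy
    obtain ⟨c, hc⟩ := hspan ⟨y, h1⟩
    have hc' : c • (v : E) = y := congrArg Subtype.val hc
    rw [← hc', real_inner_smul_right] at h2
    rw [← hc', (mul_eq_zero.1 h2).resolve_right (inner_self_ne_zero.2 (by simpa using hv)), zero_smul]
  let e : E ≃L[ℝ] F × ℝ := (LinearEquiv.ofInjectiveOfFinrankEq (T x₀).toLinearMap hinj
    (by simp [hEF])).toContinuousLinearEquiv
  have he : (e : E →L[ℝ] F × ℝ) = T x₀ := by ext y <;> rfl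
  have hopen : IsOpen (W ∩ T ⁻¹' Set.range ((↑) : (E ≃L[ℝ] F × ℝ) → E →L[ℝ] F × ℝ)) :=
    hT.continuousOn.isOpen_inter_preimage hW ContinuousLinearEquiv.isOpen
  refine ⟨_, hopen, ⟨hx₀, e, he⟩, Set.inter_subset_left,
    fun x => ContinuousLinearMap.inverse (T x) (0, 1), ?_, ?_⟩
  · rintro x ⟨hx, e', he'⟩
    have h : ContDiffAt ℝ ∞ ContinuousLinearMap.inverse (T x) := by
      rw [← he']; exact contDiffAt_map_inverse e'
    have h2 : ContDiffAt ℝ ∞ (fun x => ContinuousLinearMap.inverse (T x)) x :=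
      h.comp x (hT.contDiffAt (hW.mem_nhds hx))
    exact (h2.clm_apply contDiffAt_const).contDiffWithinAt
  · rintro x ⟨hx, e', he'⟩
    have h : T x (ContinuousLinearMap.inverse (T x) (0, 1)) = (0, 1) := by
      rw [← he', ContinuousLinearMap.inverse_equiv]
      exact e'.apply_symm_apply _
    refine ⟨fun h0 => ?_, congrArg Prod.fst h⟩
    have h0' : ContinuousLinearMap.inverse (T x) (0, 1) = 0 := h0
    rw [h0', map_zero] at h
    exact zero_ne_one (congrArg Prod.snd h)

/-- A symmetric form that is a multiple of the inner product on the orthogonal complement of `u`. -/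
lemma symm_form_eq {S : E → E → ℝ} (hadd : ∀ x y z, S (x + y) z = S x z + S y z)
    (hsmul : ∀ (c : ℝ) x y, S (c • x) y = c * S x y) (hsymm : ∀ x y, S x y = S y x)
    {u : E} (hu : u ≠ 0) {φ : ℝ}
    (h : ∀ X Y, inner ℝ u X = 0 → inner ℝ u Y = 0 → S X Y = 2 * φ * inner ℝ X Y) (X Y : E) :
    S X Y + (-(inner ℝ u u : ℝ)⁻¹ * S u X + (inner ℝ u u : ℝ)⁻¹ *
        (φ + (2 * inner ℝ u u : ℝ)⁻¹ * S u u) * inner ℝ u X) * inner ℝ u Y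
      + (-(inner ℝ u u : ℝ)⁻¹ * S u Y + (inner ℝ u u : ℝ)⁻¹ *
        (φ + (2 * inner ℝ u u : ℝ)⁻¹ * S u u) * inner ℝ u Y) * inner ℝ u X
      = 2 * φ * inner ℝ X Y := by
  have huu : (inner ℝ u u : ℝ) ≠ 0 := inner_self_ne_zero.2 hu
  have hadd' : ∀ x y z, S x (y + z) = S x y + S x z := fun x y z => by
    rw [hsymm, hadd, hsymm y, hsymm z]
  have hsmul' : ∀ (c : ℝ) x y, S x (c • y) = c * S x y := fun c x y => by
    rw [hsymm, hsmul, hsymm]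
  -- The hypothesis for the projections of `X` and `Y` orthogonal to `u`, scaled by `|u|²`. Expanded
  -- bilinearly, it is the asserted equation.
  have key := h ((inner ℝ u u : ℝ) • X + (-inner ℝ u X : ℝ) • u)
    ((inner ℝ u u : ℝ) • Y + (-inner ℝ u Y : ℝ) • u)
    (by simp only [inner_add_right, real_inner_smul_right]; ring)
    (by simp only [inner_add_right, real_inner_smul_right]; ring)
  simp only [hadd, hadd', hsmul, hsmul', inner_add_left, inner_add_right, real_inner_smul_left,
    real_inner_smul_right] at key
  rw [hsymm X u, real_inner_comm u X] at key
  generalize (inner ℝ u u : ℝ) = n at *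
  refine mul_left_cancel₀ (mul_ne_zero huu huu) ?_
  field_simp
  linear_combination 2 * key

/-- The infinitesimal form of conformality of a submersion transverse to the field `u` in its
kernel. -/
lemma exists_shear_factor (hEF : Module.finrank ℝ E = Module.finrank ℝ F + 1)
    (hF : Module.finrank ℝ F ≠ 0) (hW : IsOpen W)
    {s : E → F} (hs : ContDiffOn ℝ ∞ s W) {H : E → F →L[ℝ] F →L[ℝ] ℝ} (hH : ContDiffOn ℝ ∞ H W)
    (hHv : ∀ x ∈ W, ∀ v, fderiv ℝ s x v = 0 → fderiv ℝ H x v = 0)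
    {u : E → E} (hu : ContDiffOn ℝ ∞ u W) (hu0 : ∀ x ∈ W, u x ≠ 0)
    (hsu : ∀ x ∈ W, fderiv ℝ s x (u x) = 0)
    (hconf : ∀ x ∈ W, ∃ r : ℝ, 0 < r ∧ ∀ X Y, inner ℝ (u x) X = 0 → inner ℝ (u x) Y = 0 →
      H x (fderiv ℝ s x X) (fderiv ℝ s x Y) = r * inner ℝ X Y) :
    ∃ φ : E → ℝ, ContDiffOn ℝ ∞ φ W ∧ ∀ x ∈ W, ∀ X Y, inner ℝ (u x) X = 0 → inner ℝ (u x) Y = 0 →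
      inner ℝ (fderiv ℝ u x X) Y + inner ℝ (fderiv ℝ u x Y) X = 2 * φ x * inner ℝ X Y := by
  have hDs : ContDiffOn ℝ ∞ (fderiv ℝ s) W :=
    ContDiffOn.fderiv_of_isOpen (n := ∞) (m := ∞) hs hW (by simp)
  let G : E → E → E → ℝ := fun X Y x => H x (fderiv ℝ s x X) (fderiv ℝ s x Y)
  have hG : ∀ X Y, ContDiffOn ℝ ∞ (G X Y) W := fun X Y =>
    (hH.clm_apply (hDs.clm_apply contDiffOn_const)).clm_apply (hDs.clm_apply contDiffOn_const)
  let b := stdOrthonormalBasis ℝ E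
  -- The conformal factor as a normalised trace, which makes it smooth: the projection orthogonal to
  -- `u` has trace `dim E - 1 = dim F`.
  let r : E → ℝ := fun x => (Module.finrank ℝ F : ℝ)⁻¹ * ∑ k, G (b k) (b k) x
  have hr : ContDiffOn ℝ ∞ r W :=
    contDiffOn_const.mul (ContDiffOn.sum fun k _ => hG (b k) (b k))
  -- the pulled back form is `r` times the inner product of the projections
  have hGr : ∀ x ∈ W, 0 < r x ∧ ∀ X Y, inner ℝ (u x) (u x) * G X Y x =
      r x * (inner ℝ (u x) (u x) * inner ℝ X Y - inner ℝ (u x) X * inner ℝ (u x) Y) := by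
    intro x hx
    obtain ⟨r', hr', h⟩ := hconf x hx
    have huu : (inner ℝ (u x) (u x) : ℝ) ≠ 0 := inner_self_ne_zero.2 (hu0 x hx)
    have h1 : ∀ X Y, inner ℝ (u x) (u x) * G X Y x =
      r' * (inner ℝ (u x) (u x) * inner ℝ X Y - inner ℝ (u x) X * inner ℝ (u x) Y) := by
      intro X Y
      have key := h ((inner ℝ (u x) (u x) : ℝ) • X + (-inner ℝ (u x) X : ℝ) • u x)
        ((inner ℝ (u x) (u x) : ℝ) • Y + (-inner ℝ (u x) Y : ℝ) • u x)
        (by simp only [inner_add_right, real_inner_smul_right]; ring)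
        (by simp only [inner_add_right, real_inner_smul_right]; ring)
      simp only [map_add, map_smul, hsu x hx, smul_zero, add_zero, smul_apply,
        inner_add_left, inner_add_right, real_inner_smul_left, real_inner_smul_right,
        smul_eq_mul] at key
      rw [real_inner_comm (u x) X] at key
      refine mul_left_cancel₀ huu ?_
      change _ * (_ * H x (fderiv ℝ s x X) (fderiv ℝ s x Y)) = _
      linear_combination key
    have h2 : r x = r' := by
      have h3 : ∑ k, inner ℝ (u x) (u x) * G (b k) (b k) x =
          r' * (inner ℝ (u x) (u x) * Module.finrank ℝ F) := by
        simp only [h1, ← Finset.mul_sum, Finset.sum_sub_distrib]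
        have e1 : ∑ k, inner ℝ (u x) (b k) * inner ℝ (u x) (b k) = (inner ℝ (u x) (u x) : ℝ) := by
          rw [← b.sum_inner_mul_inner (u x) (u x)]
          exact Finset.sum_congr rfl fun k _ => by rw [real_inner_comm (u x) (b k)]
        have e2 : ∑ k, inner ℝ (b k) (b k) = (Module.finrank ℝ F : ℝ) + 1 := by
          simp [hEF]
        rw [e1, e2]; ring
      rw [← Finset.mul_sum] at h3
      have hF' : (Module.finrank ℝ F : ℝ) ≠ 0 := Nat.cast_ne_zero.2 hF
      have h4 : ∑ k, G (b k) (b k) x = r' * Module.finrank ℝ F :=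
        mul_left_cancel₀ huu (by rw [h3]; ring)
      change (Module.finrank ℝ F : ℝ)⁻¹ * ∑ k, G (b k) (b k) x = r'
      rw [h4]; field_simp
    rw [h2]
    exact ⟨hr', h1⟩
  have hDr : ContDiffOn ℝ ∞ (fun x => fderiv ℝ r x (u x)) W :=
    (ContDiffOn.fderiv_of_isOpen (n := ∞) (m := ∞) hr hW (by simp)).clm_apply hu
  -- The pulled back form is `r` times the horizontal metric and is invariant along `u`. Hence `u(r)
  -- ⟨X, Y⟩ + r (ℒ_u g)(X, Y) = 0` for horizontal `X, Y`, which gives `2φ = -u(r)/r`.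
  refine ⟨fun x => -(fderiv ℝ r x (u x)) * (2 * r x)⁻¹, hDr.neg.mul
    ((contDiffOn_const.mul hr).inv fun x hx => mul_ne_zero two_ne_zero (hGr x hx).1.ne'), ?_⟩
  intro x hx X Y hX hY
  have huu : (inner ℝ (u x) (u x) : ℝ) ≠ 0 := inner_self_ne_zero.2 (hu0 x hx)
  have hrx := (hGr x hx).1
  -- differentiation of the defining property of `u`
  have hDsu : ∀ Z, fderiv ℝ (fderiv ℝ s) x (u x) Z = -fderiv ℝ s x (fderiv ℝ u x Z) := by
    intro Z
    have h1 : HasFDerivAt (fun y => fderiv ℝ s y (u y)) _ x := (hDs.hasFDerivAt_of_isOpen hW hx).clm_apply (hu.hasFDerivAt_of_isOpen hW hx)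
    have h2 : HasFDerivAt (fun y => fderiv ℝ s y (u y)) (0 : E →L[ℝ] F) x :=
      (hasFDerivAt_const (0 : F) x).congr_of_eventuallyEq
        (Filter.eventuallyEq_of_mem (hW.mem_nhds hx) hsu)
    have h3 := congrArg (fun L => L Z) (h1.unique h2)
    have hsym : fderiv ℝ (fderiv ℝ s) x (u x) Z = fderiv ℝ (fderiv ℝ s) x Z (u x) :=
      ContDiffAt.isSymmSndFDerivAt (n := ∞) (hs.contDiffAt (hW.mem_nhds hx))
        (by simp; exact WithTop.coe_le_coe.2 le_top) _ _
    rw [hsym]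
    simp at h3
    exact eq_neg_of_add_eq_zero_right h3
  -- Invariance along `u`, for constant `X, Y`: `H` is constant in vertical directions, and
  -- differentiating `ds(u) = 0` expresses the second derivative of `s` by `Du`.
  have hDG : fderiv ℝ (G X Y) x (u x) = -G (fderiv ℝ u x X) Y x - G X (fderiv ℝ u x Y) x := by
    have h1 : HasFDerivAt (G X Y) _ x :=
      ((hH.hasFDerivAt_of_isOpen hW hx).clm_apply ((hDs.hasFDerivAt_of_isOpen hW hx).clm_apply (hasFDerivAt_const X x))).clm_apply
        ((hDs.hasFDerivAt_of_isOpen hW hx).clm_apply (hasFDerivAt_const Y x))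
    rw [h1.fderiv]
    simp [hHv x hx _ (hsu x hx), hDsu, G]
    ring
  have hGX : ∀ Z, inner ℝ (u x) Z = 0 → ∀ T, G T Z x = r x * inner ℝ T Z ∧
      G Z T x = r x * inner ℝ T Z := by
    intro Z hZ T
    constructor <;> refine mul_left_cancel₀ huu ?_
    · rw [(hGr x hx).2, hZ]; ring
    · rw [(hGr x hx).2, hZ, real_inner_comm Z T]; ring
  rw [(hGX Y hY _).1, (hGX X hX _).2] at hDG
  -- differentiation of the formula for the pulled back form
  have h1 : HasFDerivAt (fun y => inner ℝ (u y) (u y) * G X Y y) _ x :=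
    ((hu.hasFDerivAt_of_isOpen hW hx).inner ℝ (hu.hasFDerivAt_of_isOpen hW hx)).fun_mul ((hG X Y).hasFDerivAt_of_isOpen hW hx)
  have h2 : HasFDerivAt (fun y => r y * (inner ℝ (u y) (u y) * inner ℝ X Y
      - inner ℝ (u y) X * inner ℝ (u y) Y)) _ x :=
    (hr.hasFDerivAt_of_isOpen hW hx).fun_mul ((((hu.hasFDerivAt_of_isOpen hW hx).inner ℝ (hu.hasFDerivAt_of_isOpen hW hx)).fun_mul (hasFDerivAt_const (inner ℝ X Y : ℝ) x)).fun_sub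
      (((hu.hasFDerivAt_of_isOpen hW hx).inner ℝ (hasFDerivAt_const X x)).fun_mul ((hu.hasFDerivAt_of_isOpen hW hx).inner ℝ (hasFDerivAt_const Y x))))
  have h3 := h1.unique (h2.congr_of_eventuallyEq
    (Filter.eventuallyEq_of_mem (hW.mem_nhds hx) fun y hy => (hGr y hy).2 X Y))
  have h4 := congrArg (fun L => L (u x)) h3
  simp [hX, hY, (hGX Y hY X).1, hDG, fderivInnerCLM_apply] at h4
  have hn : ‖u x‖ ^ 2 ≠ 0 := pow_ne_zero 2 (norm_ne_zero_iff.2 (hu0 x hx))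
  have h5 : r x * (inner ℝ (fderiv ℝ u x X) Y + inner ℝ (fderiv ℝ u x Y) X) =
      -(inner ℝ X Y * fderiv ℝ r x (u x)) :=
    mul_left_cancel₀ hn (by linear_combination -h4)
  have hr0 : r x ≠ 0 := hrx.ne'
  change _ = 2 * (-(fderiv ℝ r x (u x)) * (2 * r x)⁻¹) * inner ℝ X Y
  field_simp
  linear_combination h5

/-- A conformal submersion from a flat space with one-dimensional fibres, whose horizontal
distribution is not integrable at a point, is near that point the quotient by a conformal Killing
field. -/
theorem exists_conformalKilling_of_conformal_submersion
    (hEF : Module.finrank ℝ E = Module.finrank ℝ F + 1) (hF : 3 ≤ Module.finrank ℝ F)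
    (hW : IsOpen W) {s : E → F} (hs : ContDiffOn ℝ ∞ s W)
    {H : E → F →L[ℝ] F →L[ℝ] ℝ} (hH : ContDiffOn ℝ ∞ H W)
    (hHv : ∀ x ∈ W, ∀ v, fderiv ℝ s x v = 0 → fderiv ℝ H x v = 0)
    (hsurj : ∀ x ∈ W, Function.Surjective (fderiv ℝ s x))
    (hconf : ∀ x ∈ W, ∃ r : ℝ, 0 < r ∧ ∀ X Y,
      (∀ v, fderiv ℝ s x v = 0 → inner ℝ X v = 0) → (∀ v, fderiv ℝ s x v = 0 → inner ℝ Y v = 0) →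
      H x (fderiv ℝ s x X) (fderiv ℝ s x Y) = r * inner ℝ X Y)
    {x₀ : E} (hx₀ : x₀ ∈ W) {X Y : E → E} (hX : DifferentiableAt ℝ X x₀)
    (hY : DifferentiableAt ℝ Y x₀)
    (hXh : ∀ x ∈ W, ∀ v, fderiv ℝ s x v = 0 → inner ℝ (X x) v = 0)
    (hYh : ∀ x ∈ W, ∀ v, fderiv ℝ s x v = 0 → inner ℝ (Y x) v = 0)
    {v₀ : E} (hv₀ : fderiv ℝ s x₀ v₀ = 0)
    (hrot : inner ℝ v₀ (VectorField.lieBracket ℝ X Y x₀) ≠ 0) :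
    ∃ N : Set E, IsOpen N ∧ x₀ ∈ N ∧ N ⊆ W ∧ ∃ V : E → E, ContDiffOn ℝ ∞ V N ∧
      (∀ x ∈ N, V x ≠ 0 ∧ fderiv ℝ s x (V x) = 0) ∧
      ∃ ψ : E → ℝ, ∀ x ∈ N, ∀ X Y, inner ℝ (fderiv ℝ V x X) Y + inner ℝ (fderiv ℝ V x Y) X
        = 2 * ψ x * inner ℝ X Y := by
  obtain ⟨N, hN, hxN, hNW, u, hu, huN⟩ := exists_kernel_field hEF hW
    (ContDiffOn.fderiv_of_isOpen (n := ∞) (m := ∞) hs hW (by simp)) hx₀ (hsurj x₀ hx₀)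
  have hker : ∀ x ∈ N, ∀ v, fderiv ℝ s x v = 0 → ∃ c : ℝ, v = c • u x := by
    intro x hx v hv
    have h1 := LinearMap.finrank_range_add_finrank_ker (fderiv ℝ s x).toLinearMap
    have h2 : LinearMap.range (fderiv ℝ s x).toLinearMap = ⊤ :=
      LinearMap.range_eq_top.2 (hsurj x (hNW hx))
    rw [h2, finrank_top, hEF] at h1
    have hk : Module.finrank ℝ (LinearMap.ker (fderiv ℝ s x).toLinearMap) = 1 := by omega
    obtain ⟨c, hc⟩ := (finrank_eq_one_iff_of_nonzero'
      (⟨u x, (huN x hx).2⟩ : LinearMap.ker (fderiv ℝ s x).toLinearMap)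
      (fun h => (huN x hx).1 (congrArg Subtype.val h))).1 hk ⟨v, hv⟩
    exact ⟨c, (congrArg Subtype.val hc).symm⟩
  have hperp : ∀ x ∈ N, ∀ Z, inner ℝ (u x) Z = 0 → ∀ v, fderiv ℝ s x v = 0 → inner ℝ Z v = 0 := by
    intro x hx Z hZ v hv
    obtain ⟨c, rfl⟩ := hker x hx v hv
    rw [real_inner_smul_right, real_inner_comm, hZ, mul_zero]
  obtain ⟨φ, hφ, hφK⟩ := exists_shear_factor hEF (by omega) hN (hs.mono hNW) (hH.mono hNW)
    (fun x hx => hHv x (hNW hx)) hu (fun x hx => (huN x hx).1) (fun x hx => (huN x hx).2)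
    (fun x hx => by
      obtain ⟨r, hr, h⟩ := hconf x (hNW hx)
      exact ⟨r, hr, fun X Y hX hY => h X Y (hperp x hx X hX) (hperp x hx Y hY)⟩)
  have hDu : ContDiffOn ℝ ∞ (fderiv ℝ u) N :=
    ContDiffOn.fderiv_of_isOpen (n := ∞) (m := ∞) hu hN (by simp)
  have huu : ∀ x ∈ N, (inner ℝ (u x) (u x) : ℝ) ≠ 0 := fun x hx =>
    inner_self_ne_zero.2 (huN x hx).1
  have hcu : ContDiffOn ℝ ∞ (fun x => (inner ℝ (u x) (u x) : ℝ)) N := hu.inner ℝ hu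
  have hin : ∀ {Z : E → E}, ContDiffOn ℝ ∞ Z N → ContDiffOn ℝ ∞ (fun x => innerSL ℝ (Z x)) N :=
    fun hZ => (innerSL ℝ (E := E)).contDiff.comp_contDiffOn hZ
  have hDuu : ContDiffOn ℝ ∞ (fun x => fderiv ℝ u x (u x)) N := hDu.clm_apply hu
  let S : E → E → E → ℝ := fun x X Y => inner ℝ (fderiv ℝ u x X) Y + inner ℝ (fderiv ℝ u x Y) X
  have hS : ContDiffOn ℝ ∞ (fun x => S x (u x) (u x)) N := (hDuu.inner ℝ hu).add (hDuu.inner ℝ hu)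
  -- The coefficient form of `symm_form_eq` for the symmetrised `Du`, as a continuous linear form
  -- depending smoothly on `x`.
  let w : E → E →L[ℝ] ℝ := fun x =>
    (-(inner ℝ (u x) (u x) : ℝ)⁻¹) • (innerSL ℝ (fderiv ℝ u x (u x))
      + (innerSL ℝ (u x)).comp (fderiv ℝ u x))
    + ((inner ℝ (u x) (u x) : ℝ)⁻¹ * (φ x + (2 * inner ℝ (u x) (u x) : ℝ)⁻¹ * S x (u x) (u x))) •
      innerSL ℝ (u x)
  have hw : ContDiffOn ℝ ∞ w N := by
    have hc : ContDiffOn ℝ ∞ (fun x => (inner ℝ (u x) (u x) : ℝ)⁻¹ *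
        (φ x + (2 * inner ℝ (u x) (u x) : ℝ)⁻¹ * S x (u x) (u x))) N :=
      (hcu.inv huu).mul (hφ.add (((contDiffOn_const.mul hcu).inv
        fun x hx => mul_ne_zero two_ne_zero (huu x hx)).mul hS))
    exact ((hcu.inv huu).neg.smul ((hin hDuu).add ((hin hu).clm_comp hDu))).add (hc.smul (hin hu))
  have hK : ∀ x ∈ N, ∀ X Y, inner ℝ (fderiv ℝ u x X) Y + inner ℝ (fderiv ℝ u x Y) X
      + w x X * inner ℝ (u x) Y + w x Y * inner ℝ (u x) X = 2 * φ x * inner ℝ X Y := by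
    intro x hx X Y
    have hw' : ∀ Z, w x Z = -(inner ℝ (u x) (u x) : ℝ)⁻¹ * S x (u x) Z
        + (inner ℝ (u x) (u x) : ℝ)⁻¹ *
        (φ x + (2 * inner ℝ (u x) (u x) : ℝ)⁻¹ * S x (u x) (u x)) * inner ℝ (u x) Z := by
      intro Z
      simp only [w, S, add_apply, smul_apply, smul_eq_mul, innerSL_apply_apply,
        ContinuousLinearMap.comp_apply, real_inner_comm (u x) (fderiv ℝ u x Z)]
    have h := symm_form_eq (S := S x) (fun X Y Z => by
        simp only [S, map_add, inner_add_left, inner_add_right]; ring) (fun c X Y => by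
        simp only [S, map_smul, real_inner_smul_left, real_inner_smul_right]; ring)
      (fun X Y => add_comm _ _) (huN x hx).1 (hφK x hx) X Y
    rw [hw', hw']
    exact h
  have hd := hu.hasFDerivAt_of_isOpen hN hxN
  obtain ⟨c, hc⟩ := hker x₀ hxN v₀ hv₀
  have huX : ∀ x ∈ N, inner ℝ (u x) (X x) = 0 := fun x hx => by
    rw [real_inner_comm]; exact hXh x (hNW hx) _ (huN x hx).2
  have huY : ∀ x ∈ N, inner ℝ (u x) (Y x) = 0 := fun x hx => by
    rw [real_inner_comm]; exact hYh x (hNW hx) _ (huN x hx).2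
  have hdiff : ∀ {Z : E → E}, DifferentiableAt ℝ Z x₀ → (∀ x ∈ N, inner ℝ (u x) (Z x) = 0) → ∀ T,
      inner ℝ (u x₀) (fderiv ℝ Z x₀ T) + inner ℝ (fderiv ℝ u x₀ T) (Z x₀) = 0 := by
    intro Z hZ huZ T
    have h1 := hd.inner ℝ hZ.hasFDerivAt
    have h2 : HasFDerivAt (fun x => (inner ℝ (u x) (Z x) : ℝ)) (0 : E →L[ℝ] ℝ) x₀ :=
      (hasFDerivAt_const (0 : ℝ) x₀).congr_of_eventuallyEq
        (Filter.eventuallyEq_of_mem (hN.mem_nhds hxN) huZ)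
    have h3 := congrArg (fun L => L T) (h1.unique h2)
    simpa [fderivInnerCLM_apply] using h3
  -- Differentiating `⟨u, X⟩ = ⟨u, Y⟩ = 0` gives `⟨u, [X, Y]⟩ = ⟨Du Y, X⟩ - ⟨Du X, Y⟩`, so symmetry
  -- of `Du` on `X, Y` would contradict `hrot`.
  obtain ⟨N', hN', hxN', hNN', f, hf, hfK⟩ := exists_conformalKilling_scale (by omega) hN hu hw hK
    hxN (fun x hx => (huN x hx).1) (huX x₀ hxN) (huY x₀ hxN) (fun heq => hrot (by
      rw [hc, VectorField.lieBracket, real_inner_smul_left, inner_sub_right]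
      have a1 := hdiff hX huX (Y x₀)
      have a2 := hdiff hY huY (X x₀)
      have : inner ℝ (u x₀) (fderiv ℝ Y x₀ (X x₀)) - inner ℝ (u x₀) (fderiv ℝ X x₀ (Y x₀)) = 0 := by
        linear_combination a2 - a1 - heq
      rw [this, mul_zero]))
  refine ⟨N', hN', hxN', hNN'.trans hNW, fun y => Real.exp (f y) • u y,
    hf.exp.smul (hu.mono hNN'), fun x hx => ⟨smul_ne_zero (Real.exp_ne_zero _) (huN x (hNN' hx)).1, ?_⟩,
    fun x => Real.exp (f x) * φ x, hfK⟩
  rw [map_smul, (huN x (hNN' hx)).2, smul_zero]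

end Submersion

/-! ### Vector fields and metrics in a chart -/

section Charts

variable {n : ℕ} {M : Type*} [TopologicalSpace M]
  [ChartedSpace (EuclideanSpace ℝ (Fin n)) M] [IsManifold (𝓡 n) ∞ M]
  {e : OpenPartialHomeomorph M (EuclideanSpace ℝ (Fin n))}

lemma mdifferentiable_of_mem_maximalAtlas (he : e ∈ IsManifold.maximalAtlas (𝓡 n) ∞ M) :
    e.MDifferentiable (𝓡 n) (𝓡 n) :=
  ⟨(contMDiffOn_of_mem_maximalAtlas he).mdifferentiableOn (by simp),
    (contMDiffOn_symm_of_mem_maximalAtlas he).mdifferentiableOn (by simp)⟩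

lemma mfderiv_mfderiv_symm (he : e ∈ IsManifold.maximalAtlas (𝓡 n) ∞ M)
    {y : EuclideanSpace ℝ (Fin n)} (hy : y ∈ e.target) (v : EuclideanSpace ℝ (Fin n)) :
    mfderiv (𝓡 n) (𝓡 n) e (e.symm y) (mfderiv (𝓡 n) (𝓡 n) e.symm y v) = v :=
  congrArg (fun L => L v) ((mdifferentiable_of_mem_maximalAtlas he).comp_symm_deriv hy)

lemma mfderiv_symm_mfderiv (he : e ∈ IsManifold.maximalAtlas (𝓡 n) ∞ M)
    {q : M} (hq : q ∈ e.source) (v : TangentSpace (𝓡 n) q) :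
    mfderiv (𝓡 n) (𝓡 n) e.symm (e q) (mfderiv (𝓡 n) (𝓡 n) e q v) = v :=
  congrArg (fun L => L v) ((mdifferentiable_of_mem_maximalAtlas he).symm_comp_deriv hq)

lemma mfderiv_symm_mfderiv' (he : e ∈ IsManifold.maximalAtlas (𝓡 n) ∞ M)
    {y : EuclideanSpace ℝ (Fin n)} (hy : y ∈ e.target) (v : TangentSpace (𝓡 n) (e.symm y)) :
    mfderiv (𝓡 n) (𝓡 n) e.symm y (mfderiv (𝓡 n) (𝓡 n) e (e.symm y) v) = v := by
  have := mfderiv_symm_mfderiv he (e.map_target hy) v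
  rwa [e.right_inv hy] at this

lemma isInvertible_mfderiv (he : e ∈ IsManifold.maximalAtlas (𝓡 n) ∞ M) {q : M}
    (hq : q ∈ e.source) : (mfderiv (𝓡 n) (𝓡 n) e q).IsInvertible :=
  ⟨(mdifferentiable_of_mem_maximalAtlas he).mfderiv hq, rfl⟩

lemma isInvertible_mfderiv_symm (he : e ∈ IsManifold.maximalAtlas (𝓡 n) ∞ M)
    {y : EuclideanSpace ℝ (Fin n)} (hy : y ∈ e.target) :
    (mfderiv (𝓡 n) (𝓡 n) e.symm y).IsInvertible :=
  ⟨(mdifferentiable_of_mem_maximalAtlas he).symm.mfderiv hy, rfl⟩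

lemma mpullback_eq (he : e ∈ IsManifold.maximalAtlas (𝓡 n) ∞ M) {q : M} (hq : q ∈ e.source)
    (V : EuclideanSpace ℝ (Fin n) → EuclideanSpace ℝ (Fin n)) :
    VectorField.mpullback (𝓡 n) (𝓡 n) e V q = mfderiv (𝓡 n) (𝓡 n) e.symm (e q) (V (e q)) := by
  obtain ⟨L, hL⟩ := isInvertible_mfderiv he hq
  change (mfderiv (𝓡 n) (𝓡 n) e q).inverse (V (e q)) = _
  rw [← hL, ContinuousLinearMap.inverse_equiv]
  refine (L.symm_apply_eq).2 ?_
  have := mfderiv_mfderiv_symm he (e.map_source hq) (V (e q))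
  rw [e.left_inv hq, ← hL] at this
  exact this.symm

lemma mpullback_eq' (he : e ∈ IsManifold.maximalAtlas (𝓡 n) ∞ M) {y : EuclideanSpace ℝ (Fin n)}
    (hy : y ∈ e.target) (V : EuclideanSpace ℝ (Fin n) → EuclideanSpace ℝ (Fin n)) :
    VectorField.mpullback (𝓡 n) (𝓡 n) e V (e.symm y) = mfderiv (𝓡 n) (𝓡 n) e.symm y (V y) := by
  rw [mpullback_eq he (e.map_target hy), e.right_inv hy]

lemma mpullback_symm_eq (he : e ∈ IsManifold.maximalAtlas (𝓡 n) ∞ M)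
    {y : EuclideanSpace ℝ (Fin n)} (hy : y ∈ e.target) (X : (q : M) → TangentSpace (𝓡 n) q) :
    VectorField.mpullback (𝓡 n) (𝓡 n) e.symm X y
      = mfderiv (𝓡 n) (𝓡 n) e (e.symm y) (X (e.symm y)) := by
  obtain ⟨L, hL⟩ := isInvertible_mfderiv_symm he hy
  rw [VectorField.mpullback_apply, ← hL, ContinuousLinearMap.inverse_equiv]
  refine (L.symm_apply_eq).2 ?_
  have := mfderiv_symm_mfderiv' he hy (X (e.symm y))
  rw [← hL] at this
  exact this.symm

lemma smoothFieldOn_mpullback (he : e ∈ IsManifold.maximalAtlas (𝓡 n) ∞ M)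
    {V : EuclideanSpace ℝ (Fin n) → EuclideanSpace ℝ (Fin n)} {N : Set (EuclideanSpace ℝ (Fin n))}
    (hN : IsOpen N) (hV : ContDiffOn ℝ ∞ V N) :
    SmoothFieldOn (VectorField.mpullback (𝓡 n) (𝓡 n) e V) (e.source ∩ e ⁻¹' N) := by
  have : IsManifold (𝓡 n) 1 M := IsManifold.of_le (n := ∞) (by simp)
  rintro q ⟨hq, hqN⟩
  refine ContMDiffAt.contMDiffWithinAt ?_
  exact ContMDiffAt.mpullback_vectorField_preimage (n := ∞)
    (contMDiffAt_vectorSpace_iff_contDiffAt.2 (hV.contDiffAt (hN.mem_nhds hqN)))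
    (contMDiffAt_of_mem_maximalAtlas he hq) (isInvertible_mfderiv he hq) (by simp)

lemma contDiffOn_mpullback_symm (he : e ∈ IsManifold.maximalAtlas (𝓡 n) ∞ M)
    {X : (q : M) → TangentSpace (𝓡 n) q} {U : Set M} (hU : IsOpen U) (hX : SmoothFieldOn X U) :
    ContDiffOn ℝ ∞ (VectorField.mpullback (𝓡 n) (𝓡 n) e.symm X : EuclideanSpace ℝ (Fin n) →
      EuclideanSpace ℝ (Fin n)) (e.target ∩ e.symm ⁻¹' U) := by
  have : IsManifold (𝓡 n) 1 M := IsManifold.of_le (n := ∞) (by simp)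
  rintro y ⟨hy, hyU⟩
  refine ContDiffAt.contDiffWithinAt (contMDiffAt_vectorSpace_iff_contDiffAt.1 ?_)
  exact ContMDiffAt.mpullback_vectorField_preimage (n := ∞)
    (hX.contMDiffAt (hU.mem_nhds hyU)) (contMDiffAt_symm_of_mem_maximalAtlas he hy)
    (isInvertible_mfderiv_symm he hy) (by simp)

/-- The pullback of a bilinear form under a linear map, with finite-dimensional source. -/
noncomputable def bilinPullback {E V : Type*} [NormedAddCommGroup E] [NormedSpace ℝ E]
    [FiniteDimensional ℝ E] [AddCommGroup V] [Module ℝ V] [TopologicalSpace V]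
    (G : V →L[ℝ] V →L[ℝ] ℝ) (L : E →L[ℝ] V) : E →L[ℝ] E →L[ℝ] ℝ :=
  (LinearMap.mk₂ ℝ (fun a b => G (L a) (L b)) (fun a a' b => by simp) (fun c a b => by simp)
    (fun a b b' => by simp) (fun c a b => by simp)).toContinuousBilinearMap

/-- The expression of a Riemannian metric in a chart. -/
noncomputable def chartMetric (g : Metric n M) (e : OpenPartialHomeomorph M (EuclideanSpace ℝ (Fin n)))
    (y : EuclideanSpace ℝ (Fin n)) :
    EuclideanSpace ℝ (Fin n) →L[ℝ] EuclideanSpace ℝ (Fin n) →L[ℝ] ℝ :=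
  bilinPullback (E := EuclideanSpace ℝ (Fin n)) (V := TangentSpace (𝓡 n) (e.symm y))
    (g.inner (e.symm y)) (mfderiv (𝓡 n) (𝓡 n) e.symm y)

lemma chartMetric_apply (g : Metric n M) (e : OpenPartialHomeomorph M (EuclideanSpace ℝ (Fin n)))
    (y a b : EuclideanSpace ℝ (Fin n)) : chartMetric g e y a b = g.inner (e.symm y)
      (mfderiv (𝓡 n) (𝓡 n) e.symm y a) (mfderiv (𝓡 n) (𝓡 n) e.symm y b) := rfl

lemma contMDiffOn_inner (g : Metric n M) {X Y : (q : M) → TangentSpace (𝓡 n) q} {U : Set M}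
    (hX : SmoothFieldOn X U) (hY : SmoothFieldOn Y U) :
    ContMDiffOn (𝓡 n) 𝓘(ℝ, ℝ) ∞ (fun q => g.inner q (X q) (Y q)) U := by
  intro q hq
  have : ContMDiffWithinAt (𝓡 n) ((𝓡 n).prod 𝓘(ℝ)) ∞
      (fun m ↦ Bundle.TotalSpace.mk' ℝ (E := Bundle.Trivial M ℝ) m (g.inner m (X m) (Y m))) U q :=
    ContMDiffWithinAt.clm_bundle_apply₂ (F₁ := EuclideanSpace ℝ (Fin n))
      (F₂ := EuclideanSpace ℝ (Fin n)) (g.contMDiff.contMDiffAt.contMDiffWithinAt) (hX q hq) (hY q hq)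
  simp only [Bundle.contMDiffWithinAt_totalSpace] at this
  exact this.2

/-- Smoothness is tested on pairs of constant vectors, whose pullbacks are smooth fields on the
manifold. -/
lemma contDiffOn_chartMetric (g : Metric n M) (he : e ∈ IsManifold.maximalAtlas (𝓡 n) ∞ M) :
    ContDiffOn ℝ ∞ (chartMetric g e) e.target := by
  refine contDiffOn_clm_apply.2 fun a => contDiffOn_clm_apply.2 fun b => ?_
  have hs : ∀ a : EuclideanSpace ℝ (Fin n),
      SmoothFieldOn (VectorField.mpullback (𝓡 n) (𝓡 n) e fun _ => a) e.source := fun a => by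
    simpa using smoothFieldOn_mpullback he isOpen_univ (V := fun _ => a) contDiffOn_const
  have h := (contMDiffOn_inner g (hs a) (hs b)).comp (contMDiffOn_symm_of_mem_maximalAtlas he)
    (fun y hy => e.map_target hy)
  refine (contMDiffOn_iff_contDiffOn.1 h).congr fun y hy => ?_
  simp only [Function.comp_apply]
  rw [mpullback_eq he (e.map_target hy), mpullback_eq he (e.map_target hy), e.right_inv hy]
  rfl

end Charts

/-! ### Transfer of conformal Killing fields from the chart to the manifold -/

section ChartFields

variable {n : ℕ} {M : Type*} [TopologicalSpace M]
  [ChartedSpace (EuclideanSpace ℝ (Fin n)) M] [IsManifold (𝓡 n) ∞ M]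
  {e : OpenPartialHomeomorph M (EuclideanSpace ℝ (Fin n))}

/-- The expression of a vector field in a chart. -/
noncomputable def chartField (e : OpenPartialHomeomorph M (EuclideanSpace ℝ (Fin n)))
    (X : (q : M) → TangentSpace (𝓡 n) q) : EuclideanSpace ℝ (Fin n) → EuclideanSpace ℝ (Fin n) :=
  VectorField.mpullback (𝓡 n) (𝓡 n) e.symm X

lemma chartField_eq (he : e ∈ IsManifold.maximalAtlas (𝓡 n) ∞ M)
    {y : EuclideanSpace ℝ (Fin n)} (hy : y ∈ e.target) (X : (q : M) → TangentSpace (𝓡 n) q) :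
    chartField e X y = mfderiv (𝓡 n) (𝓡 n) e (e.symm y) (X (e.symm y)) :=
  mpullback_symm_eq he hy X

lemma SmoothFieldOn.mdifferentiableAt {X : (q : M) → TangentSpace (𝓡 n) q} {U : Set M}
    (hX : SmoothFieldOn X U) (hU : IsOpen U) {q : M} (hq : q ∈ U) :
    MDifferentiableAt (𝓡 n) (𝓡 n).tangent (fun p => (⟨p, X p⟩ : TangentBundle (𝓡 n) M)) q :=
  (hX.contMDiffAt (hU.mem_nhds hq)).mdifferentiableAt (by simp)

lemma mfderiv_mlieBracket (he : e ∈ IsManifold.maximalAtlas (𝓡 n) ∞ M)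
    {y : EuclideanSpace ℝ (Fin n)} (hy : y ∈ e.target) {X Y : (q : M) → TangentSpace (𝓡 n) q}
    (hX : MDifferentiableAt (𝓡 n) (𝓡 n).tangent
      (fun p => (⟨p, X p⟩ : TangentBundle (𝓡 n) M)) (e.symm y))
    (hY : MDifferentiableAt (𝓡 n) (𝓡 n).tangent
      (fun p => (⟨p, Y p⟩ : TangentBundle (𝓡 n) M)) (e.symm y)) :
    mfderiv (𝓡 n) (𝓡 n) e (e.symm y) (VectorField.mlieBracket (𝓡 n) X Y (e.symm y)) =
      VectorField.lieBracket ℝ (chartField e X) (chartField e Y) y := by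
  have : IsManifold (𝓡 n) (minSmoothness ℝ 2) M :=
    IsManifold.of_le (n := ∞) (by simp; exact WithTop.coe_le_coe.2 le_top)
  rw [← mpullback_symm_eq he hy, VectorField.mpullback_mlieBracket (n := ∞) hX hY
    (contMDiffAt_symm_of_mem_maximalAtlas he hy) (by simp; exact WithTop.coe_le_coe.2 le_top)]
  rw [← VectorField.mlieBracketWithin_univ, VectorField.mlieBracketWithin_eq_lieBracketWithin]
  exact congrFun (VectorField.lieBracketWithin_univ (𝕜 := ℝ) (V := chartField e X)
    (W := chartField e Y)) y

lemma chartField_mpullback (he : e ∈ IsManifold.maximalAtlas (𝓡 n) ∞ M)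
    (V : EuclideanSpace ℝ (Fin n) → EuclideanSpace ℝ (Fin n)) {y : EuclideanSpace ℝ (Fin n)}
    (hy : y ∈ e.target) :
    chartField e (VectorField.mpullback (𝓡 n) (𝓡 n) e V) y = V y := by
  rw [chartField_eq he hy, mpullback_eq' he hy]
  exact mfderiv_mfderiv_symm he hy (V y)

/-- In the chart every representative is `r` times the Euclidean metric, and `ℒ_V (r g₀) = V(r) g₀ +
r ℒ_V g₀`. The conformal factor is thus that of `V` for `g₀` plus `V(r)/(2r)`. -/
theorem isConformalKillingOn_mpullback (hn : n ≠ 0) {c : ConformalStructure n M}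
    (he : e ∈ IsManifold.maximalAtlas (𝓡 n) ∞ M)
    (hflat : ∀ g : Metric n M, Represents g c → ∀ q ∈ e.source, ∃ r : ℝ, 0 < r ∧
      ∀ v w : TangentSpace (𝓡 n) q, g.inner q v w = r * inner (E := EuclideanSpace ℝ (Fin n)) ℝ
          (mfderiv (𝓡 n) (𝓡 n) e q v) (mfderiv (𝓡 n) (𝓡 n) e q w))
    {N : Set (EuclideanSpace ℝ (Fin n))} (hN : IsOpen N)
    {V : EuclideanSpace ℝ (Fin n) → EuclideanSpace ℝ (Fin n)} (hV : ContDiffOn ℝ ∞ V N)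
    {ψ : EuclideanSpace ℝ (Fin n) → ℝ}
    (hK : ∀ x ∈ N, ∀ X Y, inner ℝ (fderiv ℝ V x X) Y + inner ℝ (fderiv ℝ V x Y) X
        = 2 * ψ x * inner ℝ X Y) :
    IsConformalKillingOn c (VectorField.mpullback (𝓡 n) (𝓡 n) e V) (e.source ∩ e ⁻¹' N) := by
  refine ⟨smoothFieldOn_mpullback he hN hV, fun g hg => ?_⟩
  obtain ⟨a, ha⟩ : ∃ a : EuclideanSpace ℝ (Fin n), inner ℝ a a = (1 : ℝ) :=
    ⟨EuclideanSpace.single ⟨0, Nat.pos_of_ne_zero hn⟩ 1, by simp⟩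
  -- The factors given by flatness are chosen pointwise; evaluating the metric on a fixed unit
  -- vector shows that they form a smooth function.
  let r : EuclideanSpace ℝ (Fin n) → ℝ := fun y => chartMetric g e y a a
  have hr : ContDiffOn ℝ ∞ r e.target :=
    ((contDiffOn_chartMetric g he).clm_apply contDiffOn_const).clm_apply contDiffOn_const
  have hgr : ∀ y ∈ e.target, 0 < r y ∧ ∀ v w : TangentSpace (𝓡 n) (e.symm y),
      g.inner (e.symm y) v w = r y * inner (E := EuclideanSpace ℝ (Fin n)) ℝ
        (mfderiv (𝓡 n) (𝓡 n) e (e.symm y) v) (mfderiv (𝓡 n) (𝓡 n) e (e.symm y) w) := by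
    intro y hy
    obtain ⟨r', hr', h⟩ := hflat g hg _ (e.map_target hy)
    have : r y = r' := by
      have h1 : ∀ z : EuclideanSpace ℝ (Fin n), z = a → r' * inner ℝ z z = r' := by
        rintro _ rfl
        rw [ha, mul_one]
      exact (h _ _).trans (h1 _ (mfderiv_mfderiv_symm he hy a))
    rw [this]
    exact ⟨hr', h⟩
  have hopen : IsOpen (e.source ∩ e ⁻¹' N) := e.isOpen_inter_preimage hN
  refine ⟨fun q => fderiv ℝ r (e q) (V (e q)) * (2 * r (e q))⁻¹ + ψ (e q), ?_⟩
  intro X Y hX hY q hq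
  obtain ⟨y, hy, rfl⟩ : ∃ y ∈ e.target, e.symm y = q :=
    ⟨e q, e.map_source hq.1, e.left_inv hq.1⟩
  have hyN : y ∈ N := by have := hq.2; rwa [Set.mem_preimage, e.right_inv hy] at this
  have hnhds : e.target ∩ e.symm ⁻¹' (e.source ∩ e ⁻¹' N) ∈ nhds y :=
    (e.symm.isOpen_inter_preimage hopen).mem_nhds ⟨hy, hq⟩
  have hdX : HasFDerivAt (chartField e X) (fderiv ℝ (chartField e X) y) y :=
    (((contDiffOn_mpullback_symm he hopen hX).contDiffAt hnhds).differentiableAt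
      (by simp)).hasFDerivAt
  have hdY : HasFDerivAt (chartField e Y) (fderiv ℝ (chartField e Y) y) y :=
    (((contDiffOn_mpullback_symm he hopen hY).contDiffAt hnhds).differentiableAt
      (by simp)).hasFDerivAt
  have hdr : HasFDerivAt r (fderiv ℝ r y) y := hr.hasFDerivAt_of_isOpen e.open_target hy
  have hF := hdr.fun_mul (hdX.inner ℝ hdY)
  have hdir : dirDeriv (fun q => g.inner q (X q) (Y q)) (e.symm y)
      (VectorField.mpullback (𝓡 n) (𝓡 n) e V (e.symm y)) =
      fderiv ℝ r y (V y) * inner ℝ (chartField e X y) (chartField e Y y) +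
      r y * (inner ℝ (fderiv ℝ (chartField e X) y (V y)) (chartField e Y y) +
        inner ℝ (chartField e X y) (fderiv ℝ (chartField e Y) y (V y))) := by
    obtain ⟨L, hL⟩ : ∃ L, L = fderiv ℝ
      (fun z => r z * inner ℝ (chartField e X z) (chartField e Y z)) y := ⟨_, rfl⟩
    have hLv : L (V y) = fderiv ℝ r y (V y) * inner ℝ (chartField e X y) (chartField e Y y) +
        r y * (inner ℝ (fderiv ℝ (chartField e X) y (V y)) (chartField e Y y) +
        inner ℝ (chartField e X y) (fderiv ℝ (chartField e Y) y (V y))) := by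
      rw [hL, hF.fderiv]
      simp [fderivInnerCLM_apply]
      ring
    have hF' : HasFDerivAt (fun z => r z * inner ℝ (chartField e X z) (chartField e Y z)) L
        (e (e.symm y)) := by
      rw [e.right_inv hy, hL, hF.fderiv]
      exact hF
    have h1 := hF'.hasMFDerivAt.comp (e.symm y)
      ((mdifferentiable_of_mem_maximalAtlas he).mdifferentiableAt (e.map_target hy)).hasMFDerivAt
    have heq : (fun q => g.inner q (X q) (Y q)) =ᶠ[nhds (e.symm y)]
        (fun z => r z * inner ℝ (chartField e X z) (chartField e Y z)) ∘ e := by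
      filter_upwards [e.open_source.mem_nhds (e.map_target hy)] with q hq
      obtain ⟨z, hz, rfl⟩ : ∃ z ∈ e.target, e.symm z = q := ⟨e q, e.map_source hq, e.left_inv hq⟩
      rw [(hgr z hz).2, Function.comp_apply, e.right_inv hz, chartField_eq he hz,
        chartField_eq he hz]
      rfl
    have h2 := (h1.congr_of_eventuallyEq heq).mfderiv
    have hv : mfderiv (𝓡 n) (𝓡 n) e (e.symm y) (VectorField.mpullback (𝓡 n) (𝓡 n) e V (e.symm y))
        = V y := (chartField_eq he hy _).symm.trans (chartField_mpullback he V hy)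
    have h3 := congrArg
      (fun L => L (VectorField.mpullback (𝓡 n) (𝓡 n) e V (e.symm y))) h2
    exact h3.trans ((congrArg L hv).trans hLv)
  have hbr : ∀ Z : (q : M) → TangentSpace (𝓡 n) q, SmoothFieldOn Z (e.source ∩ e ⁻¹' N) →
      mfderiv (𝓡 n) (𝓡 n) e (e.symm y) (VectorField.mlieBracket (𝓡 n)
        (VectorField.mpullback (𝓡 n) (𝓡 n) e V) Z (e.symm y)) =
      fderiv ℝ (chartField e Z) y (V y) - fderiv ℝ V y (chartField e Z y) := by
    intro Z hZ
    rw [mfderiv_mlieBracket he hy ((smoothFieldOn_mpullback he hN hV).mdifferentiableAt hopen hq)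
      (hZ.mdifferentiableAt hopen hq)]
    have h : chartField e (VectorField.mpullback (𝓡 n) (𝓡 n) e V) =ᶠ[nhds y] V :=
      Filter.eventuallyEq_of_mem (e.open_target.mem_nhds hy)
        fun z hz => chartField_mpullback he V hz
    rw [VectorField.lieBracket, h.fderiv_eq, h.eq_of_nhds]
  rw [lieDerivMetric, hdir, (hgr y hy).2, (hgr y hy).2, (hgr y hy).2, hbr X hX, hbr Y hY,
    ← chartField_eq he hy, ← chartField_eq he hy, inner_sub_left, inner_sub_right]
  simp only [e.right_inv hy]
  have hk := hK y hyN (chartField e X y) (chartField e Y y)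
  rw [real_inner_comm (chartField e X y) (fderiv ℝ V y (chartField e Y y))] at hk
  have hr0 := (hgr y hy).1.ne'
  field_simp
  linear_combination r y * hk

end ChartFields

/-! ### Metrics under charts and conformal change -/

section ChartMetric

variable {n : ℕ} {M : Type*} [TopologicalSpace M]
  [ChartedSpace (EuclideanSpace ℝ (Fin n)) M] [IsManifold (𝓡 n) ∞ M]
  {e : OpenPartialHomeomorph M (EuclideanSpace ℝ (Fin n))}

/-- The base point `b` is only propositionally equal to `e.symm y`, so that the lemma applies to `σ
(e.symm x)` and its image in a chart of `B` without transport of tangent spaces. -/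
lemma chartMetric_mfderiv (g : Metric n M) (he : e ∈ IsManifold.maximalAtlas (𝓡 n) ∞ M)
    {b : M} {y : EuclideanSpace ℝ (Fin n)} (hy : y ∈ e.target) (hb : b = e.symm y)
    (v w : TangentSpace (𝓡 n) b) :
    chartMetric g e y (mfderiv (𝓡 n) (𝓡 n) e b v) (mfderiv (𝓡 n) (𝓡 n) e b w) = g.inner b v w := by
  subst hb
  refine (chartMetric_apply g e _ _ _).trans ?_
  have hv := mfderiv_symm_mfderiv' he hy v
  have hw := mfderiv_symm_mfderiv' he hy w
  exact congrArg₂ (fun a b => g.inner (e.symm y) a b) hv hw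

/-- Flatness provides a chart for one representative at a time; the same chart serves for the whole
class. -/
lemma flat_of_represents {c : ConformalStructure n M} {g g' : Metric n M} (hg : Represents g c)
    (hg' : Represents g' c) {q : M}
    (h : ∃ r : ℝ, 0 < r ∧ ∀ v w : TangentSpace (𝓡 n) q,
      g.inner q v w = r * inner (E := EuclideanSpace ℝ (Fin n)) ℝ
        (mfderiv (𝓡 n) (𝓡 n) e q v) (mfderiv (𝓡 n) (𝓡 n) e q w)) :
    ∃ r : ℝ, 0 < r ∧ ∀ v w : TangentSpace (𝓡 n) q,
      g'.inner q v w = r * inner (E := EuclideanSpace ℝ (Fin n)) ℝ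
        (mfderiv (𝓡 n) (𝓡 n) e q v) (mfderiv (𝓡 n) (𝓡 n) e q w) := by
  obtain ⟨Λ, -, hpos, hΛ⟩ : conformalSetoid n M g g' := Quotient.exact (hg.trans hg'.symm)
  obtain ⟨r, hr, h⟩ := h
  exact ⟨Λ q * r, mul_pos (hpos q) hr, fun v w => by rw [hΛ, h, mul_assoc]⟩

end ChartMetric

/-! ### The submersion in charts -/

section ChartMap

variable {m n : ℕ} {M : Type*} [TopologicalSpace M]
  [ChartedSpace (EuclideanSpace ℝ (Fin n)) M] [IsManifold (𝓡 n) ∞ M]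
  {B : Type*} [TopologicalSpace B]
  [ChartedSpace (EuclideanSpace ℝ (Fin m)) B] [IsManifold (𝓡 m) ∞ B]
  {e : OpenPartialHomeomorph M (EuclideanSpace ℝ (Fin n))}
  {κ : OpenPartialHomeomorph B (EuclideanSpace ℝ (Fin m))} {σ : M → B}

lemma contDiffOn_chartMap (he : e ∈ IsManifold.maximalAtlas (𝓡 n) ∞ M)
    (hκ : κ ∈ IsManifold.maximalAtlas (𝓡 m) ∞ B) (hσ : ContMDiff (𝓡 n) (𝓡 m) ∞ σ) :
    ContDiffOn ℝ ∞ (κ ∘ σ ∘ e.symm) (e.target ∩ e.symm ⁻¹' (σ ⁻¹' κ.source)) := by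
  refine contMDiffOn_iff_contDiffOn.1 ?_
  exact (contMDiffOn_of_mem_maximalAtlas hκ).comp
    (hσ.comp_contMDiffOn ((contMDiffOn_symm_of_mem_maximalAtlas he).mono Set.inter_subset_left))
    (fun x hx => hx.2)

lemma fderiv_chartMap (he : e ∈ IsManifold.maximalAtlas (𝓡 n) ∞ M)
    (hκ : κ ∈ IsManifold.maximalAtlas (𝓡 m) ∞ B) (hσ : ContMDiff (𝓡 n) (𝓡 m) ∞ σ)
    {x : EuclideanSpace ℝ (Fin n)} (hx : x ∈ e.target) (hx' : σ (e.symm x) ∈ κ.source)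
    (v : EuclideanSpace ℝ (Fin n)) :
    fderiv ℝ (κ ∘ σ ∘ e.symm) x v = mfderiv (𝓡 m) (𝓡 m) κ (σ (e.symm x))
      (mfderiv (𝓡 n) (𝓡 m) σ (e.symm x) (mfderiv (𝓡 n) (𝓡 n) e.symm x v)) := by
  have h1 := ((mdifferentiable_of_mem_maximalAtlas he).mdifferentiableAt_symm hx).hasMFDerivAt
  have h2 := (hσ.mdifferentiableAt (by simp) (x := e.symm x)).hasMFDerivAt
  have h3 := ((mdifferentiable_of_mem_maximalAtlas hκ).mdifferentiableAt hx').hasMFDerivAt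
  have h := h3.comp x (h2.comp x h1)
  exact congrArg (fun L => L v) (mfderiv_eq_fderiv.symm.trans h.mfderiv)

lemma fderiv_chartMap_mfderiv (he : e ∈ IsManifold.maximalAtlas (𝓡 n) ∞ M)
    (hκ : κ ∈ IsManifold.maximalAtlas (𝓡 m) ∞ B) (hσ : ContMDiff (𝓡 n) (𝓡 m) ∞ σ)
    {x : EuclideanSpace ℝ (Fin n)} (hx : x ∈ e.target) (hx' : σ (e.symm x) ∈ κ.source)
    (v : TangentSpace (𝓡 n) (e.symm x)) :
    fderiv ℝ (κ ∘ σ ∘ e.symm) x (mfderiv (𝓡 n) (𝓡 n) e (e.symm x) v) =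
      mfderiv (𝓡 m) (𝓡 m) κ (σ (e.symm x)) (mfderiv (𝓡 n) (𝓡 m) σ (e.symm x) v) := by
  refine (fderiv_chartMap he hκ hσ hx hx' _).trans ?_
  exact congrArg (fun z => mfderiv (𝓡 m) (𝓡 m) κ (σ (e.symm x)) (mfderiv (𝓡 n) (𝓡 m) σ (e.symm x) z))
    (mfderiv_symm_mfderiv' he hx v)

lemma fderiv_chartMap_eq_zero_iff (he : e ∈ IsManifold.maximalAtlas (𝓡 n) ∞ M)
    (hκ : κ ∈ IsManifold.maximalAtlas (𝓡 m) ∞ B) (hσ : ContMDiff (𝓡 n) (𝓡 m) ∞ σ)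
    {x : EuclideanSpace ℝ (Fin n)} (hx : x ∈ e.target) (hx' : σ (e.symm x) ∈ κ.source)
    (v : EuclideanSpace ℝ (Fin n)) :
    fderiv ℝ (κ ∘ σ ∘ e.symm) x v = 0 ↔
      mfderiv (𝓡 n) (𝓡 m) σ (e.symm x) (mfderiv (𝓡 n) (𝓡 n) e.symm x v) = 0 := by
  rw [fderiv_chartMap he hκ hσ hx hx']
  exact map_eq_zero_iff (mfderiv (𝓡 m) (𝓡 m) κ (σ (e.symm x)))
    ((mdifferentiable_of_mem_maximalAtlas hκ).mfderiv_injective hx')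

lemma surjective_fderiv_chartMap (he : e ∈ IsManifold.maximalAtlas (𝓡 n) ∞ M)
    (hκ : κ ∈ IsManifold.maximalAtlas (𝓡 m) ∞ B) (hσ : ContMDiff (𝓡 n) (𝓡 m) ∞ σ)
    {x : EuclideanSpace ℝ (Fin n)} (hx : x ∈ e.target) (hx' : σ (e.symm x) ∈ κ.source)
    (hs : Function.Surjective (mfderiv (𝓡 n) (𝓡 m) σ (e.symm x))) :
    Function.Surjective (fderiv ℝ (κ ∘ σ ∘ e.symm) x) := by
  intro z
  obtain ⟨z', hz'⟩ := (mdifferentiable_of_mem_maximalAtlas hκ).mfderiv_surjective hx' z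
  obtain ⟨v, rfl⟩ := hs z'
  exact ⟨mfderiv (𝓡 n) (𝓡 n) e (e.symm x) v,
    (fderiv_chartMap_mfderiv he hκ hσ hx hx' v).trans hz'⟩

end ChartMap

end FlatConformalFlow

/-! ### The theorem on manifolds -/

theorem mainTheorem3 {m : ℕ} (hm : 3 ≤ m)
    {M : Type*} [TopologicalSpace M] [ChartedSpace (EuclideanSpace ℝ (Fin (m + 1))) M]
    [IsManifold (𝓡 (m + 1)) ∞ M]
    {B : Type*} [TopologicalSpace B] [ChartedSpace (EuclideanSpace ℝ (Fin m)) B]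
    [IsManifold (𝓡 m) ∞ B]
    (c : FlatConformalFlow.ConformalStructure (m + 1) M) (hc : c.IsFlat)
    (c' : FlatConformalFlow.ConformalStructure m B)
    (σ : M → B) (hσ : FlatConformalFlow.IsFlow (m := m) σ)
    (hrigid : FlatConformalFlow.IsConformallyRigid c c' σ)
    (p : M) (hp : ∃ g : FlatConformalFlow.Metric (m + 1) M,
      FlatConformalFlow.Represents g c ∧ FlatConformalFlow.RotationNeZeroAt g σ p) :
    FlatConformalFlow.IsConformallyIsometricAt c σ p := by
  open FlatConformalFlow in
  obtain ⟨g, hg, u, hu, -, U, hU, hpU, X, Y, hX, hY, hhor, hrot⟩ := hp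
  obtain ⟨e, he, hpe, hflat⟩ := hc g hg p
  obtain ⟨h, hh⟩ := Quotient.exists_rep c'
  obtain ⟨hσs, hsurj⟩ := hσ
  obtain ⟨κ, hκ, hpκ⟩ : ∃ κ ∈ IsManifold.maximalAtlas (𝓡 m) ∞ B, σ p ∈ κ.source :=
    ⟨_, IsManifold.chart_mem_maximalAtlas (σ p), mem_chart_source _ (σ p)⟩
  obtain ⟨x₀, hx₀, rfl⟩ : ∃ x ∈ e.target, e.symm x = p := ⟨e p, e.map_source hpe, e.left_inv hpe⟩
  obtain ⟨s, hs⟩ : ∃ s, s = κ ∘ σ ∘ e.symm := ⟨_, rfl⟩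
  obtain ⟨W, hW⟩ : ∃ W, W = e.target ∩ e.symm ⁻¹' (σ ⁻¹' κ.source ∩ U) := ⟨_, rfl⟩
  have hWo : IsOpen W := by
    rw [hW]
    exact e.symm.isOpen_inter_preimage ((κ.open_source.preimage hσs.continuous).inter hU)
  have hWt : ∀ x ∈ W, x ∈ e.target ∧ σ (e.symm x) ∈ κ.source ∧ e.symm x ∈ U := by
    rw [hW]
    exact fun x hx => ⟨hx.1, hx.2.1, hx.2.2⟩
  have hsW : ContDiffOn ℝ ∞ s W := by
    rw [hs]
    exact (contDiffOn_chartMap he hκ hσs).mono fun x hx => ⟨(hWt x hx).1, (hWt x hx).2.1⟩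
  have hsκ : ∀ x ∈ W, s x ∈ κ.target := fun x hx => by
    rw [hs]; exact κ.map_source (hWt x hx).2.1
  have hCM := contDiffOn_chartMetric h hκ
  have hker : ∀ x ∈ W, ∀ v, fderiv ℝ s x v = 0 ↔
      IsVertical σ (e.symm x) (mfderiv (𝓡 (m + 1)) (𝓡 (m + 1)) e.symm x v) := fun x hx v => by
    rw [hs]; exact fderiv_chartMap_eq_zero_iff he hκ hσs (hWt x hx).1 (hWt x hx).2.1 v
  have hker' : ∀ x ∈ W, ∀ v, IsVertical σ (e.symm x) v →
      fderiv ℝ s x (mfderiv (𝓡 (m + 1)) (𝓡 (m + 1)) e (e.symm x) v) = 0 := fun x hx v hv => by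
    refine (hker x hx _).2 ?_
    have := mfderiv_symm_mfderiv' he (hWt x hx).1 v
    exact (congrArg (IsVertical σ (e.symm x)) this).mpr hv
  obtain ⟨N, hN, hxN, hNW, V, hV, hVN, ψ, hK⟩ :=
    exists_conformalKilling_of_conformal_submersion (E := EuclideanSpace ℝ (Fin (m + 1)))
      (F := EuclideanSpace ℝ (Fin m)) (by simp) (by simpa using hm) hWo hsW
      -- The metric of `B` is taken along `s`, so by the chain rule its derivative vanishes on the
      -- kernel of `ds`.
      (H := fun x => chartMetric h κ (s x)) (hCM.comp hsW hsκ)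
      (fun x hx v hv => by
        have h1 := (hCM.hasFDerivAt_of_isOpen κ.open_target (hsκ x hx)).comp x
          (hsW.hasFDerivAt_of_isOpen hWo hx)
        have h2 := congrArg (fun L => L v) h1.fderiv
        refine h2.trans ?_
        rw [ContinuousLinearMap.comp_apply, hv, map_zero])
      (fun x hx => by
        rw [hs]
        exact surjective_fderiv_chartMap he hκ hσs (hWt x hx).1 (hWt x hx).2.1 (hsurj _))
      (fun x hx => by
        obtain ⟨r, hr, hflatx⟩ := hflat _ (e.map_target (hWt x hx).1)
        obtain ⟨r', hr', hrx⟩ := hrigid g h hg hh (e.symm x)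
        have hhorz : ∀ Z, (∀ v, fderiv ℝ s x v = 0 → inner ℝ Z v = 0) →
            IsHorizontal g σ (e.symm x) (mfderiv (𝓡 (m + 1)) (𝓡 (m + 1)) e.symm x Z) := by
          intro Z hZ v hv
          refine (hflatx _ _).trans ?_
          have h1 := hZ _ (hker' x hx v hv)
          have h2 := mfderiv_mfderiv_symm he (hWt x hx).1 Z
          refine mul_eq_zero_of_right _ ?_
          rw [← h2] at h1
          exact h1
        -- The factor of the submersion times the factor of `g` relative to the Euclidean metric of
        -- the chart.
        refine ⟨r' * r, mul_pos hr' hr, fun Z Z' hZ hZ' => ?_⟩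
        have h1 := hrx _ _ (hhorz Z hZ) (hhorz Z' hZ')
        rw [hflatx] at h1
        have h2 := chartMetric_mfderiv h hκ (hsκ x hx) (b := σ (e.symm x))
          (by rw [hs]; exact (κ.left_inv (hWt x hx).2.1).symm)
          (mfderiv (𝓡 (m + 1)) (𝓡 m) σ (e.symm x) (mfderiv (𝓡 (m + 1)) (𝓡 (m + 1)) e.symm x Z))
          (mfderiv (𝓡 (m + 1)) (𝓡 m) σ (e.symm x) (mfderiv (𝓡 (m + 1)) (𝓡 (m + 1)) e.symm x Z'))
        have h3 : ∀ v, fderiv ℝ s x v = mfderiv (𝓡 m) (𝓡 m) κ (σ (e.symm x))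
            (mfderiv (𝓡 (m + 1)) (𝓡 m) σ (e.symm x)
              (mfderiv (𝓡 (m + 1)) (𝓡 (m + 1)) e.symm x v)) := fun v => by
          rw [hs]; exact fderiv_chartMap he hκ hσs (hWt x hx).1 (hWt x hx).2.1 v
        have h4 : chartMetric h κ (s x) (fderiv ℝ s x Z) (fderiv ℝ s x Z') = _ :=
          (congrArg₂ (fun a b => chartMetric h κ (s x) a b) (h3 Z) (h3 Z')).trans (h2.trans h1)
        refine h4.trans ?_
        have h5 := congrArg₂ (fun a b : EuclideanSpace ℝ (Fin (m + 1)) => r' * (r * inner ℝ a b))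
          (mfderiv_mfderiv_symm he (hWt x hx).1 Z) (mfderiv_mfderiv_symm he (hWt x hx).1 Z')
        exact h5.trans (mul_assoc _ _ _).symm)
      (x₀ := x₀) (by rw [hW]; exact ⟨hx₀, hpκ, hpU⟩)
      (X := chartField e X) (Y := chartField e Y)
      (((contDiffOn_mpullback_symm he hU hX).contDiffAt
        ((e.symm.isOpen_inter_preimage hU).mem_nhds ⟨hx₀, hpU⟩)).differentiableAt (by simp))
      (((contDiffOn_mpullback_symm he hU hY).contDiffAt
        ((e.symm.isOpen_inter_preimage hU).mem_nhds ⟨hx₀, hpU⟩)).differentiableAt (by simp))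
      (fun x hx v hv => by
        obtain ⟨r, hr, hflatx⟩ := hflat _ (e.map_target (hWt x hx).1)
        have h1 := (hhor _ (hWt x hx).2.2).1 _ ((hker x hx v).1 hv)
        rw [hflatx] at h1
        have h2 := (mul_eq_zero.1 h1).resolve_left hr.ne'
        have h3 := mfderiv_mfderiv_symm he (hWt x hx).1 v
        exact (congrArg₂ (fun a b : EuclideanSpace ℝ (Fin (m + 1)) => inner ℝ a b)
          (chartField_eq he (hWt x hx).1 X) h3.symm).trans h2)
      (fun x hx v hv => by
        obtain ⟨r, hr, hflatx⟩ := hflat _ (e.map_target (hWt x hx).1)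
        have h1 := (hhor _ (hWt x hx).2.2).2 _ ((hker x hx v).1 hv)
        rw [hflatx] at h1
        have h2 := (mul_eq_zero.1 h1).resolve_left hr.ne'
        have h3 := mfderiv_mfderiv_symm he (hWt x hx).1 v
        exact (congrArg₂ (fun a b : EuclideanSpace ℝ (Fin (m + 1)) => inner ℝ a b)
          (chartField_eq he (hWt x hx).1 Y) h3.symm).trans h2)
      (hker' x₀ (by rw [hW]; exact ⟨hx₀, hpκ, hpU⟩) u hu)
      (fun h0 => by
        obtain ⟨r, hr, hflatx⟩ := hflat _ (e.map_target hx₀)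
        refine hrot ?_
        rw [FlatConformalFlow.rotation, hflatx, mfderiv_mlieBracket he hx₀ (hX.mdifferentiableAt hU hpU)
          (hY.mdifferentiableAt hU hpU)]
        refine mul_eq_zero_of_right _ (mul_eq_zero_of_right _ h0))
  refine ⟨e.source ∩ e ⁻¹' N, e.isOpen_inter_preimage hN, ⟨hpe, ?_⟩,
    VectorField.mpullback (𝓡 (m + 1)) (𝓡 (m + 1)) e V, ?_,
    isConformalKillingOn_mpullback (Nat.succ_ne_zero m) he
      (fun g' hg' q hq => flat_of_represents hg hg' (hflat q hq)) hN hV hK⟩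
  · rw [Set.mem_preimage, e.right_inv hx₀]; exact hxN
  · rintro q ⟨hq, hqN⟩
    obtain ⟨y, hy, rfl⟩ : ∃ y ∈ e.target, e.symm y = q := ⟨e q, e.map_source hq, e.left_inv hq⟩
    have hyN : y ∈ N := by rwa [Set.mem_preimage, e.right_inv hy] at hqN
    rw [mpullback_eq' he hy]
    refine ⟨fun h0 => (hVN y hyN).1 ?_, (hker y (hNW hyN) _).1 (hVN y hyN).2⟩
    have h1 := mfderiv_mfderiv_symm he hy (V y)
    have h2 : mfderiv (𝓡 (m + 1)) (𝓡 (m + 1)) e (e.symm y) _ = _ :=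
      congrArg (fun z => mfderiv (𝓡 (m + 1)) (𝓡 (m + 1)) e (e.symm y) z) h0
    exact h1.symm.trans (h2.trans (map_zero _))
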